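/- Let $d\ge 4$, let $n=\lfloor (d-1)/2\rfloor$, and consider $(\mathbb C^d)^{\otimes 3}$ with parties $A,B,C$ and computational basis $|p\rangle_A|q\rangle_B|r\rangle_C$, $0\le p,q,r\le d-1$. For each layer $k=0,\dots,n-1$ (counted from the outside) put $L=k$, $H=d-1-k$, $m_k=H-L$; let $\{\eta_i\}_{i=0}^{m_k-1}$ be nonzero, pairwise orthogonal linear combinations of $|L\rangle,\dots,|H-1\rangle$ with $\eta_0=|L\rangle+\dots+|H-1\rangle$, and $\{\xi_j\}_{j=0}^{m_k-1}$ nonzero, pairwise orthogonal linear combinations of $|L+1\rangle,\dots,|H\rangle$ with $\xi_0=|L+1\rangle+\dots+|H\rangle$ (the families depend on $k$). The facial blocks of layer $k$ are, with $0\le i,j<m_k$ and tensor factors in the order $A,B,C$, $$\mathcal B_1=\{|L\rangle\,\eta_i\,\xi_j\},\quad \mathcal B_2=\{\eta_i\,|H\rangle\,\xi_j\},\quad \mathcal B_3=\{|H\rangle\,\xi_j\,\eta_i\},$$ $$\mathcal B_4=\{\eta_i\,\xi_j\,|L\rangle\},\quad \mathcal B_5=\{\xi_j\,|L\rangle\,\eta_i\},\quad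 \mathcal B_6=\{\xi_j\,\eta_i\,|H\rangle\}.$$ Write $\psi(i,j)^{(k)}_p$ for the elements of $\mathcal B^{(k)}_p$. For odd $d$ let $\mathcal B_0=\{|aaa\rangle: 0\le a<d\}$ and $\mathcal B_0'=\emptyset$. For even $d$ let $\mathcal B_0=\{|aaa\rangle: a\ne \tfrac d2-1,\tfrac d2\}$ and $\mathcal B_0'=\{\phi_l\otimes\phi_m\otimes\phi_p: l,m,p\in\{0,1\}\}$ with $\phi_{0}=|\tfrac d2-1\rangle+|\tfrac d2\rangle$, $\phi_1=|\tfrac d2-1\rangle-|\tfrac d2\rangle$. Let $|S\rangle=(\sum_{a=0}^{d-1}|a\rangle)^{\otimes 3}$ and $$\mathcal U_{PB}=\bigcup_{k,p}\bigl(\mathcal B^{(k)}_p\setminus\{\psi(0,0)^{(k)}_p\}\bigr)\cup\bigl(\mathcal B_0'\setminus\{\phi_0\otimes\phi_0\otimes\phi_0\}\bigr)\cup\{|S\rangle\},$$ $$\mathcal U^{S}_{BB}=\mathcal U_{PB}\cup\bigcup_k\{\psi^{(k)-}_{12},\psi^{(k)-}_{34},\psi^{(k)-}_{56}\},\qquad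 \mathcal U^{AB|C}_{BB}=\mathcal U_{PB}\cup\bigcup_k\{\psi^{(k)-}_{12},\psi^{(k)-}_{35},\psi^{(k)-}_{(L)4},\psi^{(k)-}_{(H)6}\},$$ where $\psi^{(k)-}_{pq}=\psi(0,0)^{(k)}_p-\psi(0,0)^{(k)}_q$ and $\psi^{(k)-}_{(a)p}=m_k^2|aaa\rangle-\psi(0,0)^{(k)}_p$. A vector is biseparable if it is a tensor product across at least one of the bipartitions $A|BC$, $B|AC$, $C|AB$. A UPB (UBB) is a set of nonzero pairwise orthogonal fully product (biseparable) vectors that spans a proper subspace whose orthogonal complement contains no nonzero fully product (biseparable) vector; a UPB in a cut is defined in the same way with vectors that are product across that cut. A density matrix is genuinely entangled if it is not a convex mixture of pure biseparable states. A bipartite state $\rho$ is $1$-distillable if local filters $F,G$ into $\mathbb C^2$ exist such that $(F\otimes G)\rho(F\otimes G)^\dagger$ has a non-positive partial transpose, distillable if $\rho^{\otimes N}$ is $1$-distillable for some $N\ge1$, and bound entangled if it is not separable and not distillable. Such families $\eta,\xi$ exist, and for every choice of them: 1. $\mathcal B_0\cup\mathcal B_0'\cup\bigcup_{k,p}\mathcal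 B^{(k)}_p$ is an orthogonal product basis of $(\mathbb C^d)^{\otimes3}$. 2. $\mathcal U_{PB}$ is a UPB with $d^3-8n$ elements; its complementary subspace has dimension $8n$. 3. $\mathcal U^{S}_{BB}$ is a UBB with $d^3-5n$ elements; its complementary subspace has dimension $5n$. 4. Every density matrix supported on the complementary subspace of $\mathcal U^{S}_{BB}$ is genuinely entangled, and it is $1$-distillable (hence distillable) across every bipartition. 5. $\mathcal U^{AB|C}_{BB}$ is a UBB, and a UPB in the cut $AB|C$, with $d^3-4n$ elements; its complementary subspace has dimension $4n$, and every density matrix supported on it is genuinely entangled. 6. The normalized projector onto the complementary subspace of $\mathcal U^{AB|C}_{BB}$ has positive partial transpose and is bound entangled in the cut $AB|C$, and it is $1$-distillable in the cuts $A|BC$ and $B|AC$. 7. The normalized projector onto the complementary subspace of $\mathcal U_{PB}$ has positive partial transpose and is bound entangled in every bipartition. Moreover, for every bipartition $\alpha|\beta$ of the three parties and every subspace $\mathcal S\subseteq(\mathbb C^d)^{\otimes3}$ with orthogonal projector $P$: if $\operatorname{rank}P<\max[\operatorname{rank}\operatorname{Tr}_\beta P,\operatorname{rank}\operatorname{Tr}_\alpha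 P]$, then every density matrix of rank $\dim\mathcal S$ supported on $\mathcal S$ is $1$-distillable across $\alpha|\beta$. -/

import Mathlib

open scoped Kronecker ComplexOrder

namespace BlockCube

noncomputable section

/-! ## Three qudits, bipartitions, product vectors -/

/-- The local space `ℂ^d`. -/
abbrev Qudit (d : ℕ) : Type := EuclideanSpace ℂ (Fin d)

/-- Labels `(p, q, r)` of the basic blocks of the `d × d × d` block-cube. -/
abbrev Cube (d : ℕ) : Type := Fin d × Fin d × Fin d

/-- The space `(ℂ^d)^{⊗3}` of Alice, Bob and Charlie, in the computational basis. -/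
abbrev ThreeQudit (d : ℕ) : Type := EuclideanSpace ℂ (Cube d)

/-- The computational basis vector `|k⟩`. -/
def ket {d : ℕ} (k : Fin d) : Qudit d := EuclideanSpace.single k 1

/-- The product vector `|x⟩_A ⊗ |y⟩_B ⊗ |z⟩_C`. -/
def tri {d : ℕ} (x y z : Qudit d) : ThreeQudit d :=
  WithLp.toLp 2 fun t => x t.1 * y t.2.1 * z t.2.2

/-- The three bipartitions `A|BC`, `B|AC`, `C|AB` of the parties `A`, `B`, `C`. -/
inductive Cut
  | A_BC
  | B_AC
  | C_AB

/-- Regrouping of the three party indices along a bipartition: the single party first, then the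
pair of the two other parties. -/
def cutEquiv (d : ℕ) : Cut → Cube d ≃ Fin d × (Fin d × Fin d)
  | .A_BC => Equiv.refl _
  | .B_AC =>
    { toFun := fun t => (t.2.1, t.1, t.2.2)
      invFun := fun s => (s.2.1, s.1, s.2.2)
      left_inv := fun _ => rfl
      right_inv := fun _ => rfl }
  | .C_AB =>
    { toFun := fun t => (t.2.2, t.1, t.2.1)
      invFun := fun s => (s.2.1, s.2.2, s.1)
      left_inv := fun _ => rfl
      right_inv := fun _ => rfl }

/-- Fully product vectors. -/
def IsFullyProduct {d : ℕ} (v : ThreeQudit d) : Prop :=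
  ∃ x y z : Qudit d, v = tri x y z

/-- Vectors that are a tensor product across the bipartition `c`. -/
def IsProductAcross {d : ℕ} (c : Cut) (v : ThreeQudit d) : Prop :=
  ∃ (x : Qudit d) (y : EuclideanSpace ℂ (Fin d × Fin d)),
    ∀ t : Cube d, v t = x (cutEquiv d c t).1 * y (cutEquiv d c t).2

/-- Biseparable vectors: product across at least one bipartition. -/
def IsBiseparable {d : ℕ} (v : ThreeQudit d) : Prop :=
  ∃ c : Cut, IsProductAcross c v

/-! ## Orthogonal, unextendible and complete bases of a given type -/

/-- `U` is a set of nonzero pairwise orthogonal vectors with the property `P`. -/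
structure IsOrthogonalFamily {d : ℕ} (P : ThreeQudit d → Prop) (U : Set (ThreeQudit d)) :
    Prop where
  ne_zero : ∀ v ∈ U, v ≠ 0
  orthogonal : U.Pairwise fun v w => inner ℂ v w = 0
  mem : ∀ v ∈ U, P v

/-- An orthogonal basis of the whole space consisting of product vectors. -/
def IsOrthogonalProductBasis {d : ℕ} (U : Set (ThreeQudit d)) : Prop :=
  IsOrthogonalFamily IsFullyProduct U ∧ Submodule.span ℂ U = ⊤

/-- The subspace complementary (orthogonal) to the span of `U`. -/
def complementary {d : ℕ} (U : Set (ThreeQudit d)) : Submodule ℂ (ThreeQudit d) :=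
  (Submodule.span ℂ U)ᗮ

/-- `U` consists of nonzero pairwise orthogonal vectors with the property `P`, spans a proper
subspace, and no nonzero vector with the property `P` is orthogonal to all of `U`. -/
structure IsUnextendible {d : ℕ} (P : ThreeQudit d → Prop) (U : Set (ThreeQudit d)) :
    Prop where
  family : IsOrthogonalFamily P U
  proper : Submodule.span ℂ U ≠ ⊤
  unextendible : ∀ v ∈ complementary U, P v → v = 0

/-- Unextendible product basis. -/
def IsUPB {d : ℕ} (U : Set (ThreeQudit d)) : Prop := IsUnextendible IsFullyProduct U

/-- Unextendible biseparable basis. -/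
def IsUBB {d : ℕ} (U : Set (ThreeQudit d)) : Prop := IsUnextendible IsBiseparable U

/-- Unextendible product basis of the bipartite system obtained by the bipartition `c`. -/
def IsUPBAcross {d : ℕ} (c : Cut) (U : Set (ThreeQudit d)) : Prop :=
  IsUnextendible (IsProductAcross c) U

/-! ## Density matrices, separability, distillability -/

/-- Density matrices. -/
def IsDensity {ι : Type*} [Fintype ι] (ρ : Matrix ι ι ℂ) : Prop :=
  ρ.PosSemidef ∧ ρ.trace = 1

/-- The rank one operator `|v⟩⟨v|`. -/
def pureState {ι : Type*} (v : EuclideanSpace ℂ ι) : Matrix ι ι ℂ :=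
  Matrix.of fun s t => v s * star (v t)

/-- `ρ` is supported on `S`: the range of `ρ` is contained in `S`. -/
def SupportedOn {ι : Type*} [Fintype ι] (ρ : Matrix ι ι ℂ)
    (S : Submodule ℂ (EuclideanSpace ℂ ι)) : Prop :=
  ∀ v : ι → ℂ, WithLp.toLp 2 (ρ.mulVec v) ∈ S

/-- The matrix of the orthogonal projector onto `S`. -/
def projMatrix {ι : Type*} [Fintype ι] [DecidableEq ι]
    (S : Submodule ℂ (EuclideanSpace ℂ ι)) : Matrix ι ι ℂ :=
  Matrix.of fun s t => S.starProjection (EuclideanSpace.single t (1 : ℂ)) s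

/-- The normalized projector onto `S`. -/
def projState {ι : Type*} [Fintype ι] [DecidableEq ι]
    (S : Submodule ℂ (EuclideanSpace ℂ ι)) : Matrix ι ι ℂ :=
  ((Module.finrank ℂ S : ℂ)⁻¹) • projMatrix S

/-- A three-qudit density matrix is genuinely entangled if it is not a convex mixture of
biseparable pure states (which may be product across different bipartitions). -/
def IsGenuinelyEntangled {d : ℕ} (ρ : Matrix (Cube d) (Cube d) ℂ) : Prop :=
  ρ ∉ convexHull ℝ {σ | ∃ v : ThreeQudit d, ‖v‖ = 1 ∧ IsBiseparable v ∧ σ = pureState v}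

/-- A three-qudit operator regarded as an operator of the bipartite system given by `c`. -/
def across {d : ℕ} (c : Cut) (ρ : Matrix (Cube d) (Cube d) ℂ) :
    Matrix (Fin d × (Fin d × Fin d)) (Fin d × (Fin d × Fin d)) ℂ :=
  Matrix.reindex (cutEquiv d c) (cutEquiv d c) ρ

section Bipartite

variable {α β : Type*}

/-- Bipartite product pure states: `v (a, b) = x a * y b`. -/
def IsProduct (v : EuclideanSpace ℂ (α × β)) : Prop :=
  ∃ (x : EuclideanSpace ℂ α) (y : EuclideanSpace ℂ β), ∀ t : α × β, v t = x t.1 * y t.2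

/-- Separable states: convex mixtures of product pure states. -/
def IsSeparable [Fintype α] [Fintype β] (ρ : Matrix (α × β) (α × β) ℂ) : Prop :=
  ρ ∈ convexHull ℝ {σ | ∃ v : EuclideanSpace ℂ (α × β),
    ‖v‖ = 1 ∧ IsProduct v ∧ σ = pureState v}

/-- Partial transposition in the second factor. -/
def partialTranspose (ρ : Matrix (α × β) (α × β) ℂ) : Matrix (α × β) (α × β) ℂ :=
  Matrix.of fun s t => ρ (s.1, t.2) (t.1, s.2)

/-- Positive partial transpose. -/
def IsPPT [Fintype α] [Fintype β] (ρ : Matrix (α × β) (α × β) ℂ) : Prop :=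
  (partialTranspose ρ).PosSemidef

/-- The reduced operator of the first factor (partial trace over the second factor). -/
def reducedFst [Fintype β] (ρ : Matrix (α × β) (α × β) ℂ) : Matrix α α ℂ :=
  Matrix.of fun a a' => ∑ b, ρ (a, b) (a', b)

/-- The reduced operator of the second factor (partial trace over the first factor). -/
def reducedSnd [Fintype α] (ρ : Matrix (α × β) (α × β) ℂ) : Matrix β β ℂ :=
  Matrix.of fun b b' => ∑ a, ρ (a, b) (a, b')

/-- `1`-distillability of a bipartite state: local filters into a two-qubit system turn a single
copy of `ρ` into an (unnormalized) two-qubit state with negative partial transpose. -/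
def IsOneDistillable [Fintype α] [Fintype β] (ρ : Matrix (α × β) (α × β) ℂ) : Prop :=
  ∃ (F : Matrix (Fin 2) α ℂ) (G : Matrix (Fin 2) β ℂ),
    ¬ IsPPT ((F ⊗ₖ G) * ρ * (F ⊗ₖ G).conjTranspose)

/-- The bipartite state of `n` copies of `ρ`, each side holding its `n` subsystems. -/
def copies (n : ℕ) (ρ : Matrix (α × β) (α × β) ℂ) :
    Matrix ((Fin n → α) × (Fin n → β)) ((Fin n → α) × (Fin n → β)) ℂ :=
  Matrix.of fun s t => ∏ i, ρ (s.1 i, s.2 i) (t.1 i, t.2 i)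

/-- Distillable: some finite number of copies is `1`-distillable. -/
def IsDistillable [Fintype α] [Fintype β] (ρ : Matrix (α × β) (α × β) ℂ) : Prop :=
  ∃ n : ℕ, 1 ≤ n ∧ IsOneDistillable (copies n ρ)

/-- Bound entangled: entangled, but not distillable. -/
def IsBoundEntangled [Fintype α] [Fintype β] (ρ : Matrix (α × β) (α × β) ℂ) : Prop :=
  ¬ IsSeparable ρ ∧ ¬ IsDistillable ρ

end Bipartite

/-! ## The layered block structure

The layers of facial blocks are indexed from the outside by `k = 0, 1, …, ⌊(d-1)/2⌋ - 1`. Layer `k`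
lives on the faces of the sub-cube with coordinates from `low = k` to `high = d - 1 - k`. -/

/-- Number of layers: `(d-1)/2` for odd `d`, and `d/2 - 1` for even `d`. -/
def numLayers (d : ℕ) : ℕ := (d - 1) / 2

/-- `high - low` for layer `k`, the side length of the facial blocks of that layer. -/
def side (d : ℕ) (k : Fin (numLayers d)) : ℕ := d - 1 - 2 * (k : ℕ)

theorem two_mul_lt {d : ℕ} (k : Fin (numLayers d)) : 2 * (k : ℕ) + 2 < d := by
  have := k.2
  unfold numLayers at this
  omega

theorem side_pos {d : ℕ} (k : Fin (numLayers d)) : 0 < side d k := by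
  have := two_mul_lt k
  unfold side
  omega

/-- The lowest coordinate of layer `k`. -/
def low {d : ℕ} (k : Fin (numLayers d)) : Fin d :=
  ⟨k, by have := two_mul_lt k; omega⟩

/-- The highest coordinate of layer `k`. -/
def high {d : ℕ} (k : Fin (numLayers d)) : Fin d :=
  ⟨d - 1 - k, by have := two_mul_lt k; omega⟩

/-- The index `0` of the families `η`, `ξ` of layer `k`. -/
def zeroIdx {d : ℕ} (k : Fin (numLayers d)) : Fin (side d k) := ⟨0, side_pos k⟩

/-- A choice of the local vectors of all layers. In layer `k`, `η_0 = |low⟩ + ⋯ + |high - 1⟩` is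
completed by linear combinations of `|low⟩, …, |high - 1⟩` to a family of `high - low` nonzero
pairwise orthogonal vectors, and similarly `ξ_0 = |low + 1⟩ + ⋯ + |high⟩`. -/
structure LayerVectors (d : ℕ) where
  eta : (k : Fin (numLayers d)) → Fin (side d k) → Qudit d
  xi : (k : Fin (numLayers d)) → Fin (side d k) → Qudit d
  eta_zero : ∀ k, eta k (zeroIdx k) = ∑ a ∈ Finset.Ico (low k) (high k), ket a
  xi_zero : ∀ k, xi k (zeroIdx k) = ∑ a ∈ Finset.Ioc (low k) (high k), ket a
  eta_mem : ∀ k i, eta k i ∈ Submodule.span ℂ (ket '' Set.Ico (low k) (high k))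
  xi_mem : ∀ k j, xi k j ∈ Submodule.span ℂ (ket '' Set.Ioc (low k) (high k))
  eta_ne_zero : ∀ k i, eta k i ≠ 0
  xi_ne_zero : ∀ k j, xi k j ≠ 0
  eta_orthogonal : ∀ k, Pairwise fun i i' => inner ℂ (eta k i) (eta k i') = 0
  xi_orthogonal : ∀ k, Pairwise fun j j' => inner ℂ (xi k j) (xi k j') = 0

/-- The six facial blocks of a layer. -/
inductive Face
  | f1
  | f2
  | f3
  | f4
  | f5
  | f6

section Construction

variable {d : ℕ} (V : LayerVectors d)

/-- The state `|ψ(i,j)⟩` of the facial block `p` of layer `k`. -/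
def psi (k : Fin (numLayers d)) (p : Face) (i j : Fin (side d k)) : ThreeQudit d :=
  match p with
  | .f1 => tri (ket (low k)) (V.eta k i) (V.xi k j)
  | .f2 => tri (V.eta k i) (ket (high k)) (V.xi k j)
  | .f3 => tri (ket (high k)) (V.xi k j) (V.eta k i)
  | .f4 => tri (V.eta k i) (V.xi k j) (ket (low k))
  | .f5 => tri (V.xi k j) (ket (low k)) (V.eta k i)
  | .f6 => tri (V.xi k j) (V.eta k i) (ket (high k))

/-- The state `|ψ(0,0)⟩` of the facial block `p` of layer `k`. -/
def psi00 (k : Fin (numLayers d)) (p : Face) : ThreeQudit d :=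
  psi V k p (zeroIdx k) (zeroIdx k)

/-- The facial block `p` of layer `k`. -/
def faceBlock (k : Fin (numLayers d)) (p : Face) : Set (ThreeQudit d) :=
  {v | ∃ i j : Fin (side d k), v = psi V k p i j}

/-- The basic block states `|kkk⟩`. -/
def diag (a : Fin d) : ThreeQudit d := tri (ket a) (ket a) (ket a)

/-- For even `d`, the two middle coordinates `d/2 - 1` and `d/2`; none for odd `d`. -/
def IsMiddle (a : Fin d) : Prop := Even d ∧ (2 * (a : ℕ) + 2 = d ∨ 2 * (a : ℕ) = d)

/-- The body-diagonal block: all `|kkk⟩`, except the two middle ones for even `d`. -/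
def diagBlock (d : ℕ) : Set (ThreeQudit d) := {v | ∃ a : Fin d, ¬ IsMiddle a ∧ v = diag a}

/-- For even `d`, `|φ_0⟩ = |d/2 - 1⟩ + |d/2⟩` and `|φ_1⟩ = |d/2 - 1⟩ - |d/2⟩`. -/
def phi (d : ℕ) (l : Fin 2) : Qudit d :=
  WithLp.toLp 2 fun a =>
    if 2 * (a : ℕ) + 2 = d then 1 else if 2 * (a : ℕ) = d then (-1) ^ (l : ℕ) else 0

/-- The central `2 × 2 × 2` block for even `d` (empty for odd `d`). -/
def centralBlock (d : ℕ) : Set (ThreeQudit d) :=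
  {v | Even d ∧ ∃ l m p : Fin 2, v = tri (phi d l) (phi d m) (phi d p)}

/-- The layered twisted product basis. -/
def twistedBasis : Set (ThreeQudit d) :=
  diagBlock d ∪ centralBlock d ∪ ⋃ (k : Fin (numLayers d)) (p : Face), faceBlock V k p

/-- The stopper state `|0 + 1 + ⋯ + (d-1)⟩^{⊗3}`. -/
def stopper (d : ℕ) : ThreeQudit d := tri (∑ a, ket a) (∑ a, ket a) (∑ a, ket a)

/-- The set `U_PB`. -/
def productBasis : Set (ThreeQudit d) :=
  (⋃ (k : Fin (numLayers d)) (p : Face), (faceBlock V k p \ {psi00 V k p})) ∪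
    (centralBlock d \ {tri (phi d 0) (phi d 0) (phi d 0)}) ∪ {stopper d}

/-- `|ψ⟩^-_{pq} = |ψ(0,0)⟩_p - |ψ(0,0)⟩_q` in layer `k`. -/
def psiMinus (k : Fin (numLayers d)) (p q : Face) : ThreeQudit d :=
  psi00 V k p - psi00 V k q

/-- `|ψ⟩^-_{(a)p} = m² |aaa⟩ - |ψ(0,0)⟩_p` in layer `k`, with `m²` the number of basic blocks in
a facial block of that layer. -/
def psiMinusDiag (k : Fin (numLayers d)) (a : Fin d) (p : Face) : ThreeQudit d :=
  ((side d k : ℂ) ^ 2) • diag a - psi00 V k p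

/-- The symmetric set of biseparable vectors. -/
def symmetricBasis : Set (ThreeQudit d) :=
  productBasis V ∪ ⋃ k : Fin (numLayers d),
    {psiMinus V k .f1 .f2, psiMinus V k .f3 .f4, psiMinus V k .f5 .f6}

/-- The asymmetric set of biseparable vectors, for the cut `AB|C`. -/
def asymmetricBasis : Set (ThreeQudit d) :=
  productBasis V ∪ ⋃ k : Fin (numLayers d),
    {psiMinus V k .f1 .f2, psiMinus V k .f3 .f5,
      psiMinusDiag V k (low k) .f4, psiMinusDiag V k (high k) .f6}

end Construction

end

end BlockCube

/-! The labels `(p, q, r)` form a cube, which splits into cells: in each layer six faces, numbered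
like the blocks, and two corners, and in the middle a core. The basis vectors of a cell other than
its indicator vector span the vectors on that cell with zero sum. Hence a vector is orthogonal to
`U_PB` iff it is constant on every cell and its entries add up to zero; each difference `ψ⁻` in
addition equates its values on two cells. All dimensions follow by counting cells.

A product vector across a cut is a matrix whose `2 × 2` minors vanish, its rows being slices of the
cube. For a fully product vector orthogonal to `U_PB`, and for a product vector across any cut
orthogonal to the asymmetric basis, the minors show that the entries in and inside the outermost
layer are `0` or one number `v`, and zero sum gives `v = 0`. Removing layers one at a time, the
vector vanishes. The cyclic symmetry of the cells reduces every cut to `A|BC`.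

A positive matrix is the Gram matrix of vectors `Φ t`, and a condition on its support becomes the
same condition on the family `Φ`. Put `T x y = ∑ x a • y b • Φ (a, b)`. If the matrix is not
`1`-distillable, then `T x y = 0` implies `⟪T x y', T x' y⟫ = 0`: a positive partial transpose with
a zero on the diagonal has a zero row. Product vectors satisfy the same implication, so one layer
argument shows that the symmetric basis is unextendible and that all states on its complement are
`1`-distillable: the orthogonality relations give `⟪Φ t, v⟫ ∈ {0, ⟪v, v⟫}` for each value `v` in the
layer, and zero sum again gives `v = 0`. For the asymmetric basis the relations in a single layer
equate two values of `Φ` that differ. For the rank criterion, choose `x` with `ker (T x)` of least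
dimension: the implication forces it into every `ker (T x')`, which bounds the rank of the reduced
state by that of the state.

The partial transpose of the projector onto the span of orthogonal product vectors is again such a
projector, so the complementary projector is PPT, hence undistillable. A separable state has a
support spanned by product vectors; for `U_PB` these exist, but in the outermost layer their values
on two faces cancel, which fails for some vector of the complement. -/

namespace BlockCube

noncomputable section

open Matrix Module

section Gram

variable {ι H : Type*} [Finite ι] [NormedAddCommGroup H] [InnerProductSpace ℂ H]

theorem exists_eq_gram {ρ : Matrix ι ι ℂ} (h : ρ.PosSemidef) :
    ∃ (m : ℕ) (Φ : ι → EuclideanSpace ℂ (Fin m)), ρ = gram ℂ Φ := by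
  obtain ⟨m, v, rfl⟩ := posSemidef_iff_eq_sum_vecMulVec.1 h
  refine ⟨m, fun t => WithLp.toLp 2 fun i => star (v i t), ?_⟩
  ext s t
  simp [gram_apply, PiLp.inner_apply, Matrix.sum_apply, vecMulVec_apply, mul_comm]

theorem gram_mulVec_eq_zero_iff [Fintype ι] (Φ : ι → H) (u : ι → ℂ) :
    gram ℂ Φ *ᵥ u = 0 ↔ ∑ t, u t • Φ t = 0 := by
  rw [← (posSemidef_gram ℂ Φ).dotProduct_mulVec_zero_iff, star_dotProduct_gram_mulVec,
    inner_self_eq_zero]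

theorem finrank_range_le_of_ker_le {K V V₁ V₂ : Type*} [DivisionRing K] [AddCommGroup V]
    [Module K V] [FiniteDimensional K V] [AddCommGroup V₁] [Module K V₁] [AddCommGroup V₂]
    [Module K V₂] {f : V →ₗ[K] V₁} {g : V →ₗ[K] V₂} (h : LinearMap.ker g ≤ LinearMap.ker f) :
    finrank K (LinearMap.range f) ≤ finrank K (LinearMap.range g) := by
  have hf := f.finrank_range_add_finrank_ker
  have hg := g.finrank_range_add_finrank_ker
  have := Submodule.finrank_mono h
  omega

theorem rank_gram [Fintype ι] (Φ : ι → H) :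
    (gram ℂ Φ).rank = finrank ℂ (LinearMap.range (Fintype.linearCombination ℂ Φ)) := by
  have h : LinearMap.ker (gram ℂ Φ).mulVecLin = LinearMap.ker (Fintype.linearCombination ℂ Φ) := by
    ext u
    simp [gram_mulVec_eq_zero_iff, Fintype.linearCombination_apply]
  exact (finrank_range_le_of_ker_le h.ge).antisymm (finrank_range_le_of_ker_le h.le)

end Gram

section FilterFree

variable {X Y H : Type*} [AddCommGroup X] [Module ℂ X] [AddCommGroup Y] [Module ℂ Y]
  [NormedAddCommGroup H] [InnerProductSpace ℂ H]

/-- When `T x y` is the combination, with the coefficients of `x ⊗ y`, of vectors with Gram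
matrix `ρ`, this condition holds if no pair of local filters onto qubits maps `ρ` to a state whose
partial transpose has a zero on the diagonal but not in the rest of that row. -/
def IsFilterFree (T : X →ₗ[ℂ] Y →ₗ[ℂ] H) : Prop :=
  ∀ x x' y y', T x y = 0 → inner ℂ (T x y') (T x' y) = 0

theorem IsFilterFree.flip {T : X →ₗ[ℂ] Y →ₗ[ℂ] H} (hT : IsFilterFree T) :
    IsFilterFree T.flip := fun x x' y y' h => by
  rw [LinearMap.flip_apply, LinearMap.flip_apply, inner_eq_zero_symm]
  exact hT y y' x x' h

theorem IsFilterFree.inner_eq_zero_of_ne {T : X →ₗ[ℂ] Y →ₗ[ℂ] H} (hT : IsFilterFree T)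
    {x x' : X} {y z : Y} {s t : ℂ} (hst : s ≠ t) (hy : T (x + s • x') y = 0)
    (hz : T (x + t • x') z = 0) : inner ℂ (T x' y) (T x' z) = 0 := by
  have hxy : T (x + t • x') y = (t - s) • T x' y := by
    rw [← sub_zero (T (x + t • x') y), ← hy]
    simp only [map_add, map_smul, LinearMap.add_apply, LinearMap.smul_apply]
    module
  have h := hT (x + t • x') x' z y hz
  rw [hxy, inner_smul_left, mul_eq_zero, map_eq_zero, sub_eq_zero] at h
  exact h.resolve_left hst.symm

variable [FiniteDimensional ℂ Y]

/-- If some `y ∈ ker (T x)` were outside `ker (T x')`, with `ker (T x)` of least dimension, every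
`ker (T (x + t • x'))` would contain a `z t` outside `ker (T x')`, and the vectors `T x' (z t)`
would be infinitely many nonzero orthogonal ones. -/
theorem IsFilterFree.exists_forall_ker_le {T : X →ₗ[ℂ] Y →ₗ[ℂ] H} (hT : IsFilterFree T) :
    ∃ x, ∀ x', LinearMap.ker (T x) ≤ LinearMap.ker (T x') := by
  let δ : X → ℕ := fun x => finrank ℂ (LinearMap.ker (T x))
  refine ⟨Function.argmin δ, fun x' => ?_⟩
  set x := Function.argmin δ
  by_contra hle
  have hlt : finrank ℂ ↥(LinearMap.ker (T x) ⊓ LinearMap.ker (T x')) < δ x :=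
    Submodule.finrank_lt_finrank_of_lt (inf_le_left.lt_of_ne fun h => hle (inf_eq_left.1 h))
  have exists_z : ∀ t : ℂ, ∃ z, T (x + t • x') z = 0 ∧ T x' z ≠ 0 := by
    intro t
    by_contra! hz
    refine hlt.not_ge ((Function.argmin_le δ (x + t • x')).trans (Submodule.finrank_mono ?_))
    refine fun z hz' => ⟨?_, hz z hz'⟩
    simpa [hz z hz'] using hz'
  choose z hz hz' using exists_z
  have hind : LinearIndependent ℂ (T x' ∘ z) :=
    linearIndependent_of_ne_zero_of_inner_eq_zero hz'
      fun s t hst => hT.inner_eq_zero_of_ne hst (hz s) (hz t)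
  exact Module.Finite.not_linearIndependent_of_infinite z (hind.of_comp _)

end FilterFree

section Distillation

variable {α β H : Type*} [Fintype α] [Fintype β] [NormedAddCommGroup H] [InnerProductSpace ℂ H]

/-- The combination of the vectors `Φ` with the coefficients of `x ⊗ y`. -/
def pairing (Φ : α × β → H) : (α → ℂ) →ₗ[ℂ] (β → ℂ) →ₗ[ℂ] H :=
  LinearMap.mk₂ ℂ (fun x y => ∑ t, (x t.1 * y t.2) • Φ t)
    (fun x x' y => by simp [add_mul, add_smul, Finset.sum_add_distrib])
    (fun c x y => by simp [Finset.smul_sum, mul_smul])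
    (fun x y y' => by simp [mul_add, add_smul, Finset.sum_add_distrib])
    (fun c x y => by simp [Finset.smul_sum, smul_smul, mul_left_comm])

theorem pairing_apply (Φ : α × β → H) (x : α → ℂ) (y : β → ℂ) :
    pairing Φ x y = ∑ t, (x t.1 * y t.2) • Φ t := rfl

theorem pairing_single_left [DecidableEq α] (Φ : α × β → H) (a : α) (y : β → ℂ) :
    pairing Φ (Pi.single a 1) y = ∑ b, y b • Φ (a, b) := by
  rw [pairing_apply, Fintype.sum_prod_type, Finset.sum_eq_single a] <;> simp +contextual

theorem pairing_single [DecidableEq α] [DecidableEq β] (Φ : α × β → H) (a : α) (b : β) :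
    pairing Φ (Pi.single a 1) (Pi.single b 1) = Φ (a, b) := by
  rw [pairing_single_left, Finset.sum_eq_single b] <;> simp +contextual

theorem pairing_comp_swap (Φ : α × β → H) : pairing (Φ ∘ Prod.swap) = (pairing Φ).flip := by
  ext x y
  rw [LinearMap.flip_apply, pairing_apply, pairing_apply, ← Equiv.sum_comp (Equiv.prodComm β α)]
  simp [mul_comm]

theorem filtered_gram_apply (Φ : α × β → H) (F : Matrix (Fin 2) α ℂ) (G : Matrix (Fin 2) β ℂ)
    (s t : Fin 2 × Fin 2) :
    ((F ⊗ₖ G) * gram ℂ Φ * (F ⊗ₖ G)ᴴ) s t =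
      inner ℂ (pairing Φ (star (F s.1)) (star (G s.2)))
        (pairing Φ (star (F t.1)) (star (G t.2))) := by
  rw [pairing_apply, pairing_apply, ← star_dotProduct_gram_mulVec Φ
    (fun r => star (F s.1) r.1 * star (G s.2) r.2), dotProduct_mulVec, Matrix.mul_apply]
  simp [dotProduct, vecMul, Matrix.mul_apply]

theorem isFilterFree_pairing {Φ : α × β → H} (h : ¬ IsOneDistillable (gram ℂ Φ)) :
    IsFilterFree (pairing Φ) := by
  intro x x' y y' hxy
  let F : Matrix (Fin 2) α ℂ := of ![star x, star x']
  let G : Matrix (Fin 2) β ℂ := of ![star y, star y']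
  have hF : star (F 0) = x ∧ star (F 1) = x' := ⟨star_star x, star_star x'⟩
  have hG : star (G 0) = y ∧ star (G 1) = y' := ⟨star_star y, star_star y'⟩
  have hPPT : IsPPT ((F ⊗ₖ G) * gram ℂ Φ * (F ⊗ₖ G)ᴴ) := not_not.1 fun hn => h ⟨F, G, hn⟩
  have hdiag := (hPPT.dotProduct_mulVec_zero_iff (Pi.single (0, 0) 1)).1 (by
    simp [partialTranspose, filtered_gram_apply, hF, hG, hxy])
  have hentry := congrFun hdiag (1, 1)
  simp only [mulVec_single_one, Pi.zero_apply, col_apply, partialTranspose, of_apply,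
    filtered_gram_apply, hF, hG] at hentry
  exact inner_eq_zero_symm.1 hentry

omit [Fintype β] in
theorem reducedSnd_gram (Φ : α × β → H) :
    reducedSnd (gram ℂ Φ) = gram ℂ fun b => WithLp.toLp 2 fun a => Φ (a, b) := by
  ext b b'
  simp [reducedSnd, gram_apply, PiLp.inner_apply]

theorem rank_reducedSnd_gram_le {Φ : α × β → H} {x : α → ℂ}
    (hx : ∀ x', LinearMap.ker (pairing Φ x) ≤ LinearMap.ker (pairing Φ x')) :
    (reducedSnd (gram ℂ Φ)).rank ≤ (gram ℂ Φ).rank := by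
  classical
  rw [reducedSnd_gram, rank_gram, rank_gram]
  calc
    _ ≤ finrank ℂ (LinearMap.range (pairing Φ x)) := by
      refine finrank_range_le_of_ker_le fun y hy => ?_
      rw [LinearMap.mem_ker]
      ext a
      simpa [pairing_single_left, Fintype.linearCombination_apply] using hx (Pi.single a 1) hy
    _ ≤ _ := by
      refine Submodule.finrank_mono ?_
      rintro _ ⟨y, rfl⟩
      exact ⟨fun t => x t.1 * y t.2, rfl⟩

theorem rank_submatrix_swap {α β : Type*} [Fintype α] [Fintype β] (ρ : Matrix (α × β) (α × β) ℂ) :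
    (ρ.submatrix Prod.swap Prod.swap).rank = ρ.rank :=
  rank_submatrix ρ (Equiv.prodComm β α) (Equiv.prodComm β α)

/-- Only the kernel of `σ` matters, so the rank of `σ` stands for that of every state with the
same support. -/
theorem max_rank_reduced_le {ρ σ : Matrix (α × β) (α × β) ℂ} (hρ : ρ.PosSemidef)
    (hσ : σ.PosSemidef) (hker : ∀ u, ρ *ᵥ u = 0 ↔ σ *ᵥ u = 0) (h : ¬ IsOneDistillable ρ) :
    max (reducedFst σ).rank (reducedSnd σ).rank ≤ σ.rank := by
  obtain ⟨m, Φ, rfl⟩ := exists_eq_gram hρ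
  obtain ⟨n, Ψ, rfl⟩ := exists_eq_gram hσ
  have hΨ : ∀ x y, pairing Ψ x y = 0 ↔ pairing Φ x y = 0 := fun x y => by
    simp_rw [pairing_apply, ← gram_mulVec_eq_zero_iff _ fun t : α × β => x t.1 * y t.2, hker]
  have hfree := isFilterFree_pairing h
  obtain ⟨x, hx⟩ := hfree.exists_forall_ker_le
  obtain ⟨y, hy⟩ := hfree.flip.exists_forall_ker_le
  refine max_le ?_ (rank_reducedSnd_gram_le (x := x) fun x' z hz => ?_)
  · rw [← rank_submatrix_swap (gram ℂ Ψ)]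
    refine rank_reducedSnd_gram_le (Φ := Ψ ∘ Prod.swap) (x := y) fun y' z hz => ?_
    rw [pairing_comp_swap, LinearMap.mem_ker, LinearMap.flip_apply, hΨ] at hz ⊢
    exact hy y' hz
  · rw [LinearMap.mem_ker, hΨ] at hz ⊢
    exact hx x' hz

end Distillation

section Support

variable {ι : Type*} [Fintype ι] [DecidableEq ι]

/-- The range of a matrix, as a subspace of the Hilbert space: for a state, the least subspace it is
supported on. -/
def support (ρ : Matrix ι ι ℂ) : Submodule ℂ (EuclideanSpace ℂ ι) :=
  LinearMap.range (toEuclideanLin ρ)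

theorem supportedOn_iff_support_le {ρ : Matrix ι ι ℂ} {S : Submodule ℂ (EuclideanSpace ℂ ι)} :
    SupportedOn ρ S ↔ support ρ ≤ S :=
  ⟨fun h => by rintro _ ⟨v, rfl⟩; exact h v, fun h v => h ⟨WithLp.toLp 2 v, rfl⟩⟩

theorem support_eq_bot_iff {ρ : Matrix ι ι ℂ} : support ρ = ⊥ ↔ ρ = 0 := by
  rw [support, LinearMap.range_eq_bot, EmbeddingLike.map_eq_zero_iff]

theorem finrank_support (ρ : Matrix ι ι ℂ) : finrank ℂ (support ρ) = ρ.rank := by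
  rw [rank_eq_finrank_range_toLin ρ (PiLp.basisFun 2 ℂ ι) (PiLp.basisFun 2 ℂ ι),
    ← toLpLin_eq_toLin, support]

theorem mem_orthogonal_support_iff {ρ : Matrix ι ι ℂ} (hρ : ρ.IsHermitian) {u : ι → ℂ} :
    WithLp.toLp 2 u ∈ (support ρ)ᗮ ↔ ρ *ᵥ u = 0 := by
  rw [support, (isSymmetric_toEuclideanLin_iff.2 hρ).orthogonal_range, LinearMap.mem_ker]
  simp

theorem support_le_support_of_le {ρ σ : Matrix ι ι ℂ} (hσ : σ.PosSemidef)
    (h : (ρ - σ).PosSemidef) : support σ ≤ support ρ := by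
  have hρ : ρ.PosSemidef := by simpa using h.add hσ
  rw [← Submodule.orthogonal_le_orthogonal_iff]
  rintro ⟨u⟩ hu
  rw [mem_orthogonal_support_iff hρ.1] at hu
  rw [mem_orthogonal_support_iff hσ.1, ← hσ.dotProduct_mulVec_zero_iff]
  refine le_antisymm ?_ (hσ.dotProduct_mulVec_nonneg u)
  simpa [sub_mulVec, hu] using h.dotProduct_mulVec_nonneg u

omit [Fintype ι] [DecidableEq ι] in
theorem posSemidef_pureState [Finite ι] (v : EuclideanSpace ℂ ι) : (pureState v).PosSemidef :=
  posSemidef_vecMulVec_self_star v.ofLp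

theorem toEuclideanLin_pureState_apply (v w : EuclideanSpace ℂ ι) :
    toEuclideanLin (pureState v) w = inner ℂ v w • v := by
  ext t
  simp only [toLpLin_apply, mulVec, dotProduct, pureState, of_apply, PiLp.smul_apply,
    PiLp.inner_apply, RCLike.inner_apply, smul_eq_mul, Finset.sum_mul]
  exact Finset.sum_congr rfl fun _ _ => by simp; ring

theorem toEuclideanLin_smul_pureState_apply (c : ℝ) (v w : EuclideanSpace ℂ ι) :
    toEuclideanLin (c • pureState v) w = ((c : ℂ) * inner ℂ v w) • v := by
  rw [← Complex.coe_smul, map_smul, LinearMap.smul_apply, toEuclideanLin_pureState_apply, smul_smul]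

theorem mem_support_smul_pureState {v : EuclideanSpace ℂ ι} (hv : ‖v‖ = 1) {c : ℝ} (hc : c ≠ 0) :
    v ∈ support (c • pureState v) := by
  rw [← Submodule.smul_mem_iff _ (Complex.ofReal_ne_zero.2 hc)]
  exact ⟨v, by simp [toEuclideanLin_smul_pureState_apply, inner_self_eq_norm_sq_to_K, hv]⟩

theorem support_le_span_of_mem_convexHull {p : EuclideanSpace ℂ ι → Prop} {ρ : Matrix ι ι ℂ}
    (h : ρ ∈ convexHull ℝ {σ | ∃ v : EuclideanSpace ℂ ι, ‖v‖ = 1 ∧ p v ∧ σ = pureState v}) :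
    support ρ ≤ Submodule.span ℂ {v | v ∈ support ρ ∧ p v} := by
  classical
  obtain ⟨κ, _, c, z, hc, -, hz, rfl⟩ := mem_convexHull_iff_exists_fintype.1 h
  choose v hv hp hzv using hz
  obtain rfl : z = fun i => pureState (v i) := funext hzv
  have hpos : ∀ i, (c i • pureState (v i)).PosSemidef := fun i =>
    (posSemidef_pureState (v i)).smul (hc i)
  have hmem : ∀ i, c i ≠ 0 → v i ∈ support (∑ j, c j • pureState (v j)) := fun i hi => by
    refine support_le_support_of_le (hpos i) ?_ (mem_support_smul_pureState (hv i) hi)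
    rw [← Finset.add_sum_erase _ _ (Finset.mem_univ i), add_sub_cancel_left]
    exact posSemidef_sum _ fun j _ => hpos j
  rintro _ ⟨w, rfl⟩
  rw [map_sum, LinearMap.sum_apply]
  refine Submodule.sum_mem _ fun i _ => ?_
  rw [toEuclideanLin_smul_pureState_apply]
  obtain hi | hi := eq_or_ne (c i) 0
  · simp [hi]
  · exact Submodule.smul_mem _ _ (Submodule.subset_span ⟨hmem i hi, hp i⟩)

theorem toEuclideanLin_projMatrix (S : Submodule ℂ (EuclideanSpace ℂ ι)) :
    toEuclideanLin (projMatrix S) = S.starProjection.toLinearMap := by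
  refine (PiLp.basisFun 2 ℂ ι).ext fun t => ?_
  ext s
  simp [projMatrix]

theorem support_projMatrix (S : Submodule ℂ (EuclideanSpace ℂ ι)) : support (projMatrix S) = S := by
  rw [support, toEuclideanLin_projMatrix]
  exact S.range_starProjection

theorem posSemidef_projMatrix (S : Submodule ℂ (EuclideanSpace ℂ ι)) :
    (projMatrix S).PosSemidef := by
  rw [← isPositive_toEuclideanLin_iff, toEuclideanLin_projMatrix,
    ContinuousLinearMap.isPositive_toLinearMap_iff]
  exact ContinuousLinearMap.IsPositive.of_isStarProjection isStarProjection_starProjection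

theorem support_projState (S : Submodule ℂ (EuclideanSpace ℂ ι)) : support (projState S) = S := by
  obtain rfl | hS := eq_or_ne S ⊥
  · simp [support_eq_bot_iff, projState]
  rw [support, projState, map_smul, LinearMap.range_smul _ _ (by simpa using hS)]
  exact support_projMatrix S

theorem posSemidef_projState (S : Submodule ℂ (EuclideanSpace ℂ ι)) :
    (projState S).PosSemidef :=
  (posSemidef_projMatrix S).smul (by simp)

theorem starProjection_span_apply {κ H : Type*} [Fintype κ] [NormedAddCommGroup H]
    [InnerProductSpace ℂ H] [FiniteDimensional ℂ H] {v : κ → H} (hv : Orthonormal ℂ v) (w : H) :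
    (Submodule.span ℂ (Set.range v)).starProjection w = ∑ i, inner ℂ (v i) w • v i := by
  refine Submodule.eq_starProjection_of_mem_orthogonal
    (Submodule.sum_mem _ fun i _ => Submodule.smul_mem _ _ (Submodule.subset_span ⟨i, rfl⟩)) ?_
  have h : Set.range v ≤ (ℂ ∙ (w - ∑ i, inner ℂ (v i) w • v i))ᗮ := by
    rintro _ ⟨j, rfl⟩
    rw [SetLike.mem_coe, Submodule.mem_orthogonal_singleton_iff_inner_left, inner_sub_right,
      hv.inner_right_fintype, sub_self]
  rw [Submodule.mem_orthogonal]
  intro u hu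
  exact Submodule.mem_orthogonal_singleton_iff_inner_left.1 (Submodule.span_le.2 h hu)

theorem projMatrix_orthogonal_span {κ : Type*} [Fintype κ] {v : κ → EuclideanSpace ℂ ι}
    (hv : Orthonormal ℂ v) :
    projMatrix (Submodule.span ℂ (Set.range v))ᗮ = 1 - ∑ i, pureState (v i) := by
  apply toEuclideanLin.injective
  ext1 w
  rw [toEuclideanLin_projMatrix, ContinuousLinearMap.coe_coe,
    Submodule.starProjection_orthogonal_val, starProjection_span_apply hv, map_sub, map_sum,
    LinearMap.sub_apply, LinearMap.sum_apply]
  simp only [toEuclideanLin_pureState_apply, toLpLin_one, LinearMap.id_apply]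

end Support

section Bipartite

variable {α β : Type*} [Fintype α] [Fintype β]

omit [Fintype α] [Fintype β] in
theorem partialTranspose_kronecker (A : Matrix α α ℂ) (B : Matrix β β ℂ) :
    partialTranspose (A ⊗ₖ B) = A ⊗ₖ Bᵀ := rfl

omit [Fintype α] [Fintype β] in
theorem partialTranspose_zero : partialTranspose (0 : Matrix (α × β) (α × β) ℂ) = 0 := rfl

omit [Fintype α] [Fintype β] in
theorem partialTranspose_add (ρ σ : Matrix (α × β) (α × β) ℂ) :
    partialTranspose (ρ + σ) = partialTranspose ρ + partialTranspose σ := rfl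

theorem partialTranspose_filter {m n : Type*} (F : Matrix m α ℂ) (G : Matrix n β ℂ)
    (ρ : Matrix (α × β) (α × β) ℂ) :
    partialTranspose ((F ⊗ₖ G) * ρ * (F ⊗ₖ G)ᴴ) =
      (F ⊗ₖ G.map star) * partialTranspose ρ * (F ⊗ₖ G.map star)ᴴ := by
  classical
  induction ρ using Matrix.induction_on' with
  | h_zero =>
    simp only [Matrix.mul_zero, Matrix.zero_mul, partialTranspose_zero]
  | h_add ρ σ hρ hσ =>
    simp only [partialTranspose_add, Matrix.mul_add, Matrix.add_mul, hρ, hσ]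
  | h_std_basis s t c =>
    obtain ⟨a, b⟩ := s
    obtain ⟨a', b'⟩ := t
    rw [show single (a, b) (a', b') c = single a a' c ⊗ₖ single b b' 1 by
      rw [single_kronecker_single, mul_one]]
    have hG : (G.map star)ᴴ = Gᵀ := by ext; simp
    simp only [conjTranspose_kronecker, ← mul_kronecker_mul, partialTranspose_kronecker,
      transpose_mul, conjTranspose_transpose, hG, Matrix.mul_assoc]

theorem not_isOneDistillable_of_isPPT {ρ : Matrix (α × β) (α × β) ℂ} (h : IsPPT ρ) :
    ¬ IsOneDistillable ρ := by
  rintro ⟨F, G, hFG⟩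
  rw [IsPPT, partialTranspose_filter] at hFG
  exact hFG (h.mul_mul_conjTranspose_same _)

omit [Fintype α] [Fintype β] in
theorem posSemidef_copies [Finite α] [Finite β] {ρ : Matrix (α × β) (α × β) ℂ}
    (h : ρ.PosSemidef) (n : ℕ) : (copies n ρ).PosSemidef := by
  have := Fintype.ofFinite (α × β)
  obtain ⟨m, v, rfl⟩ := posSemidef_iff_eq_sum_vecMulVec.1 h
  let R : (Fin n → Fin m) → (Fin n → α) × (Fin n → β) → ℂ := fun k s => ∏ i, v (k i) (s.1 i, s.2 i)
  have hR : copies n (∑ k, vecMulVec (v k) (star (v k))) = ∑ k, vecMulVec (R k) (star (R k)) := by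
    ext s t
    simp only [copies, of_apply, Matrix.sum_apply, vecMulVec_apply, Finset.prod_univ_sum,
      Fintype.piFinset_univ, R, Pi.star_apply, star_prod, Finset.prod_mul_distrib]
  rw [hR]
  exact posSemidef_sum _ fun k _ => posSemidef_vecMulVec_self_star (R k)

theorem not_isDistillable_of_isPPT {ρ : Matrix (α × β) (α × β) ℂ} (h : IsPPT ρ) :
    ¬ IsDistillable ρ :=
  fun ⟨n, _, hn⟩ => not_isOneDistillable_of_isPPT (ρ := copies n ρ) (posSemidef_copies h n) hn

theorem isDistillable_of_isOneDistillable {ρ : Matrix (α × β) (α × β) ℂ}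
    (h : IsOneDistillable ρ) : IsDistillable ρ := by
  obtain ⟨F, G, hFG⟩ := h
  let f : (Fin 1 → α) ≃ α := Equiv.funUnique (Fin 1) α
  let g : (Fin 1 → β) ≃ β := Equiv.funUnique (Fin 1) β
  refine ⟨1, le_rfl, F.submatrix id f, G.submatrix id g, ?_⟩
  have hcopies : copies 1 ρ = ρ.submatrix (f.prodCongr g) (f.prodCongr g) := by
    ext s t
    rw [copies, of_apply, Fintype.prod_unique]
    rfl
  have hfilter : F.submatrix id f ⊗ₖ G.submatrix id g =
      (F ⊗ₖ G).submatrix id (f.prodCongr g) := rfl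
  rw [hcopies, hfilter, submatrix_mul_equiv, conjTranspose_submatrix, submatrix_mul_equiv,
    submatrix_id_id]
  exact hFG

theorem inner_of_apply_eq_mul {v w : EuclideanSpace ℂ (α × β)} {x x' : EuclideanSpace ℂ α}
    {y y' : EuclideanSpace ℂ β} (hv : ∀ t : α × β, v t = x t.1 * y t.2)
    (hw : ∀ t : α × β, w t = x' t.1 * y' t.2) :
    inner ℂ v w = inner ℂ x x' * inner ℂ y y' := by
  simp only [PiLp.inner_apply, hv, hw, Fintype.sum_prod_type, RCLike.inner_apply,
    Finset.sum_mul_sum, map_mul]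
  exact Finset.sum_congr rfl fun _ _ => Finset.sum_congr rfl fun _ _ => by ring

/-- Conjugating the second factors turns the `v i` into orthonormal vectors `w i`, and the partial
transpose into the projector onto the orthogonal complement of the `w i`. -/
theorem isPPT_one_sub_sum_pureState [DecidableEq α] [DecidableEq β] {κ : Type*} [Fintype κ]
    {v : κ → EuclideanSpace ℂ (α × β)} (hv : Orthonormal ℂ v) (hp : ∀ i, IsProduct (v i)) :
    IsPPT (1 - ∑ i, pureState (v i)) := by
  classical
  choose x y hxy using hp
  let y' : κ → EuclideanSpace ℂ β := fun i => WithLp.toLp 2 fun b => star (y i b)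
  let w : κ → EuclideanSpace ℂ (α × β) := fun i => WithLp.toLp 2 fun t => x i t.1 * y' i t.2
  have inner_w : ∀ i j, inner ℂ (w i) (w j) = inner ℂ (x i) (x j) * inner ℂ (y j) (y i) :=
    fun i j => by
      rw [inner_of_apply_eq_mul (x := x i) (y := y' i) (fun _ => rfl) (fun _ => rfl)]
      simp [PiLp.inner_apply, y', mul_comm]
  have hw : Orthonormal ℂ w := by
    rw [orthonormal_iff_ite] at hv ⊢
    intro i j
    have h := hv i j
    rw [inner_of_apply_eq_mul (hxy i) (hxy j)] at h
    rw [inner_w]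
    obtain rfl | hij := eq_or_ne i j
    · exact h
    · rw [if_neg hij, mul_eq_zero] at h
      rw [if_neg hij, mul_eq_zero, inner_eq_zero_symm (x := y j)]
      exact h
  have hPT : partialTranspose (1 - ∑ i, pureState (v i)) = 1 - ∑ i, pureState (w i) := by
    ext ⟨a, b⟩ ⟨a', b'⟩
    simp only [partialTranspose, of_apply, Matrix.sub_apply, one_apply, Prod.mk.injEq,
      Matrix.sum_apply, pureState, hxy, w, y', star_mul', star_star, eq_comm (a := b) (b := b')]
    exact congrArg _ (Finset.sum_congr rfl fun _ _ => by ring)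
  rw [IsPPT, hPT, ← projMatrix_orthogonal_span hw]
  exact posSemidef_projMatrix _

end Bipartite

section OrthogonalSets

variable {E : Type*} [NormedAddCommGroup E] [InnerProductSpace ℂ E]

/-- Sets of nonzero pairwise orthogonal vectors. -/
structure IsOrthogonalSet (U : Set E) : Prop where
  ne_zero : ∀ v ∈ U, v ≠ 0
  pairwise : U.Pairwise fun v w => inner ℂ v w = 0

theorem IsOrthogonalSet.linearIndependent {U : Set E} (h : IsOrthogonalSet U) :
    LinearIndependent ℂ ((↑) : U → E) :=
  linearIndependent_of_ne_zero_of_inner_eq_zero (fun u => h.ne_zero u u.2)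
    fun u v huv => h.pairwise u.2 v.2 (Subtype.coe_ne_coe.2 huv)

theorem IsOrthogonalSet.mono {U U' : Set E} (h : IsOrthogonalSet U') (hU : U ⊆ U') :
    IsOrthogonalSet U :=
  ⟨fun v hv => h.ne_zero v (hU hv), h.pairwise.mono hU⟩

theorem isOrthogonalSet_range {κ : Type*} {w : κ → E} (h0 : ∀ i, w i ≠ 0)
    (hw : Pairwise fun i j => inner ℂ (w i) (w j) = 0) : IsOrthogonalSet (Set.range w) :=
  ⟨Set.forall_mem_range.2 h0, fun _ ⟨_, hi⟩ _ ⟨_, hj⟩ hij =>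
    hi ▸ hj ▸ hw fun e => hij (hi ▸ hj ▸ congrArg w e)⟩

theorem IsOrthogonalSet.union {U U' : Set E} (h : IsOrthogonalSet U) (h' : IsOrthogonalSet U')
    (hU : ∀ u ∈ U, ∀ v ∈ U', inner ℂ u v = 0) : IsOrthogonalSet (U ∪ U') :=
  ⟨fun v hv => hv.elim (h.ne_zero v) (h'.ne_zero v),
    Set.pairwise_union.2 ⟨h.pairwise, h'.pairwise, fun u hu v hv _ =>
      ⟨hU u hu v hv, inner_eq_zero_symm.1 (hU u hu v hv)⟩⟩⟩

theorem mem_orthogonal_span_iff {U : Set E} {f : E} :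
    f ∈ (Submodule.span ℂ U)ᗮ ↔ ∀ u ∈ U, inner ℂ u f = 0 := by
  rw [← Submodule.span_singleton_le_iff_mem, ← Submodule.isOrtho_iff_le, Submodule.isOrtho_comm,
    Submodule.isOrtho_span]
  simp

variable [FiniteDimensional ℂ E]

theorem IsOrthogonalSet.finite {U : Set E} (h : IsOrthogonalSet U) : U.Finite :=
  h.linearIndependent.set_finite_of_isNoetherian

theorem IsOrthogonalSet.ncard_union {U U' : Set E} (h : IsOrthogonalSet U)
    (h' : IsOrthogonalSet U') (hU : ∀ u ∈ U, ∀ v ∈ U', inner ℂ u v = 0) :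
    (U ∪ U').ncard = U.ncard + U'.ncard := by
  refine Set.ncard_union_eq (Set.disjoint_left.2 fun u hu hu' => h.ne_zero u hu ?_) h.finite
    h'.finite
  exact inner_self_eq_zero.1 (hU u hu u hu')

theorem IsOrthogonalSet.finrank_span {U : Set E} (h : IsOrthogonalSet U) :
    finrank ℂ (Submodule.span ℂ U) = U.ncard := by
  have := h.finite.fintype
  rw [finrank_span_set_eq_card h.linearIndependent, Set.ncard_eq_toFinset_card']

theorem IsOrthogonalSet.ncard_add_finrank_orthogonal {U : Set E} (h : IsOrthogonalSet U) :
    U.ncard + finrank ℂ (Submodule.span ℂ U)ᗮ = finrank ℂ E := by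
  rw [← h.finrank_span, Submodule.finrank_add_finrank_orthogonal]

omit [FiniteDimensional ℂ E] in
theorem IsOrthogonalSet.orthonormal_normalize {U : Set E} (h : IsOrthogonalSet U) :
    Orthonormal ℂ fun u : U => (‖(u : E)‖⁻¹ : ℂ) • (u : E) := by
  refine ⟨fun u => ?_, fun u v huv => ?_⟩
  · simp [norm_smul, h.ne_zero u u.2]
  · simp [inner_smul_left, inner_smul_right, h.pairwise u.2 v.2 (Subtype.coe_ne_coe.2 huv)]

omit [FiniteDimensional ℂ E] in
theorem IsOrthogonalSet.span_normalize {U : Set E} (h : IsOrthogonalSet U) :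
    Submodule.span ℂ (Set.range fun u : U => (‖(u : E)‖⁻¹ : ℂ) • (u : E)) =
      Submodule.span ℂ U := by
  refine le_antisymm (Submodule.span_le.2 ?_) (Submodule.span_le.2 fun u hu => ?_)
  · rintro _ ⟨u, rfl⟩
    exact Submodule.smul_mem _ _ (Submodule.subset_span u.2)
  · have hu0 : (‖u‖ : ℂ) ≠ 0 := by simpa using h.ne_zero u hu
    have hmem := Submodule.smul_mem _ (‖u‖ : ℂ) (Submodule.subset_span (R := ℂ)
      (Set.mem_range_self (f := fun u : U => (‖(u : E)‖⁻¹ : ℂ) • (u : E)) ⟨u, hu⟩))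
    simpa [smul_smul, hu0] using hmem

omit [FiniteDimensional ℂ E] in
theorem orthogonal_span_eq_span {U U' : Set E} (hU : ∀ u ∈ U, ∀ v ∈ U', inner ℂ u v = 0)
    (htop : Submodule.span ℂ (U ∪ U') = ⊤) :
    (Submodule.span ℂ U)ᗮ = Submodule.span ℂ U' := by
  have hle : Submodule.span ℂ U' ≤ (Submodule.span ℂ U)ᗮ :=
    Submodule.span_le.2 fun v hv => mem_orthogonal_span_iff.2 fun u hu => hU u hu v hv
  calc (Submodule.span ℂ U)ᗮ
      = (Submodule.span ℂ U' ⊔ Submodule.span ℂ U) ⊓ (Submodule.span ℂ U)ᗮ := by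
        rw [← Submodule.span_union, Set.union_comm, htop, top_inf_eq]
    _ = Submodule.span ℂ U' := by
        rw [sup_inf_assoc_of_le _ hle, Submodule.inf_orthogonal_eq_bot, sup_bot_eq]

end OrthogonalSets

section Across

variable {d : ℕ} {c : Cut}

theorem posSemidef_across {ρ : Matrix (Cube d) (Cube d) ℂ} (h : ρ.PosSemidef) :
    (across c ρ).PosSemidef := h.submatrix _

theorem across_mulVec_eq_zero_iff {ρ : Matrix (Cube d) (Cube d) ℂ}
    {u : Fin d × (Fin d × Fin d) → ℂ} :
    across c ρ *ᵥ u = 0 ↔ ρ *ᵥ (u ∘ cutEquiv d c) = 0 := by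
  rw [across, reindex_apply, submatrix_mulVec_equiv, Equiv.symm_symm]
  exact (cutEquiv d c).symm.surjective.injective_comp_right.eq_iff' rfl

theorem isOneDistillable_across_of_rank_lt {S : Submodule ℂ (ThreeQudit d)}
    (hS : (across c (projMatrix S)).rank <
      max (reducedFst (across c (projMatrix S))).rank (reducedSnd (across c (projMatrix S))).rank)
    {ρ : Matrix (Cube d) (Cube d) ℂ} (hρ : ρ.PosSemidef) (hρS : SupportedOn ρ S)
    (hrank : ρ.rank = finrank ℂ S) : IsOneDistillable (across c ρ) := by
  by_contra h
  refine hS.not_ge (max_rank_reduced_le (posSemidef_across hρ)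
    (posSemidef_across (posSemidef_projMatrix S)) (fun u => ?_) h)
  have hsupport : support ρ = S := Submodule.eq_of_le_of_finrank_eq
    (supportedOn_iff_support_le.1 hρS) ((finrank_support ρ).trans hrank)
  rw [across_mulVec_eq_zero_iff, across_mulVec_eq_zero_iff, ← mem_orthogonal_support_iff hρ.1,
    ← mem_orthogonal_support_iff (posSemidef_projMatrix S).1, hsupport, support_projMatrix]

theorem mem_convexHull_of_isSeparable_across {ρ : Matrix (Cube d) (Cube d) ℂ}
    (h : IsSeparable (across c ρ)) :
    ρ ∈ convexHull ℝ {σ | ∃ v : ThreeQudit d, ‖v‖ = 1 ∧ IsProductAcross c v ∧ σ = pureState v} := by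
  let e := cutEquiv d c
  have hρ := Set.mem_image_of_mem (reindexLinearEquiv ℝ ℂ e.symm e.symm).toLinearMap h
  rw [LinearMap.image_convexHull] at hρ
  have hback : reindexLinearEquiv ℝ ℂ e.symm e.symm (across c ρ) = ρ :=
    ((reindexLinearEquiv ℝ ℂ e e).symm_apply_apply ρ :)
  rw [LinearEquiv.coe_coe, hback] at hρ
  refine convexHull_mono ?_ hρ
  rintro _ ⟨_, ⟨v, hv, ⟨x, y, hxy⟩, rfl⟩, rfl⟩
  let e' := LinearIsometryEquiv.piLpCongrLeft 2 ℂ ℂ e.symm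
  exact ⟨e' v, by rw [e'.norm_map, hv], ⟨x, y, fun t => hxy (e t)⟩, rfl⟩

theorem eq_zero_of_mem_convexHull {P : ThreeQudit d → Prop} {U : Set (ThreeQudit d)}
    (hU : IsUnextendible P U) {ρ : Matrix (Cube d) (Cube d) ℂ}
    (hρ : SupportedOn ρ (complementary U))
    (h : ρ ∈ convexHull ℝ {σ | ∃ v : ThreeQudit d, ‖v‖ = 1 ∧ P v ∧ σ = pureState v}) : ρ = 0 := by
  rw [← support_eq_bot_iff, eq_bot_iff]
  refine (support_le_span_of_mem_convexHull h).trans (Submodule.span_le.2 fun v hv => ?_)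
  exact hU.unextendible v (supportedOn_iff_support_le.1 hρ hv.1) hv.2

theorem isGenuinelyEntangled_of_isUBB {U : Set (ThreeQudit d)} (hU : IsUBB U)
    {ρ : Matrix (Cube d) (Cube d) ℂ} (hρ : IsDensity ρ) (hρU : SupportedOn ρ (complementary U)) :
    IsGenuinelyEntangled ρ := fun h => by
  simpa [eq_zero_of_mem_convexHull hU hρU h] using hρ.2

theorem IsOrthogonalFamily.isOrthogonalSet {P : ThreeQudit d → Prop} {U : Set (ThreeQudit d)}
    (h : IsOrthogonalFamily P U) : IsOrthogonalSet U := ⟨h.ne_zero, h.orthogonal⟩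

theorem isPPT_across_projState {U : Set (ThreeQudit d)}
    (hU : IsOrthogonalFamily (IsProductAcross c) U) :
    IsPPT (across c (projState (complementary U))) := by
  have := hU.isOrthogonalSet.finite.fintype
  let e := LinearIsometryEquiv.piLpCongrLeft 2 ℂ ℂ (cutEquiv d c)
  have horth := hU.isOrthogonalSet.orthonormal_normalize
  have hproj : across c (projMatrix (complementary U)) =
      1 - ∑ u : U, pureState (e ((‖(u : ThreeQudit d)‖⁻¹ : ℂ) • (u : ThreeQudit d))) := by
    rw [complementary, ← hU.isOrthogonalSet.span_normalize, projMatrix_orthogonal_span horth]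
    ext s t
    simp [across, Matrix.sum_apply, pureState, e, Matrix.one_apply]
  have hPPT : IsPPT (across c (projMatrix (complementary U))) := by
    refine hproj ▸ isPPT_one_sub_sum_pureState (horth.comp_linearIsometryEquiv e) fun u => ?_
    obtain ⟨x, y, hxy⟩ := hU.mem u u.2
    refine ⟨(‖(u : ThreeQudit d)‖⁻¹ : ℂ) • x, y, fun t => ?_⟩
    simp [e, hxy, mul_assoc]
  exact PosSemidef.smul hPPT (a := (finrank ℂ (complementary U) : ℂ)⁻¹) (by positivity)

end Across

section LocalBases

variable {d : ℕ}

@[simp] theorem ket_apply (a b : Fin d) : ket a b = if b = a then 1 else 0 := by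
  simp [ket]

@[simp] theorem tri_apply (x y z : Qudit d) (t : Cube d) :
    tri x y z t = x t.1 * y t.2.1 * z t.2.2 := rfl

theorem inner_tri (x y z x' y' z' : Qudit d) :
    inner ℂ (tri x y z) (tri x' y' z') = inner ℂ x x' * inner ℂ y y' * inner ℂ z z' := by
  let pair (y z : Qudit d) : EuclideanSpace ℂ (Fin d × Fin d) :=
    WithLp.toLp 2 fun s => y s.1 * z s.2
  have hpair : inner ℂ (pair y z) (pair y' z') = inner ℂ y y' * inner ℂ z z' :=
    inner_of_apply_eq_mul (fun _ => rfl) fun _ => rfl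
  rw [mul_assoc, ← hpair]
  exact inner_of_apply_eq_mul (fun t => mul_assoc _ _ _) fun t => mul_assoc _ _ _

theorem tri_ket (a b c : Fin d) :
    tri (ket a) (ket b) (ket c) = EuclideanSpace.single (a, b, c) 1 := by
  ext t
  simp only [tri_apply, ket_apply, PiLp.single_apply, Prod.ext_iff]
  split_ifs <;> simp_all

theorem isLinearMap_tri_fst (y z : Qudit d) : IsLinearMap ℂ fun x => tri x y z :=
  ⟨fun _ _ => by ext; simp [add_mul], fun _ _ => by ext; simp [mul_assoc]⟩

theorem isLinearMap_tri_snd (x z : Qudit d) : IsLinearMap ℂ fun y => tri x y z :=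
  ⟨fun _ _ => by ext; simp [mul_add, add_mul], fun _ _ => by ext; simp; ring⟩

theorem isLinearMap_tri_trd (x y : Qudit d) : IsLinearMap ℂ fun z => tri x y z :=
  ⟨fun _ _ => by ext; simp [mul_add], fun _ _ => by ext; simp; ring⟩

theorem tri_mem_span {A B C : Set (Qudit d)} {x y z : Qudit d} (hx : x ∈ Submodule.span ℂ A)
    (hy : y ∈ Submodule.span ℂ B) (hz : z ∈ Submodule.span ℂ C) :
    tri x y z ∈ Submodule.span ℂ {v | ∃ x ∈ A, ∃ y ∈ B, ∃ z ∈ C, v = tri x y z} := by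
  set S := Submodule.span ℂ {v | ∃ x ∈ A, ∃ y ∈ B, ∃ z ∈ C, v = tri x y z}
  have span_induct {W : Set (Qudit d)} {f : Qudit d → ThreeQudit d} (hf : IsLinearMap ℂ f)
      (hW : ∀ w ∈ W, f w ∈ S) {w : Qudit d} (hw : w ∈ Submodule.span ℂ W) : f w ∈ S :=
    (Submodule.span_le (p := S.comap (hf.mk' f))).2 hW hw
  refine span_induct (isLinearMap_tri_fst y z) (fun x hx => ?_) hx
  refine span_induct (isLinearMap_tri_snd x z) (fun y hy => ?_) hy
  refine span_induct (isLinearMap_tri_trd x y) (fun z hz => ?_) hz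
  exact Submodule.subset_span ⟨x, hx, y, hy, z, hz, rfl⟩

/-- The sum of the computational basis vectors with labels in `s`. -/
def indVec (s : Finset (Fin d)) : Qudit d := ∑ a ∈ s, ket a

@[simp] theorem indVec_apply (s : Finset (Fin d)) (b : Fin d) :
    indVec s b = if b ∈ s then 1 else 0 := by
  simp [indVec, Finset.sum_apply]

theorem orthonormal_ket : Orthonormal ℂ (ket : Fin d → Qudit d) :=
  EuclideanSpace.orthonormal_single

theorem finrank_span_ket (s : Finset (Fin d)) :
    finrank ℂ (Submodule.span ℂ (ket '' (s : Set (Fin d)))) = s.card := by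
  have h : LinearIndependent ℂ fun a : s => ket (a : Fin d) :=
    orthonormal_ket.linearIndependent.comp _ Subtype.val_injective
  exact (Set.image_eq_range ket _).symm ▸ (finrank_span_eq_card h).trans (Fintype.card_coe s)

theorem mem_span_ket_iff {s : Finset (Fin d)} {u : Qudit d} :
    u ∈ Submodule.span ℂ (ket '' (s : Set (Fin d))) ↔ ∀ a ∉ s, u a = 0 := by
  have h := (EuclideanSpace.basisFun (Fin d) ℂ).toBasis.mem_span_image (m := u) (s := s)
  have hket : ⇑(EuclideanSpace.basisFun (Fin d) ℂ).toBasis = ket := by ext1; simp [ket]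
  rw [← hket, h]
  simp [Set.subset_def, not_imp_comm]

/-- An orthogonal basis of the space spanned by the `|a⟩` with `a ∈ s`, containing their sum. -/
structure IsLocalBasis (s : Finset (Fin d)) (E : Set (Qudit d)) : Prop where
  isOrthogonalSet : IsOrthogonalSet E
  indVec_mem : indVec s ∈ E
  span_eq : Submodule.span ℂ E = Submodule.span ℂ (ket '' (s : Set (Fin d)))

theorem IsLocalBasis.apply_eq_zero {s : Finset (Fin d)} {E : Set (Qudit d)}
    (h : IsLocalBasis s E) {u : Qudit d} (hu : u ∈ E) {a : Fin d} (ha : a ∉ s) : u a = 0 :=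
  mem_span_ket_iff.1 (h.span_eq ▸ Submodule.subset_span hu) a ha

theorem IsLocalBasis.ket_mem_span {s : Finset (Fin d)} {E : Set (Qudit d)}
    (h : IsLocalBasis s E) {a : Fin d} (ha : a ∈ s) : ket a ∈ Submodule.span ℂ E :=
  h.span_eq ▸ Submodule.subset_span ⟨a, ha, rfl⟩

theorem isLocalBasis_range {κ : Type*} [Fintype κ] {s : Finset (Fin d)} {w : κ → Qudit d}
    (h0 : ∀ i, w i ≠ 0) (hw : Pairwise fun i j => inner ℂ (w i) (w j) = 0)
    (hmem : ∀ i, w i ∈ Submodule.span ℂ (ket '' (s : Set (Fin d))))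
    (hcard : Fintype.card κ = s.card) {i₀ : κ} (hi : w i₀ = indVec s) :
    IsLocalBasis s (Set.range w) := by
  refine ⟨isOrthogonalSet_range h0 hw, ⟨i₀, hi⟩, Submodule.eq_of_le_of_finrank_eq
    (Submodule.span_le.2 (Set.range_subset_iff.2 hmem)) ?_⟩
  rw [finrank_span_eq_card (linearIndependent_of_ne_zero_of_inner_eq_zero h0 hw), hcard,
    finrank_span_ket]

theorem isLocalBasis_singleton (a : Fin d) : IsLocalBasis {a} {ket a} where
  isOrthogonalSet := ⟨by simp [orthonormal_ket.ne_zero a], by simp⟩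
  indVec_mem := by simp [indVec]
  span_eq := by simp

end LocalBases

section Cells

variable {d : ℕ}

/-- The coordinates at distance at least `j` from both ends of `0, …, d - 1`. -/
def innerCoords (d j : ℕ) : Finset (Fin d) :=
  Finset.univ.filter fun a => j ≤ (a : ℕ) ∧ (a : ℕ) + j < d

/-- The ranges of a single coordinate in the blocks: the two ends of a layer, the supports of the
vectors `η` and `ξ` of a layer, and the central coordinates (one for odd `d`, two for even `d`). -/
inductive Side (d : ℕ)
  | low (k : Fin (numLayers d))
  | high (k : Fin (numLayers d))
  | eta (k : Fin (numLayers d))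
  | xi (k : Fin (numLayers d))
  | core

/-- The labels of the computational basis vectors belonging to a side. -/
def Side.coords : Side d → Finset (Fin d)
  | .low k => {BlockCube.low k}
  | .high k => {BlockCube.high k}
  | .eta k => Finset.Ico (BlockCube.low k) (BlockCube.high k)
  | .xi k => Finset.Ioc (BlockCube.low k) (BlockCube.high k)
  | .core => innerCoords d (numLayers d)

/-- The cells into which the cube of labels is divided: the supports of the facial blocks, the two
corners of each layer on the body diagonal, and the centre. -/
inductive Cell (d : ℕ)
  | face (k : Fin (numLayers d)) (p : Face)
  | lo (k : Fin (numLayers d))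
  | hi (k : Fin (numLayers d))
  | core

/-- The range of the first coordinate in a cell. -/
def Cell.fst : Cell d → Side d
  | .face k .f1 => .low k
  | .face k .f2 => .eta k
  | .face k .f3 => .high k
  | .face k .f4 => .eta k
  | .face k .f5 => .xi k
  | .face k .f6 => .xi k
  | .lo k => .low k
  | .hi k => .high k
  | .core => .core

/-- The range of the second coordinate in a cell. -/
def Cell.snd : Cell d → Side d
  | .face k .f1 => .eta k
  | .face k .f2 => .high k
  | .face k .f3 => .xi k
  | .face k .f4 => .xi k
  | .face k .f5 => .low k
  | .face k .f6 => .eta k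
  | .lo k => .low k
  | .hi k => .high k
  | .core => .core

/-- The range of the third coordinate in a cell. -/
def Cell.trd : Cell d → Side d
  | .face k .f1 => .xi k
  | .face k .f2 => .xi k
  | .face k .f3 => .eta k
  | .face k .f4 => .low k
  | .face k .f5 => .eta k
  | .face k .f6 => .high k
  | .lo k => .low k
  | .hi k => .high k
  | .core => .core

/-- The set of labels `(p, q, r)` belonging to a cell. -/
def Cell.box (c : Cell d) : Finset (Cube d) := c.fst.coords ×ˢ c.snd.coords ×ˢ c.trd.coords

theorem Cell.mem_box {c : Cell d} {t : Cube d} :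
    t ∈ c.box ↔ t.1 ∈ c.fst.coords ∧ t.2.1 ∈ c.snd.coords ∧ t.2.2 ∈ c.trd.coords := by
  simp [Cell.box]

theorem mem_innerCoords {j : ℕ} {a : Fin d} :
    a ∈ innerCoords d j ↔ j ≤ (a : ℕ) ∧ (a : ℕ) + j < d := by
  simp [innerCoords]

theorem Side.mem_low {k : Fin (numLayers d)} {a : Fin d} :
    a ∈ (Side.low k).coords ↔ (a : ℕ) = k := by
  simp [Side.coords, BlockCube.low, Fin.ext_iff]

theorem Side.mem_high {k : Fin (numLayers d)} {a : Fin d} :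
    a ∈ (Side.high k).coords ↔ (a : ℕ) = d - 1 - k := by
  simp [Side.coords, BlockCube.high, Fin.ext_iff]

theorem Side.mem_eta {k : Fin (numLayers d)} {a : Fin d} :
    a ∈ (Side.eta k).coords ↔ (k : ℕ) ≤ a ∧ (a : ℕ) < d - 1 - k := by
  simp [Side.coords, BlockCube.low, BlockCube.high, Fin.le_def, Fin.lt_def]

theorem Side.mem_xi {k : Fin (numLayers d)} {a : Fin d} :
    a ∈ (Side.xi k).coords ↔ (k : ℕ) < a ∧ (a : ℕ) ≤ d - 1 - k := by
  simp [Side.coords, BlockCube.low, BlockCube.high, Fin.le_def, Fin.lt_def]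

theorem Side.mem_core {a : Fin d} :
    a ∈ (Side.core : Side d).coords ↔ numLayers d ≤ (a : ℕ) ∧ (a : ℕ) + numLayers d < d :=
  mem_innerCoords

theorem Cell.eq_of_mem {c c' : Cell d} {t : Cube d} (h : t ∈ c.box) (h' : t ∈ c'.box) :
    c = c' := by
  have layer_lt (k : Fin (numLayers d)) : 2 * (k : ℕ) + 2 < d ∧ (k : ℕ) < numLayers d :=
    ⟨two_mul_lt k, k.2⟩
  rcases c with ⟨k, (_ | _)⟩ | k | k | _ <;> rcases c' with ⟨k', (_ | _)⟩ | k' | k' | _ <;>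
    simp only [Cell.mem_box, Cell.fst, Cell.snd, Cell.trd, Side.mem_low, Side.mem_high,
      Side.mem_eta, Side.mem_xi, Side.mem_core, Cell.face.injEq, Cell.lo.injEq, Cell.hi.injEq,
      Fin.ext_iff, and_true, reduceCtorEq, and_false] at h h' ⊢ <;>
    (try have := layer_lt k) <;> (try have := layer_lt k') <;> omega

/-- The labels whose coordinates all have distance at least `j` from the ends `0` and `d - 1`. -/
def subcube (d j : ℕ) : Finset (Cube d) :=
  innerCoords d j ×ˢ innerCoords d j ×ˢ innerCoords d j

theorem mem_subcube {j : ℕ} {t : Cube d} :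
    t ∈ subcube d j ↔
      t.1 ∈ innerCoords d j ∧ t.2.1 ∈ innerCoords d j ∧ t.2.2 ∈ innerCoords d j := by
  simp [subcube]

theorem mem_subcube_zero (t : Cube d) : t ∈ subcube d 0 := by
  simp [mem_subcube, mem_innerCoords]

theorem subcube_numLayers : subcube d (numLayers d) = (Cell.core : Cell d).box := rfl

theorem Cell.layer_cases (k : Fin (numLayers d)) {t : Cube d} (h : t ∈ subcube d k) :
    t ∈ (Cell.lo k).box ∨ t ∈ (Cell.hi k).box ∨ (∃ p, t ∈ (Cell.face k p).box) ∨
      t ∈ subcube d (k + 1) := by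
  have hk := two_mul_lt k
  have hcoord (a : Fin d) (ha : (k : ℕ) ≤ a ∧ (a : ℕ) + k < d) :
      (a : ℕ) = k ∨ (a : ℕ) = d - 1 - k ∨ (k : ℕ) + 1 ≤ a ∧ (a : ℕ) + (k + 1) < d := by lia
  by_contra! hcon
  obtain ⟨hlo, hhi, hface, hsub⟩ := hcon
  have h1 := hface .f1
  have h2 := hface .f2
  have h3 := hface .f3
  have h4 := hface .f4
  have h5 := hface .f5
  have h6 := hface .f6
  simp only [mem_subcube, mem_innerCoords, Cell.mem_box, Cell.fst, Cell.snd, Cell.trd,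
    Side.mem_low, Side.mem_high, Side.mem_eta, Side.mem_xi] at h hlo hhi hsub h1 h2 h3 h4 h5 h6
  clear hface
  rcases hcoord _ h.1 with ha | ha | ha <;> rcases hcoord _ h.2.1 with hb | hb | hb <;>
    rcases hcoord _ h.2.2 with hc | hc | hc <;> omega

theorem Cell.exists_mem (t : Cube d) : ∃ c : Cell d, t ∈ c.box := by
  by_contra! hcon
  have mem_all : ∀ j ≤ numLayers d, t ∈ subcube d j := by
    intro j
    induction j with
    | zero => exact fun _ => mem_subcube_zero t
    | succ j ih =>
      intro hj
      obtain h | h | ⟨p, h⟩ | h := Cell.layer_cases ⟨j, hj⟩ (ih (by lia))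
      exacts [absurd h (hcon _), absurd h (hcon _), absurd h (hcon _), h]
  exact hcon _ (subcube_numLayers ▸ mem_all _ le_rfl)

theorem Side.card_eta (k : Fin (numLayers d)) : (Side.eta k).coords.card = side d k := by
  simp only [Side.coords, Fin.card_Ico, BlockCube.low, BlockCube.high, side]
  lia

theorem Side.card_xi (k : Fin (numLayers d)) : (Side.xi k).coords.card = side d k := by
  simp only [Side.coords, Fin.card_Ioc, BlockCube.low, BlockCube.high, side]
  lia

theorem Side.card_low (k : Fin (numLayers d)) : (Side.low k).coords.card = 1 :=
  Finset.card_singleton _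

theorem Side.card_high (k : Fin (numLayers d)) : (Side.high k).coords.card = 1 :=
  Finset.card_singleton _

theorem Cell.card_box_face (k : Fin (numLayers d)) (p : Face) :
    (Cell.face k p).box.card = side d k ^ 2 := by
  cases p <;> simp [Cell.box, Cell.fst, Cell.snd, Cell.trd, Side.card_eta, Side.card_xi,
    Side.card_low, Side.card_high, sq]

theorem Cell.card_box_lo (k : Fin (numLayers d)) : (Cell.lo k).box.card = 1 := by
  simp [Cell.box, Cell.fst, Cell.snd, Cell.trd, Side.card_low]

theorem Cell.card_box_hi (k : Fin (numLayers d)) : (Cell.hi k).box.card = 1 := by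
  simp [Cell.box, Cell.fst, Cell.snd, Cell.trd, Side.card_high]

theorem innerCoords_nonempty [NeZero d] : (innerCoords d (numLayers d)).Nonempty := by
  have hd := NeZero.pos d
  refine ⟨⟨numLayers d, ?_⟩, mem_innerCoords.2 ?_⟩ <;> simp only [numLayers] <;> lia

theorem Cell.box_nonempty [NeZero d] (c : Cell d) : c.box.Nonempty := by
  rcases c with ⟨k, p⟩ | k | k | _
  · exact Finset.card_pos.1 (Cell.card_box_face k p ▸ pow_pos (side_pos k) 2)
  · exact Finset.card_pos.1 (Cell.card_box_lo k ▸ Nat.one_pos)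
  · exact Finset.card_pos.1 (Cell.card_box_hi k ▸ Nat.one_pos)
  · exact innerCoords_nonempty.product (innerCoords_nonempty.product innerCoords_nonempty)

/-- The six facial blocks, the two corners and the centre, as an enumeration of the cells. -/
def Cell.equivSum (d : ℕ) : Cell d ≃ (Fin (numLayers d) × (Face ⊕ Fin 2)) ⊕ Unit where
  toFun
    | .face k p => .inl (k, .inl p)
    | .lo k => .inl (k, .inr 0)
    | .hi k => .inl (k, .inr 1)
    | .core => .inr ()
  invFun
    | .inl (k, .inl p) => .face k p
    | .inl (k, .inr 0) => .lo k
    | .inl (k, .inr 1) => .hi k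
    | .inr () => .core
  left_inv c := by rcases c with _ | _ | _ | _ <;> rfl
  right_inv c := by rcases c with ⟨k, p | i⟩ | _ <;> [rfl; (fin_cases i <;> rfl); rfl]

end Cells

section Blocks

variable {d : ℕ}

theorem mem_innerCoords_numLayers_iff [NeZero d] (he : Even d) {a : Fin d} :
    a ∈ innerCoords d (numLayers d) ↔ 2 * (a : ℕ) + 2 = d ∨ 2 * (a : ℕ) = d := by
  have hd := NeZero.pos d
  obtain ⟨m, hm⟩ := he
  simp only [mem_innerCoords, numLayers]
  lia

theorem phi_zero [NeZero d] (he : Even d) :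
    phi d 0 = indVec (innerCoords d (numLayers d)) := by
  ext a
  simp only [indVec_apply, mem_innerCoords_numLayers_iff he, phi]
  split_ifs <;> simp_all

theorem isLocalBasis_range_phi [NeZero d] (he : Even d) :
    IsLocalBasis (innerCoords d (numLayers d)) (Set.range (phi d)) := by
  obtain ⟨m, hm⟩ := he.two_dvd
  have hd := NeZero.pos d
  let a₁ : Fin d := ⟨m - 1, by lia⟩
  let a₂ : Fin d := ⟨m, by lia⟩
  have hne : a₁ ≠ a₂ := by simp only [a₁, a₂, ne_eq, Fin.mk.injEq]; lia
  have hphi (l : Fin 2) : phi d l = ket a₁ + (-1 : ℂ) ^ (l : ℕ) • ket a₂ := by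
    ext a
    have h₁ : 2 * (a : ℕ) + 2 = d ↔ a = a₁ := by simp only [a₁, Fin.ext_iff]; lia
    have h₂ : 2 * (a : ℕ) = d ↔ a = a₂ := by simp only [a₂, Fin.ext_iff]; lia
    simp only [phi, h₁, h₂, PiLp.add_apply, PiLp.smul_apply, ket_apply, smul_eq_mul]
    split_ifs <;> simp_all
  have hinner (a b : Fin d) : inner ℂ (ket a) (ket b) = if a = b then (1 : ℂ) else 0 :=
    orthonormal_iff_ite.1 orthonormal_ket a b
  refine isLocalBasis_range (fun l h => ?_) (fun l l' hl => ?_) (fun l => ?_) ?_ (phi_zero he)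
  · simpa [hphi, hne] using congrArg (fun v : Qudit d => v a₁) h
  · fin_cases l <;> fin_cases l' <;>
      simp [hphi, inner_add_left, hinner, hne, hne.symm, orthonormal_ket.1] at hl ⊢
  · refine mem_span_ket_iff.2 fun a ha => ?_
    rw [mem_innerCoords_numLayers_iff he, not_or] at ha
    simp [phi, ha.1, ha.2]
  · have : innerCoords d (numLayers d) = {a₁, a₂} := by
      ext a
      simp only [mem_innerCoords_numLayers_iff he, Finset.mem_insert, Finset.mem_singleton,
        Fin.ext_iff, a₁, a₂]
      lia
    rw [this, Finset.card_pair hne, Fintype.card_fin]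

theorem exists_innerCoords_eq_singleton (ho : ¬Even d) :
    ∃ a, innerCoords d (numLayers d) = {a} := by
  obtain ⟨m, rfl⟩ := Nat.not_even_iff_odd.1 ho
  refine ⟨⟨m, by lia⟩, Finset.ext fun a => ?_⟩
  simp only [mem_innerCoords, numLayers, Finset.mem_singleton, Fin.ext_iff]
  lia

/-- The local vectors used on a side by the twisted product basis. -/
def Side.basis (V : LayerVectors d) : Side d → Set (Qudit d)
  | .low k => {ket (BlockCube.low k)}
  | .high k => {ket (BlockCube.high k)}
  | .eta k => Set.range (V.eta k)
  | .xi k => Set.range (V.xi k)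
  | .core => if Even d then Set.range (phi d) else {indVec (innerCoords d (numLayers d))}

theorem Side.isLocalBasis [NeZero d] (V : LayerVectors d) :
    ∀ s : Side d, IsLocalBasis s.coords (s.basis V)
  | .low _ => isLocalBasis_singleton _
  | .high _ => isLocalBasis_singleton _
  | .eta k => isLocalBasis_range (V.eta_ne_zero k) (V.eta_orthogonal k)
      (by simpa [Side.coords] using V.eta_mem k) (by simp [Side.card_eta]) (V.eta_zero k)
  | .xi k => isLocalBasis_range (V.xi_ne_zero k) (V.xi_orthogonal k)
      (by simpa [Side.coords] using V.xi_mem k) (by simp [Side.card_xi]) (V.xi_zero k)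
  | .core => by
    unfold Side.basis Side.coords
    split_ifs with he
    · exact isLocalBasis_range_phi he
    · obtain ⟨a, ha⟩ := exists_innerCoords_eq_singleton he
      simpa [ha, indVec] using isLocalBasis_singleton a

/-- The product vectors with local factors from the three sides of a cell. -/
def block (V : LayerVectors d) (c : Cell d) : Set (ThreeQudit d) :=
  {v | ∃ x ∈ c.fst.basis V, ∃ y ∈ c.snd.basis V, ∃ z ∈ c.trd.basis V, v = tri x y z}

/-- The indicator vector of a cell, which is the vector `ψ(0,0)` of a facial block. -/
def cellVec (c : Cell d) : ThreeQudit d :=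
  tri (indVec c.fst.coords) (indVec c.snd.coords) (indVec c.trd.coords)

theorem cellVec_apply (c : Cell d) (t : Cube d) : cellVec c t = if t ∈ c.box then 1 else 0 := by
  simp only [cellVec, tri_apply, indVec_apply, Cell.mem_box]
  split_ifs <;> simp_all

section

variable [NeZero d] (V : LayerVectors d)

theorem cellVec_mem_block (c : Cell d) : cellVec c ∈ block V c :=
  ⟨_, (c.fst.isLocalBasis V).indVec_mem, _, (c.snd.isLocalBasis V).indVec_mem, _,
    (c.trd.isLocalBasis V).indVec_mem, rfl⟩

variable {V}

theorem apply_eq_zero_of_mem_block {c : Cell d} {v : ThreeQudit d} (hv : v ∈ block V c)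
    {t : Cube d} (ht : t ∉ c.box) : v t = 0 := by
  obtain ⟨x, hx, y, hy, z, hz, rfl⟩ := hv
  simp only [Cell.mem_box, not_and_or] at ht
  rcases ht with ht | ht | ht
  · simp [(c.fst.isLocalBasis V).apply_eq_zero hx ht]
  · simp [(c.snd.isLocalBasis V).apply_eq_zero hy ht]
  · simp [(c.trd.isLocalBasis V).apply_eq_zero hz ht]

variable (V)

theorem isOrthogonalSet_block (c : Cell d) : IsOrthogonalSet (block V c) := by
  have h₁ := (c.fst.isLocalBasis V).isOrthogonalSet
  have h₂ := (c.snd.isLocalBasis V).isOrthogonalSet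
  have h₃ := (c.trd.isLocalBasis V).isOrthogonalSet
  refine ⟨?_, ?_⟩
  · rintro _ ⟨x, hx, y, hy, z, hz, rfl⟩
    rw [← inner_self_ne_zero (𝕜 := ℂ), inner_tri]
    simp only [mul_ne_zero_iff, inner_self_ne_zero]
    exact ⟨⟨h₁.ne_zero x hx, h₂.ne_zero y hy⟩, h₃.ne_zero z hz⟩
  · rintro _ ⟨x, hx, y, hy, z, hz, rfl⟩ _ ⟨x', hx', y', hy', z', hz', rfl⟩ hne
    have : x ≠ x' ∨ y ≠ y' ∨ z ≠ z' := by
      by_contra! h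
      exact hne (by rw [h.1, h.2.1, h.2.2])
    rw [inner_tri]
    rcases this with h | h | h
    · simp [h₁.pairwise hx hx' h]
    · simp [h₂.pairwise hy hy' h]
    · simp [h₃.pairwise hz hz' h]

variable {V}

theorem inner_eq_zero_of_mem_blocks {c c' : Cell d} (hc : c ≠ c') {v w : ThreeQudit d}
    (hv : v ∈ block V c) (hw : w ∈ block V c') : inner ℂ v w = 0 := by
  rw [PiLp.inner_apply]
  refine Finset.sum_eq_zero fun t _ => ?_
  by_cases h : t ∈ c.box
  · simp [apply_eq_zero_of_mem_block hw fun h' => hc (Cell.eq_of_mem h h')]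
  · simp [apply_eq_zero_of_mem_block hv h]

variable (V)

theorem isOrthogonalSet_iUnion_block : IsOrthogonalSet (⋃ c, block V c) := by
  refine ⟨fun v hv => ?_, fun v hv w hw hne => ?_⟩
  · obtain ⟨c, hc⟩ := Set.mem_iUnion.1 hv
    exact (isOrthogonalSet_block V c).ne_zero v hc
  · obtain ⟨c, hc⟩ := Set.mem_iUnion.1 hv
    obtain ⟨c', hc'⟩ := Set.mem_iUnion.1 hw
    obtain rfl | h := eq_or_ne c c'
    · exact (isOrthogonalSet_block V c).pairwise hc hc' hne
    · exact inner_eq_zero_of_mem_blocks h hc hc'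

theorem span_iUnion_block : Submodule.span ℂ (⋃ c, block V c) = ⊤ := by
  rw [eq_top_iff, ← (EuclideanSpace.basisFun (Cube d) ℂ).toBasis.span_eq, Submodule.span_le]
  rintro _ ⟨t, rfl⟩
  obtain ⟨c, hc⟩ := Cell.exists_mem t
  obtain ⟨h₁, h₂, h₃⟩ := Cell.mem_box.1 hc
  have := tri_mem_span ((c.fst.isLocalBasis V).ket_mem_span h₁)
    ((c.snd.isLocalBasis V).ket_mem_span h₂) ((c.trd.isLocalBasis V).ket_mem_span h₃)
  rw [tri_ket] at this
  simpa using Submodule.span_mono (Set.subset_iUnion (block V) c) this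

end

end Blocks

section TwistedBasis

variable {d : ℕ} (V : LayerVectors d)

theorem faceBlock_eq (k : Fin (numLayers d)) (p : Face) :
    faceBlock V k p = block V (.face k p) := by
  ext v
  cases p
  case f1 | f2 | f4 => simp [faceBlock, psi, block, Cell.fst, Cell.snd, Cell.trd, Side.basis]
  case f3 | f5 | f6 =>
    exact (exists_comm (p := fun i j => v = psi V k _ i j)).trans
      (by simp [psi, block, Cell.fst, Cell.snd, Cell.trd, Side.basis])

theorem psi00_eq (k : Fin (numLayers d)) (p : Face) : psi00 V k p = cellVec (.face k p) := by
  cases p <;> simp [psi00, psi, cellVec, Cell.fst, Cell.snd, Cell.trd, Side.coords, indVec,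
    V.eta_zero, V.xi_zero]

theorem diag_low (k : Fin (numLayers d)) : diag (low k) = cellVec (.lo k) := by
  simp [diag, cellVec, Cell.fst, Cell.snd, Cell.trd, Side.coords, indVec]

theorem diag_high (k : Fin (numLayers d)) : diag (high k) = cellVec (.hi k) := by
  simp [diag, cellVec, Cell.fst, Cell.snd, Cell.trd, Side.coords, indVec]

theorem block_lo (k : Fin (numLayers d)) : block V (.lo k) = {cellVec (.lo k)} := by
  ext v
  simp [block, Cell.fst, Cell.snd, Cell.trd, Side.basis, ← diag_low, diag]

theorem block_hi (k : Fin (numLayers d)) : block V (.hi k) = {cellVec (.hi k)} := by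
  ext v
  simp [block, Cell.fst, Cell.snd, Cell.trd, Side.basis, ← diag_high, diag]

theorem block_core_of_even (he : Even d) : block V .core = centralBlock d := by
  ext v
  simp [block, Cell.fst, Cell.snd, Cell.trd, Side.basis, he, centralBlock]

theorem block_core_of_odd (ho : ¬Even d) : block V .core = {cellVec .core} := by
  ext v
  simp [block, Cell.fst, Cell.snd, Cell.trd, Side.basis, ho, cellVec, Side.coords]

theorem diag_eq_cellVec_core {a : Fin d} (h : innerCoords d (numLayers d) = {a}) :
    diag a = cellVec .core := by
  simp [diag, cellVec, Cell.fst, Cell.snd, Cell.trd, Side.coords, indVec, h]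

theorem tri_phi_zero [NeZero d] (he : Even d) :
    tri (phi d 0) (phi d 0) (phi d 0) = cellVec .core := by
  simp [cellVec, Cell.fst, Cell.snd, Cell.trd, Side.coords, phi_zero he]

theorem coord_cases (a : Fin d) :
    (∃ k : Fin (numLayers d), a = low k) ∨ (∃ k : Fin (numLayers d), a = high k) ∨
      a ∈ innerCoords d (numLayers d) := by
  by_cases h₁ : (a : ℕ) < numLayers d
  · exact .inl ⟨⟨a, h₁⟩, rfl⟩
  by_cases h₂ : d - 1 - (a : ℕ) < numLayers d
  · exact .inr (.inl ⟨⟨d - 1 - a, h₂⟩, by simp only [Fin.ext_iff, high]; lia⟩)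
  · exact .inr (.inr (mem_innerCoords.2 (by lia)))

theorem not_isMiddle_low (k : Fin (numLayers d)) : ¬IsMiddle (low k) := by
  have := two_mul_lt k
  simp only [IsMiddle, low]
  lia

theorem not_isMiddle_high (k : Fin (numLayers d)) : ¬IsMiddle (high k) := by
  have := two_mul_lt k
  simp only [IsMiddle, high]
  lia

theorem twistedBasis_eq [NeZero d] : twistedBasis V = ⋃ c, block V c := by
  refine Set.Subset.antisymm ?_ (Set.iUnion_subset fun c v hv => ?_)
  · rintro v ((⟨a, ha, rfl⟩ | hv) | hv)
    · rw [Set.mem_iUnion]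
      rcases coord_cases a with ⟨k, rfl⟩ | ⟨k, rfl⟩ | hc
      · exact ⟨.lo k, diag_low k ▸ cellVec_mem_block V _⟩
      · exact ⟨.hi k, diag_high k ▸ cellVec_mem_block V _⟩
      · have ho : ¬Even d := fun he => ha ⟨he, (mem_innerCoords_numLayers_iff he).1 hc⟩
        obtain ⟨b, hb⟩ := exists_innerCoords_eq_singleton ho
        obtain rfl := Finset.mem_singleton.1 (hb ▸ hc)
        exact ⟨.core, diag_eq_cellVec_core hb ▸ cellVec_mem_block V _⟩
    · exact Set.mem_iUnion.2 ⟨.core, block_core_of_even V hv.1 ▸ hv⟩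
    · obtain ⟨k, p, hv⟩ := Set.mem_iUnion₂.1 hv
      exact Set.mem_iUnion.2 ⟨.face k p, faceBlock_eq V k p ▸ hv⟩
  · rcases c with ⟨k, p⟩ | k | k | _
    · exact .inr (Set.mem_iUnion₂.2 ⟨k, p, faceBlock_eq V k p ▸ hv⟩)
    · rw [block_lo, ← diag_low] at hv
      exact .inl (.inl ⟨_, not_isMiddle_low k, hv⟩)
    · rw [block_hi, ← diag_high] at hv
      exact .inl (.inl ⟨_, not_isMiddle_high k, hv⟩)
    · by_cases he : Even d
      · exact .inl (.inr (block_core_of_even V he ▸ hv))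
      · obtain ⟨a, ha⟩ := exists_innerCoords_eq_singleton he
        rw [block_core_of_odd V he, ← diag_eq_cellVec_core ha] at hv
        exact .inl (.inl ⟨a, fun h => he h.1, hv⟩)

/-- The twisted product basis without the indicator vectors of the cells. -/
def reducedBasis : Set (ThreeQudit d) := ⋃ c, block V c \ {cellVec c}

theorem productBasis_eq [NeZero d] : productBasis V = reducedBasis V ∪ {stopper d} := by
  refine congrArg (· ∪ _) (Set.Subset.antisymm ?_ (Set.iUnion_subset fun c v hv => ?_))
  · rintro v (hv | hv)
    · obtain ⟨k, p, hv⟩ := Set.mem_iUnion₂.1 hv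
      exact Set.mem_iUnion.2 ⟨.face k p, psi00_eq V k p ▸ faceBlock_eq V k p ▸ hv⟩
    · have he := hv.1.1
      exact Set.mem_iUnion.2 ⟨.core, tri_phi_zero he ▸ block_core_of_even V he ▸ hv⟩
  · rcases c with ⟨k, p⟩ | k | k | _
    · rw [← faceBlock_eq, ← psi00_eq V] at hv
      exact .inl (Set.mem_iUnion₂.2 ⟨k, p, hv⟩)
    · simp [block_lo] at hv
    · simp [block_hi] at hv
    · by_cases he : Even d
      · rw [← tri_phi_zero he, block_core_of_even V he] at hv
        exact .inr hv
      · simp [block_core_of_odd V he] at hv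

end TwistedBasis

section BlockConstant

variable {d : ℕ}

instance : Fintype Face where
  elems := ⟨([.f1, .f2, .f3, .f4, .f5, .f6] : List Face), by simp⟩
  complete := by rintro ⟨⟩ <;> simp

instance : Fintype (Cell d) := Fintype.ofEquiv _ (Cell.equivSum d).symm

theorem card_cell : Fintype.card (Cell d) = 8 * numLayers d + 1 := by
  rw [Fintype.card_congr (Cell.equivSum d)]
  have card_face : Fintype.card Face = 6 := rfl
  simp [card_face, mul_comm]

/-- `f` takes the constant value `g c` on each cell `c`. -/
def IsBlockConst {H : Type*} (f : Cube d → H) (g : Cell d → H) : Prop :=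
  ∀ c, ∀ t ∈ c.box, f t = g c

theorem isBlockConst_cellVec (c : Cell d) [DecidableEq (Cell d)] :
    IsBlockConst (cellVec c) (Pi.single c 1) := by
  intro c' t ht
  obtain rfl | h := eq_or_ne c' c
  · simp [cellVec_apply, ht]
  · have ht' : t ∉ c.box := fun h' => h (Cell.eq_of_mem ht h')
    simp [cellVec_apply, h, ht']

theorem isBlockConst_sum (g : Cell d → ℂ) : IsBlockConst ⇑(∑ c, g c • cellVec c) g := by
  classical
  intro c t ht
  simp [isBlockConst_cellVec _ c t ht, Pi.single_apply]

theorem IsBlockConst.eq_sum {f : ThreeQudit d} {g : Cell d → ℂ} (h : IsBlockConst f g) :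
    f = ∑ c, g c • cellVec c := by
  ext t
  obtain ⟨c, hc⟩ := Cell.exists_mem t
  rw [h c t hc, isBlockConst_sum g c t hc]

theorem mem_span_range_cellVec_iff {f : ThreeQudit d} :
    f ∈ Submodule.span ℂ (Set.range cellVec) ↔ ∃ g, IsBlockConst f g := by
  rw [Submodule.mem_span_range_iff_exists_fun]
  exact ⟨fun ⟨g, hg⟩ => ⟨g, hg ▸ isBlockConst_sum g⟩, fun ⟨g, hg⟩ => ⟨g, hg.eq_sum.symm⟩⟩

theorem inner_cellVec (c : Cell d) (f : ThreeQudit d) :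
    inner ℂ (cellVec c) f = ∑ t ∈ c.box, f t := by
  simp [PiLp.inner_apply, cellVec_apply, Finset.sum_ite_mem]

theorem inner_cellVec_of_isBlockConst {f : ThreeQudit d} {g : Cell d → ℂ} (h : IsBlockConst f g)
    (c : Cell d) : inner ℂ (cellVec c) f = c.box.card * g c := by
  rw [inner_cellVec, Finset.sum_congr rfl (h c), Finset.sum_const, nsmul_eq_mul]

theorem inner_cellVec_self (c : Cell d) : inner ℂ (cellVec c) (cellVec c) = (c.box.card : ℂ) := by
  classical
  rw [inner_cellVec_of_isBlockConst (isBlockConst_cellVec c), Pi.single_eq_same, mul_one]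

theorem inner_cellVec_of_ne {c c' : Cell d} (h : c ≠ c') :
    inner ℂ (cellVec c) (cellVec c') = 0 := by
  classical
  simp [inner_cellVec_of_isBlockConst (isBlockConst_cellVec c'), h]

@[simp] theorem stopper_apply (t : Cube d) : stopper d t = 1 := by
  simp [stopper, ket_apply]

theorem inner_stopper (f : ThreeQudit d) : inner ℂ (stopper d) f = ∑ t, f t := by
  simp [PiLp.inner_apply]

theorem Cell.card_box_ne_zero [NeZero d] (c : Cell d) : (c.box.card : ℂ) ≠ 0 :=
  Nat.cast_ne_zero.2 (Finset.card_ne_zero.2 c.box_nonempty)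

theorem cellVec_ne_zero [NeZero d] (c : Cell d) : cellVec c ≠ 0 := by
  rw [← inner_self_ne_zero (𝕜 := ℂ), inner_cellVec_self]
  exact c.card_box_ne_zero

section ReducedBasis

variable [NeZero d] (V : LayerVectors d)

theorem iUnion_block_eq : ⋃ c, block V c = reducedBasis V ∪ Set.range cellVec := by
  rw [reducedBasis, ← Set.iUnion_singleton_eq_range, ← Set.iUnion_union_distrib]
  exact Set.iUnion_congr fun c => by simp [cellVec_mem_block]

theorem isOrthogonalSet_reducedBasis : IsOrthogonalSet (reducedBasis V) :=
  (isOrthogonalSet_iUnion_block V).mono (iUnion_block_eq V ▸ Set.subset_union_left)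

theorem inner_reducedBasis_cellVec {u : ThreeQudit d} (hu : u ∈ reducedBasis V) (c : Cell d) :
    inner ℂ u (cellVec c) = 0 := by
  obtain ⟨c', hu, hne⟩ := Set.mem_iUnion.1 hu
  obtain rfl | h := eq_or_ne c' c
  · exact (isOrthogonalSet_block V c').pairwise hu (cellVec_mem_block V c') hne
  · exact inner_eq_zero_of_mem_blocks h hu (cellVec_mem_block V c)

theorem complementary_reducedBasis :
    complementary (reducedBasis V) = Submodule.span ℂ (Set.range cellVec) :=
  orthogonal_span_eq_span
    (fun _ hu => Set.forall_mem_range.2 fun c => inner_reducedBasis_cellVec V hu c)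
    (iUnion_block_eq V ▸ span_iUnion_block V)

theorem forall_inner_reducedBasis_eq_zero_iff {f : ThreeQudit d} :
    (∀ u ∈ reducedBasis V, inner ℂ u f = 0) ↔ ∃ g, IsBlockConst f g := by
  rw [← mem_orthogonal_span_iff, ← mem_span_range_cellVec_iff, ← complementary_reducedBasis V]
  rfl

omit [NeZero d] in
theorem ncard_add_finrank_complementary {U : Set (ThreeQudit d)} (hU : IsOrthogonalSet U) :
    U.ncard + finrank ℂ (complementary U) = d ^ 3 := by
  rw [complementary, hU.ncard_add_finrank_orthogonal, finrank_euclideanSpace]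
  simp [pow_succ, mul_assoc]

theorem ncard_reducedBasis : (reducedBasis V).ncard + (8 * numLayers d + 1) = d ^ 3 := by
  have h : LinearIndependent ℂ (cellVec (d := d)) :=
    linearIndependent_of_ne_zero_of_inner_eq_zero cellVec_ne_zero fun _ _ => inner_cellVec_of_ne
  rw [← ncard_add_finrank_complementary (isOrthogonalSet_reducedBasis V),
    complementary_reducedBasis, finrank_span_eq_card h, card_cell]

end ReducedBasis

section ExtendedBasis

/-- The indicator vector of a cell, scaled to become orthogonal to the stopper when the indicator
vector of another cell is subtracted; it generalizes `ψ(0,0)_p - ψ(0,0)_q` and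
`m² |aaa⟩ - ψ(0,0)_p`. -/
def minusVec (c c' : Cell d) : ThreeQudit d :=
  (c'.box.card / c.box.card : ℂ) • cellVec c - cellVec c'

/-- The reduced basis, the stopper and the differences `minusVec` of given pairs of cells; all
three sets of product or biseparable vectors have this form. -/
def extendedBasis (V : LayerVectors d) {κ : Type*} (P N : κ → Cell d) : Set (ThreeQudit d) :=
  reducedBasis V ∪ {stopper d} ∪ Set.range fun i => minusVec (P i) (N i)

variable [NeZero d]

theorem inner_minusVec_of_isBlockConst {f : ThreeQudit d} {g : Cell d → ℂ} (h : IsBlockConst f g)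
    (c c' : Cell d) : inner ℂ (minusVec c c') f = c'.box.card * (g c - g c') := by
  have := c.card_box_ne_zero
  simp only [minusVec, inner_sub_left, inner_smul_left, inner_cellVec_of_isBlockConst h, map_div₀,
    Complex.conj_natCast]
  field_simp

theorem inner_minusVec_stopper (c c' : Cell d) : inner ℂ (minusVec c c') (stopper d) = 0 := by
  rw [inner_minusVec_of_isBlockConst (g := fun _ => 1) fun _ _ _ => stopper_apply _, sub_self,
    mul_zero]

theorem minusVec_ne_zero {c c' : Cell d} (h : c ≠ c') : minusVec c c' ≠ 0 := by
  intro h0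
  have : inner ℂ (cellVec c') (minusVec c c') = -(c'.box.card : ℂ) := by
    rw [minusVec, inner_sub_right, inner_smul_right, inner_cellVec_of_ne h.symm,
      inner_cellVec_self, mul_zero, zero_sub]
  rw [h0, inner_zero_right, eq_comm, neg_eq_zero] at this
  exact c'.card_box_ne_zero this

theorem stopper_ne_zero : stopper d ≠ 0 := fun h => by
  simpa [h] using stopper_apply ((0, 0, 0) : Cube d)

variable (V : LayerVectors d) {κ : Type*} {P N : κ → Cell d}

omit [NeZero d] in
theorem pairwise_inner_minusVec (h : Function.Injective (Sum.elim P N)) :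
    Pairwise fun i j => inner ℂ (minusVec (P i) (N i)) (minusVec (P j) (N j)) = 0 := by
  intro i j hij
  have hPP : P i ≠ P j := h.ne (a₁ := .inl i) (a₂ := .inl j) (by simpa)
  have hPN : P i ≠ N j := h.ne (a₁ := .inl i) (a₂ := .inr j) (by simp)
  have hNP : N i ≠ P j := h.ne (a₁ := .inr i) (a₂ := .inl j) (by simp)
  have hNN : N i ≠ N j := h.ne (a₁ := .inr i) (a₂ := .inr j) (by simpa)
  simp only [minusVec, inner_sub_left, inner_sub_right, inner_smul_left, inner_smul_right,
    inner_cellVec_of_ne, ne_eq, hPP, hPN, hNP, hNN, not_false_eq_true, mul_zero, sub_zero]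

theorem isOrthogonalSet_extendedBasis_and_ncard [Fintype κ]
    (h : Function.Injective (Sum.elim P N)) :
    IsOrthogonalSet (extendedBasis V P N) ∧
      (extendedBasis V P N).ncard + 8 * numLayers d = d ^ 3 + Fintype.card κ := by
  have hne (i : κ) : minusVec (P i) (N i) ≠ 0 :=
    minusVec_ne_zero (h.ne (a₁ := .inl i) (a₂ := .inr i) (by simp))
  have hR := isOrthogonalSet_range hne (pairwise_inner_minusVec h)
  have hinj := (linearIndependent_of_ne_zero_of_inner_eq_zero hne
    (pairwise_inner_minusVec h)).injective
  have hS : IsOrthogonalSet {stopper d} := ⟨by simp [stopper_ne_zero], by simp⟩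
  have hU := isOrthogonalSet_reducedBasis V
  have hUS : ∀ u ∈ reducedBasis V, ∀ v ∈ ({stopper d} : Set (ThreeQudit d)), inner ℂ u v = 0 := by
    rintro u hu v rfl
    exact (forall_inner_reducedBasis_eq_zero_iff V).2 ⟨fun _ => 1, fun _ _ _ => by simp⟩ u hu
  have hUSR : ∀ u ∈ reducedBasis V ∪ {stopper d},
      ∀ v ∈ Set.range fun i => minusVec (P i) (N i), inner ℂ u v = 0 := by
    rintro u (hu | rfl) _ ⟨i, rfl⟩
    · simp only [minusVec, inner_sub_right, inner_smul_right, inner_reducedBasis_cellVec V hu,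
        mul_zero, sub_zero]
    · exact inner_eq_zero_symm.1 (inner_minusVec_stopper _ _)
  refine ⟨(hU.union hS hUS).union hR hUSR, ?_⟩
  rw [extendedBasis, (hU.union hS hUS).ncard_union hR hUSR, hU.ncard_union hS hUS,
    Set.ncard_range_of_injective hinj, Set.ncard_singleton, ← ncard_reducedBasis V,
    Nat.card_eq_fintype_card]
  ring

theorem finrank_complementary_extendedBasis [Fintype κ]
    (h : Function.Injective (Sum.elim P N)) :
    finrank ℂ (complementary (extendedBasis V P N)) + Fintype.card κ = 8 * numLayers d := by
  obtain ⟨horth, hcard⟩ := isOrthogonalSet_extendedBasis_and_ncard V h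
  have := ncard_add_finrank_complementary horth
  omega

theorem mem_complementary_extendedBasis {f : ThreeQudit d} :
    f ∈ complementary (extendedBasis V P N) ↔
      ∃ g, IsBlockConst f g ∧ ∑ t, f t = 0 ∧ ∀ i, g (P i) = g (N i) := by
  have hminus {g : Cell d → ℂ} (hg : IsBlockConst f g) (c c' : Cell d) :
      inner ℂ (minusVec c c') f = 0 ↔ g c = g c' := by
    rw [inner_minusVec_of_isBlockConst hg, mul_eq_zero, or_iff_right c'.card_box_ne_zero,
      sub_eq_zero]
  simp only [complementary, mem_orthogonal_span_iff, extendedBasis, Set.mem_union, or_imp,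
    forall_and, Set.mem_singleton_iff, forall_eq, Set.forall_mem_range, inner_stopper,
    forall_inner_reducedBasis_eq_zero_iff]
  constructor
  · rintro ⟨⟨⟨g, hg⟩, hsum⟩, hPN⟩
    exact ⟨g, hg, hsum, fun i => (hminus hg _ _).1 (hPN i)⟩
  · rintro ⟨g, hg, hsum, hPN⟩
    exact ⟨⟨⟨g, hg⟩, hsum⟩, fun i => (hminus hg _ _).2 (hPN i)⟩

end ExtendedBasis

end BlockConstant

section Existence

variable {d : ℕ}

theorem exists_orthogonal_family_extending {W : Submodule ℂ (Qudit d)} {u : Qudit d} (hu : u ∈ W)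
    (hu₀ : u ≠ 0) {m : ℕ} (hm : finrank ℂ W = m) (i₀ : Fin m) :
    ∃ e : Fin m → Qudit d, e i₀ = u ∧ (∀ i, e i ∈ W) ∧ (∀ i, e i ≠ 0) ∧
      Pairwise fun i j => inner ℂ (e i) (e j) = 0 := by
  have hnorm : (‖u‖ : ℂ) ≠ 0 := by simpa using hu₀
  let v : Fin m → W := fun _ => (‖u‖ : ℂ)⁻¹ • ⟨u, hu⟩
  have hv : Orthonormal ℂ (Set.domRestrict {i₀} v) := by
    refine ⟨fun _ => ?_, fun i j hij => absurd (Subsingleton.elim i j) hij⟩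
    exact norm_smul_inv_norm (𝕜 := ℂ) (x := (⟨u, hu⟩ : W)) (by simpa using hu₀)
  obtain ⟨b, hb⟩ := hv.exists_orthonormalBasis_extension_of_card_eq (by simp [hm])
  refine ⟨fun i => (‖u‖ : ℂ) • (b i : Qudit d), ?_, fun i => W.smul_mem _ (b i).2, fun i => ?_, ?_⟩
  · simp only [hb i₀ rfl, v, Submodule.coe_smul, smul_inv_smul₀ hnorm]
  · exact smul_ne_zero hnorm (Subtype.coe_ne_coe.2 (b.orthonormal.ne_zero i))
  · intro i j hij
    have : inner ℂ (b i : Qudit d) (b j) = 0 := b.orthonormal.2 hij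
    simp only [inner_smul_left, inner_smul_right, this, mul_zero]

theorem exists_orthogonal_family_of_card {s : Finset (Fin d)} {m : ℕ} (hm : s.card = m)
    (i₀ : Fin m) :
    ∃ e : Fin m → Qudit d, e i₀ = indVec s ∧
      (∀ i, e i ∈ Submodule.span ℂ (ket '' (s : Set (Fin d)))) ∧ (∀ i, e i ≠ 0) ∧
      Pairwise fun i j => inner ℂ (e i) (e j) = 0 := by
  refine exists_orthogonal_family_extending (mem_span_ket_iff.2 fun a ha => by simp [ha]) ?_
    ((finrank_span_ket s).trans hm) i₀
  obtain ⟨a, ha⟩ := Finset.card_pos.1 (hm ▸ i₀.pos)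
  intro h
  simpa [ha] using congrArg (· a) h

theorem nonempty_layerVectors (d : ℕ) : Nonempty (LayerVectors d) := by
  choose e e₀ e_mem e_ne e_orth using fun k : Fin (numLayers d) =>
    exists_orthogonal_family_of_card (Side.card_eta k) (zeroIdx k)
  choose x x₀ x_mem x_ne x_orth using fun k : Fin (numLayers d) =>
    exists_orthogonal_family_of_card (Side.card_xi k) (zeroIdx k)
  exact ⟨{
    eta := e
    xi := x
    eta_zero := e₀
    xi_zero := x₀
    eta_mem := fun k i => by simpa [Side.coords] using e_mem k i
    xi_mem := fun k j => by simpa [Side.coords] using x_mem k j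
    eta_ne_zero := e_ne
    xi_ne_zero := x_ne
    eta_orthogonal := e_orth
    xi_orthogonal := x_orth }⟩

end Existence

section ThreeBases

variable {d : ℕ}

/-- The first cells of the pairs whose differences `minusVec` occur in the symmetric basis. -/
def symFst : Fin (numLayers d) × Fin 3 → Cell d
  | (k, 0) => .face k .f1
  | (k, 1) => .face k .f3
  | (k, 2) => .face k .f5

/-- The second cells of the pairs whose differences `minusVec` occur in the symmetric basis. -/
def symSnd : Fin (numLayers d) × Fin 3 → Cell d
  | (k, 0) => .face k .f2
  | (k, 1) => .face k .f4
  | (k, 2) => .face k .f6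

/-- The first cells of the pairs whose differences `minusVec` occur in the asymmetric basis. -/
def asymFst : Fin (numLayers d) × Fin 4 → Cell d
  | (k, 0) => .face k .f1
  | (k, 1) => .face k .f3
  | (k, 2) => .lo k
  | (k, 3) => .hi k

/-- The second cells of the pairs whose differences `minusVec` occur in the asymmetric basis. -/
def asymSnd : Fin (numLayers d) × Fin 4 → Cell d
  | (k, 0) => .face k .f2
  | (k, 1) => .face k .f5
  | (k, 2) => .face k .f4
  | (k, 3) => .face k .f6

theorem injective_sumElim_symFst_symSnd :
    Function.Injective (Sum.elim symFst symSnd : _ → Cell d) := by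
  rintro (⟨k, i⟩ | ⟨k, i⟩) (⟨k', i'⟩ | ⟨k', i'⟩) h <;> fin_cases i <;> fin_cases i' <;>
    simp_all [symFst, symSnd]

theorem injective_sumElim_asymFst_asymSnd :
    Function.Injective (Sum.elim asymFst asymSnd : _ → Cell d) := by
  rintro (⟨k, i⟩ | ⟨k, i⟩) (⟨k', i'⟩ | ⟨k', i'⟩) h <;> fin_cases i <;> fin_cases i' <;>
    simp_all [asymFst, asymSnd]

variable [NeZero d] (V : LayerVectors d)

omit [NeZero d] in
theorem psiMinus_eq (k : Fin (numLayers d)) (p q : Face) :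
    psiMinus V k p q = minusVec (.face k p) (.face k q) := by
  have : (side d k : ℂ) ≠ 0 := Nat.cast_ne_zero.2 (side_pos k).ne'
  simp [psiMinus, psi00_eq, minusVec, Cell.card_box_face, this]

omit [NeZero d] in
theorem psiMinusDiag_low (k : Fin (numLayers d)) (p : Face) :
    psiMinusDiag V k (low k) p = minusVec (.lo k) (.face k p) := by
  simp [psiMinusDiag, psi00_eq, minusVec, diag_low, Cell.card_box_face, Cell.card_box_lo]

omit [NeZero d] in
theorem psiMinusDiag_high (k : Fin (numLayers d)) (p : Face) :
    psiMinusDiag V k (high k) p = minusVec (.hi k) (.face k p) := by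
  simp [psiMinusDiag, psi00_eq, minusVec, diag_high, Cell.card_box_face, Cell.card_box_hi]

theorem productBasis_eq_extendedBasis :
    productBasis V = extendedBasis V (κ := Empty) (fun e => e.elim) fun e => e.elim := by
  rw [productBasis_eq, extendedBasis, Set.range_eq_empty, Set.union_empty]

theorem symmetricBasis_eq_extendedBasis : symmetricBasis V = extendedBasis V symFst symSnd := by
  rw [symmetricBasis, productBasis_eq, extendedBasis]
  congr 1
  ext v
  simp only [Set.mem_iUnion, Set.mem_insert_iff, Set.mem_singleton_iff, Set.mem_range,
    Prod.exists, Fin.exists_fin_succ, IsEmpty.exists_iff, or_false, psiMinus_eq, eq_comm]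
  rfl

theorem asymmetricBasis_eq_extendedBasis :
    asymmetricBasis V = extendedBasis V asymFst asymSnd := by
  rw [asymmetricBasis, productBasis_eq, extendedBasis]
  congr 1
  ext v
  simp only [Set.mem_iUnion, Set.mem_insert_iff, Set.mem_singleton_iff, Set.mem_range,
    Prod.exists, Fin.exists_fin_succ, IsEmpty.exists_iff, or_false, psiMinus_eq, psiMinusDiag_low,
    psiMinusDiag_high, eq_comm]
  rfl

end ThreeBases

section FilterFreeRows

variable {α β H : Type*} [Fintype α] [Fintype β] [NormedAddCommGroup H] [InnerProductSpace ℂ H]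
  {Φ : α × β → H}

theorem IsFilterFree.inner_row_sub_row_eq_zero (hfree : IsFilterFree (pairing Φ)) {a a' : α}
    {u v : β} (h : Φ (a, u) - Φ (a, v) = Φ (a', u) - Φ (a', v)) (a'' : α) (w : β) :
    inner ℂ (Φ (a, w) - Φ (a', w)) (Φ (a'', u) - Φ (a'', v)) = 0 := by
  classical
  have := hfree (Pi.single a 1 - Pi.single a' 1) (Pi.single a'' 1) (Pi.single u 1 - Pi.single v 1)
    (Pi.single w 1)
  simp only [map_sub, LinearMap.sub_apply, pairing_single] at this
  exact this (by rw [sub_sub_sub_comm, h, sub_self])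

theorem IsFilterFree.inner_row_eq_zero (hfree : IsFilterFree (pairing Φ)) {a : α} {u v : β}
    (h : Φ (a, u) = Φ (a, v)) (a' : α) (w : β) :
    inner ℂ (Φ (a, w)) (Φ (a', u) - Φ (a', v)) = 0 := by
  classical
  have := hfree (Pi.single a 1) (Pi.single a' 1) (Pi.single u 1 - Pi.single v 1) (Pi.single w 1)
  simp only [map_sub, pairing_single] at this
  exact this (by rw [h, sub_self])

theorem eq_zero_of_sum_eq_zero_of_inner {ι : Type*} [Fintype ι] {Φ : ι → H} (hs : ∑ t, Φ t = 0)
    {v : H} (hv : ∀ t, inner ℂ (Φ t) v = 0 ∨ inner ℂ (Φ t) v = inner ℂ v v) (t₀ : ι)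
    (h₀ : Φ t₀ = v) : v = 0 := by
  have hnonneg : ∀ t, 0 ≤ inner ℂ (Φ t) v := fun t => by
    obtain h | h := hv t
    · exact h.ge
    · exact h ▸ RCLike.nonneg_iff.2 ⟨inner_self_nonneg, inner_self_im v⟩
  have hsum : ∑ t, inner ℂ (Φ t) v = 0 := by rw [← sum_inner, hs, inner_zero_left]
  have h := (Finset.sum_eq_zero_iff_of_nonneg fun t _ => hnonneg t).1 hsum t₀ (Finset.mem_univ _)
  rwa [h₀, inner_self_eq_zero] at h

theorem IsFilterFree.pairing_comp_prodMap {γ : Type*} [Fintype γ] (hfree : IsFilterFree (pairing Φ))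
    (e : γ ≃ β) : IsFilterFree (pairing (Φ ∘ Prod.map id e)) := by
  have key (x : α → ℂ) (y : γ → ℂ) :
      pairing (Φ ∘ Prod.map id e) x y = pairing Φ x (y ∘ e.symm) := by
    rw [pairing_apply, pairing_apply, ← Equiv.sum_comp ((Equiv.refl α).prodCongr e)]
    simp
  intro x x' y y' h
  rw [key] at h
  rw [key, key]
  exact hfree _ _ _ _ h

end FilterFreeRows

section Layers

variable {d : ℕ}

theorem low_mem_eta (k : Fin (numLayers d)) : low k ∈ (Side.eta k).coords := by
  have := two_mul_lt k
  simp only [Side.mem_eta, low]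
  lia

theorem high_mem_xi (k : Fin (numLayers d)) : high k ∈ (Side.xi k).coords := by
  have := two_mul_lt k
  simp only [Side.mem_xi, high]
  lia

/-- The coordinate following the lowest one of layer `k`; it is an inner coordinate of the layer. -/
def next (k : Fin (numLayers d)) : Fin d := ⟨k + 1, by have := two_mul_lt k; omega⟩

theorem next_mem_eta (k : Fin (numLayers d)) : next k ∈ (Side.eta k).coords := by
  have := two_mul_lt k
  simp only [Side.mem_eta, next]
  lia

theorem next_mem_xi (k : Fin (numLayers d)) : next k ∈ (Side.xi k).coords := by
  have := two_mul_lt k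
  simp only [Side.mem_xi, next]
  lia

namespace IsBlockConst

variable {H : Type*} {Φ : Cube d → H} {g : Cell d → H} {k : Fin (numLayers d)} {a b c : Fin d}

theorem apply_lo (hΦ : IsBlockConst Φ g) : Φ (low k, low k, low k) = g (.lo k) :=
  hΦ _ _ (by simp [Cell.mem_box, Cell.fst, Cell.snd, Cell.trd, Side.coords])

theorem apply_hi (hΦ : IsBlockConst Φ g) : Φ (high k, high k, high k) = g (.hi k) :=
  hΦ _ _ (by simp [Cell.mem_box, Cell.fst, Cell.snd, Cell.trd, Side.coords])

theorem apply_f1 (hΦ : IsBlockConst Φ g) (hb : b ∈ (Side.eta k).coords)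
    (hc : c ∈ (Side.xi k).coords) : Φ (low k, b, c) = g (.face k .f1) :=
  hΦ _ _ (Cell.mem_box.2 ⟨Finset.mem_singleton_self _, hb, hc⟩)

theorem apply_f2 (hΦ : IsBlockConst Φ g) (ha : a ∈ (Side.eta k).coords)
    (hc : c ∈ (Side.xi k).coords) : Φ (a, high k, c) = g (.face k .f2) :=
  hΦ _ _ (Cell.mem_box.2 ⟨ha, Finset.mem_singleton_self _, hc⟩)

theorem apply_f3 (hΦ : IsBlockConst Φ g) (hb : b ∈ (Side.xi k).coords)
    (hc : c ∈ (Side.eta k).coords) : Φ (high k, b, c) = g (.face k .f3) :=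
  hΦ _ _ (Cell.mem_box.2 ⟨Finset.mem_singleton_self _, hb, hc⟩)

theorem apply_f4 (hΦ : IsBlockConst Φ g) (ha : a ∈ (Side.eta k).coords)
    (hb : b ∈ (Side.xi k).coords) : Φ (a, b, low k) = g (.face k .f4) :=
  hΦ _ _ (Cell.mem_box.2 ⟨ha, hb, Finset.mem_singleton_self _⟩)

theorem apply_f5 (hΦ : IsBlockConst Φ g) (ha : a ∈ (Side.xi k).coords)
    (hc : c ∈ (Side.eta k).coords) : Φ (a, low k, c) = g (.face k .f5) :=
  hΦ _ _ (Cell.mem_box.2 ⟨ha, Finset.mem_singleton_self _, hc⟩)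

theorem apply_f6 (hΦ : IsBlockConst Φ g) (ha : a ∈ (Side.xi k).coords)
    (hb : b ∈ (Side.eta k).coords) : Φ (a, b, high k) = g (.face k .f6) :=
  hΦ _ _ (Cell.mem_box.2 ⟨ha, hb, Finset.mem_singleton_self _⟩)

theorem apply_low_cases (hΦ : IsBlockConst Φ g) (hb : b ∈ innerCoords d k)
    (hc : c ∈ innerCoords d k) :
    (b, c) = (low k, low k) ∨ Φ (low k, b, c) = g (.face k .f1) ∨
      Φ (low k, b, c) = g (.face k .f2) ∨ Φ (low k, b, c) = g (.face k .f4) := by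
  have cases : b = low k ∧ c = low k ∨ b ∈ (Side.eta k).coords ∧ c ∈ (Side.xi k).coords ∨
      b = high k ∧ c ∈ (Side.xi k).coords ∨ b ∈ (Side.xi k).coords ∧ c = low k := by
    have := two_mul_lt k
    simp only [mem_innerCoords, Side.mem_eta, Side.mem_xi, Fin.ext_iff, low, high] at hb hc ⊢
    lia
  rcases cases with ⟨rfl, rfl⟩ | ⟨hb, hc⟩ | ⟨rfl, hc⟩ | ⟨hb, rfl⟩
  exacts [.inl rfl, .inr (.inl (hΦ.apply_f1 hb hc)),
    .inr (.inr (.inl (hΦ.apply_f2 (low_mem_eta k) hc))),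
    .inr (.inr (.inr (hΦ.apply_f4 (low_mem_eta k) hb)))]

theorem apply_high_cases (hΦ : IsBlockConst Φ g) (hb : b ∈ innerCoords d k)
    (hc : c ∈ innerCoords d k) :
    (b, c) = (high k, high k) ∨ Φ (high k, b, c) = g (.face k .f3) ∨
      Φ (high k, b, c) = g (.face k .f5) ∨ Φ (high k, b, c) = g (.face k .f6) := by
  have cases : b = high k ∧ c = high k ∨ b ∈ (Side.xi k).coords ∧ c ∈ (Side.eta k).coords ∨
      b = low k ∧ c ∈ (Side.eta k).coords ∨ b ∈ (Side.eta k).coords ∧ c = high k := by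
    have := two_mul_lt k
    simp only [mem_innerCoords, Side.mem_eta, Side.mem_xi, Fin.ext_iff, low, high] at hb hc ⊢
    lia
  rcases cases with ⟨rfl, rfl⟩ | ⟨hb, hc⟩ | ⟨rfl, hc⟩ | ⟨hb, rfl⟩
  exacts [.inl rfl, .inr (.inl (hΦ.apply_f3 hb hc)),
    .inr (.inr (.inl (hΦ.apply_f5 (high_mem_xi k) hc))),
    .inr (.inr (.inr (hΦ.apply_f6 (high_mem_xi k) hb)))]

end IsBlockConst

theorem eq_zero_of_layers {H : Type*} [NormedAddCommGroup H] [InnerProductSpace ℂ H]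
    {Φ : Cube d → H} {g : Cell d → H} (hΦ : IsBlockConst Φ g) (hs : ∑ t, Φ t = 0)
    (hlayer : ∀ k : Fin (numLayers d), (∀ t ∉ subcube d k, Φ t = 0) →
      (∀ p, g (.face k p) = 0) ∧ g (.lo k) = 0 ∧ g (.hi k) = 0) : Φ = 0 := by
  have vanish : ∀ j ≤ numLayers d, ∀ t ∉ subcube d j, Φ t = 0 := by
    intro j
    induction j with
    | zero => exact fun _ t ht => absurd (mem_subcube_zero t) ht
    | succ j ih =>
      intro hj t ht
      obtain ⟨hface, hlo, hhi⟩ := hlayer ⟨j, hj⟩ (ih (by lia))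
      by_cases h : t ∈ subcube d j
      · obtain h | h | ⟨p, h⟩ | h := Cell.layer_cases ⟨j, hj⟩ h
        exacts [(hΦ _ _ h).trans hlo, (hΦ _ _ h).trans hhi, (hΦ _ _ h).trans (hface p),
          absurd h ht]
      · exact ih (by lia) t h
  have two_valued : ∀ t, Φ t = 0 ∨ Φ t = g .core := fun t => by
    by_cases h : t ∈ subcube d (numLayers d)
    · exact .inr (hΦ .core t h)
    · exact .inl (vanish _ le_rfl t h)
  funext t
  obtain h | h := two_valued t
  · exact h
  · refine h.trans (eq_zero_of_sum_eq_zero_of_inner hs (fun s => ?_) t h)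
    exact (two_valued s).imp (fun h => by rw [h, inner_zero_left]) fun h => by rw [h]

theorem mem_eta_or_eq_high {k : Fin (numLayers d)} {a : Fin d} (ha : a ∈ innerCoords d k) :
    a ∈ (Side.eta k).coords ∨ a = high k := by
  simp only [mem_innerCoords, Side.mem_eta, Fin.ext_iff, high] at ha ⊢
  lia

theorem eq_low_or_mem_xi {k : Fin (numLayers d)} {a : Fin d} (ha : a ∈ innerCoords d k) :
    a = low k ∨ a ∈ (Side.xi k).coords := by
  simp only [mem_innerCoords, Side.mem_xi, Fin.ext_iff, low] at ha ⊢
  lia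

end Layers

section SymmetricLayer

variable {d : ℕ} {k : Fin (numLayers d)} {H : Type*} [NormedAddCommGroup H] [InnerProductSpace ℂ H]
  {Φ : Cube d → H} {g : Cell d → H}

theorem face_f1_eq_f3 (hΦ : IsBlockConst Φ g) (hfree : IsFilterFree (pairing Φ))
    (h12 : g (.face k .f1) = g (.face k .f2)) (h34 : g (.face k .f3) = g (.face k .f4)) :
    g (.face k .f1) = g (.face k .f3) := by
  have key := hfree.inner_row_sub_row_eq_zero (a := next k) (a' := high k) (u := (low k, next k))
    (v := (next k, low k)) (by
      rw [hΦ.apply_f5 (next_mem_xi k) (next_mem_eta k),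
        hΦ.apply_f4 (next_mem_eta k) (next_mem_xi k),
        hΦ.apply_f5 (high_mem_xi k) (next_mem_eta k), hΦ.apply_f3 (next_mem_xi k) (low_mem_eta k),
        h34]) (low k) (high k, next k)
  rw [hΦ.apply_f2 (next_mem_eta k) (next_mem_xi k), hΦ.apply_f3 (high_mem_xi k) (next_mem_eta k),
    hΦ.apply_f1 (low_mem_eta k) (next_mem_xi k), hΦ.apply_f4 (low_mem_eta k) (next_mem_xi k),
    ← h12, ← h34] at key
  exact sub_eq_zero.1 (inner_self_eq_zero.1 key)

theorem inner_row_lo_sub_f1 (hΦ : IsBlockConst Φ g) (hfree : IsFilterFree (pairing Φ)) {a : Fin d}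
    (ha : a ∈ (Side.xi k).coords) (w : Fin d × Fin d) :
    inner ℂ (Φ (a, w)) (g (.lo k) - g (.face k .f1)) = 0 := by
  rw [← hΦ.apply_lo, ← hΦ.apply_f1 (low_mem_eta k) (next_mem_xi k)]
  exact hfree.inner_row_eq_zero
    ((hΦ.apply_f5 ha (low_mem_eta k)).trans (hΦ.apply_f5 ha (next_mem_eta k)).symm) _ _

theorem face_f1_eq_zero (hΦ : IsBlockConst Φ g) (hz : ∀ t ∉ subcube d k, Φ t = 0)
    (hs : ∑ t, Φ t = 0) (hfree : IsFilterFree (pairing Φ))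
    (h12 : g (.face k .f1) = g (.face k .f2)) (h34 : g (.face k .f3) = g (.face k .f4)) :
    g (.face k .f1) = 0 := by
  have h13 := face_f1_eq_f3 hΦ hfree h12 h34
  have anchor : Φ (low k, high k, next k) = g (.face k .f1) :=
    (hΦ.apply_f2 (low_mem_eta k) (next_mem_xi k)).trans h12.symm
  have inner_anchor {a : Fin d} (ha : a ∈ innerCoords d k) {u : Fin d × Fin d}
      (hu : Φ (low k, u) = g (.face k .f1)) :
      inner ℂ (g (.face k .f1)) (Φ (a, u)) = inner ℂ (g (.face k .f1)) (g (.face k .f1)) := by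
    have hcol : Φ (a, high k, next k) = g (.face k .f1) := by
      obtain ha | rfl := mem_eta_or_eq_high ha
      · exact (hΦ.apply_f2 ha (next_mem_xi k)).trans h12.symm
      · exact (hΦ.apply_f3 (high_mem_xi k) (next_mem_eta k)).trans h13.symm
    have := hfree.inner_row_eq_zero (hu.trans anchor.symm) a (high k, next k)
    rwa [anchor, hcol, inner_sub_right, sub_eq_zero] at this
  have inner_cube (t : Cube d) (ht : t ∈ subcube d k) :
      inner ℂ (g (.face k .f1)) (Φ t) = inner ℂ (g (.face k .f1)) (g (.face k .f1)) := by
    obtain ⟨a, b, c⟩ := t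
    obtain ⟨ha, hb, hc⟩ := mem_subcube.1 ht
    obtain h | h | h | h := hΦ.apply_low_cases hb hc
    · rw [h]
      obtain rfl | ha' := eq_low_or_mem_xi ha
      · have := inner_row_lo_sub_f1 hΦ hfree (next_mem_xi k) (high k, next k)
        rwa [hΦ.apply_f2 (next_mem_eta k) (next_mem_xi k), ← h12, inner_sub_right, sub_eq_zero,
          ← hΦ.apply_lo] at this
      · rw [hΦ.apply_f5 ha' (low_mem_eta k), ← hΦ.apply_f5 ha' (next_mem_eta k)]
        exact inner_anchor ha (hΦ.apply_f1 (low_mem_eta k) (next_mem_xi k))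
    · exact inner_anchor ha h
    · exact inner_anchor ha (h.trans h12.symm)
    · exact inner_anchor ha (h.trans (h34.symm.trans h13.symm))
  refine eq_zero_of_sum_eq_zero_of_inner hs (fun t => ?_) _ anchor
  by_cases ht : t ∈ subcube d k
  · exact .inr (by rw [← inner_conj_symm, inner_cube t ht, inner_conj_symm])
  · exact .inl (by rw [hz t ht, inner_zero_left])

theorem lo_eq_zero (hΦ : IsBlockConst Φ g) (hz : ∀ t ∉ subcube d k, Φ t = 0) (hs : ∑ t, Φ t = 0)
    (hfree : IsFilterFree (pairing Φ)) (h1 : g (.face k .f1) = 0) (h2 : g (.face k .f2) = 0)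
    (h4 : g (.face k .f4) = 0) : g (.lo k) = 0 := by
  refine eq_zero_of_sum_eq_zero_of_inner hs (fun t => ?_) _ hΦ.apply_lo
  by_cases ht : t ∈ subcube d k
  · obtain ⟨a, b, c⟩ := t
    obtain ⟨ha, hb, hc⟩ := mem_subcube.1 ht
    obtain rfl | ha := eq_low_or_mem_xi ha
    · obtain h | h | h | h := hΦ.apply_low_cases hb hc
      · exact .inr (by rw [h, hΦ.apply_lo])
      all_goals exact .inl (by simp only [h, h1, h2, h4, inner_zero_left])
    · exact .inl (by simpa only [h1, sub_zero] using inner_row_lo_sub_f1 hΦ hfree ha (b, c))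
  · exact .inl (by rw [hz t ht, inner_zero_left])

theorem face_f5_eq_zero (hΦ : IsBlockConst Φ g) (hz : ∀ t ∉ subcube d k, Φ t = 0)
    (hs : ∑ t, Φ t = 0) (hfree : IsFilterFree (pairing Φ)) (h1 : g (.face k .f1) = 0)
    (h2 : g (.face k .f2) = 0) (h3 : g (.face k .f3) = 0) (h4 : g (.face k .f4) = 0)
    (hlo : g (.lo k) = 0) (h56 : g (.face k .f5) = g (.face k .f6)) : g (.face k .f5) = 0 := by
  have inner_high {a : Fin d} (ha : a ∈ (Side.eta k).coords) (ha' : a ∈ (Side.xi k).coords)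
      (w : Fin d × Fin d) :
      inner ℂ (Φ (a, w)) (g (.face k .f5)) = inner ℂ (Φ (high k, w)) (g (.face k .f5)) := by
    have := hfree.inner_row_sub_row_eq_zero (a := a) (a' := high k) (u := (low k, next k))
      (v := (next k, low k)) (by
        rw [hΦ.apply_f5 ha' (next_mem_eta k), hΦ.apply_f4 ha (next_mem_xi k),
          hΦ.apply_f5 (high_mem_xi k) (next_mem_eta k), hΦ.apply_f3 (next_mem_xi k) (low_mem_eta k),
          h3, h4]) (next k) w
    rwa [hΦ.apply_f5 (next_mem_xi k) (next_mem_eta k), hΦ.apply_f4 (next_mem_eta k) (next_mem_xi k),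
      h4, sub_zero, inner_sub_left, sub_eq_zero] at this
  have row_high {b c : Fin d} (hb : b ∈ innerCoords d k) (hc : c ∈ innerCoords d k) :
      inner ℂ (Φ (high k, b, c)) (g (.face k .f5)) = 0 ∨ inner ℂ (Φ (high k, b, c))
        (g (.face k .f5)) = inner ℂ (g (.face k .f5)) (g (.face k .f5)) := by
    obtain h | h | h | h := hΦ.apply_high_cases hb hc
    · rw [h, ← inner_high (next_mem_eta k) (next_mem_xi k),
        hΦ.apply_f2 (next_mem_eta k) (high_mem_xi k), h2]
      exact .inl (inner_zero_left _)
    · exact .inl (by rw [h, h3, inner_zero_left])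
    · exact .inr (by rw [h])
    · exact .inr (by rw [h, h56])
  refine eq_zero_of_sum_eq_zero_of_inner hs (fun t => ?_) _
    (hΦ.apply_f5 (high_mem_xi k) (low_mem_eta k))
  by_cases ht : t ∈ subcube d k
  · obtain ⟨a, b, c⟩ := t
    obtain ⟨ha, hb, hc⟩ := mem_subcube.1 ht
    obtain ha' | rfl := mem_eta_or_eq_high ha
    · obtain rfl | ha := eq_low_or_mem_xi ha
      · obtain h | h | h | h := hΦ.apply_low_cases hb hc
        · exact .inl (by rw [h, hΦ.apply_lo, hlo, inner_zero_left])
        all_goals exact .inl (by simp only [h, h1, h2, h4, inner_zero_left])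
      · rw [inner_high ha' ha]
        exact row_high hb hc
    · exact row_high hb hc
  · exact .inl (by rw [hz t ht, inner_zero_left])

theorem hi_eq_zero (hΦ : IsBlockConst Φ g) (hz : ∀ t ∉ subcube d k, Φ t = 0) (hs : ∑ t, Φ t = 0)
    (hfree : IsFilterFree (pairing Φ)) (h3 : g (.face k .f3) = 0) (h5 : g (.face k .f5) = 0)
    (h6 : g (.face k .f6) = 0) : g (.hi k) = 0 := by
  refine eq_zero_of_sum_eq_zero_of_inner hs (fun t => ?_) _ hΦ.apply_hi
  by_cases ht : t ∈ subcube d k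
  · obtain ⟨a, b, c⟩ := t
    obtain ⟨ha, hb, hc⟩ := mem_subcube.1 ht
    obtain ha | rfl := mem_eta_or_eq_high ha
    · left
      have := hfree.inner_row_eq_zero ((hΦ.apply_f2 ha (high_mem_xi k)).trans
        (hΦ.apply_f2 ha (next_mem_xi k)).symm) (high k) (b, c)
      rwa [hΦ.apply_hi, hΦ.apply_f3 (high_mem_xi k) (next_mem_eta k), h3, sub_zero] at this
    · obtain h | h | h | h := hΦ.apply_high_cases hb hc
      · exact .inr (by rw [h, hΦ.apply_hi])
      all_goals exact .inl (by simp only [h, h3, h5, h6, inner_zero_left])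
  · exact .inl (by rw [hz t ht, inner_zero_left])

theorem symmetric_eq_zero (hΦ : IsBlockConst Φ g) (hs : ∑ t, Φ t = 0)
    (hfree : IsFilterFree (pairing Φ)) (h12 : ∀ k, g (.face k .f1) = g (.face k .f2))
    (h34 : ∀ k, g (.face k .f3) = g (.face k .f4)) (h56 : ∀ k, g (.face k .f5) = g (.face k .f6)) :
    Φ = 0 := by
  refine eq_zero_of_layers hΦ hs fun k hz => ?_
  have h1 := face_f1_eq_zero hΦ hz hs hfree (h12 k) (h34 k)
  have h2 := (h12 k).symm.trans h1
  have h3 := (face_f1_eq_f3 hΦ hfree (h12 k) (h34 k)).symm.trans h1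
  have h4 := (h34 k).symm.trans h3
  have hlo := lo_eq_zero hΦ hz hs hfree h1 h2 h4
  have h5 := face_f5_eq_zero hΦ hz hs hfree h1 h2 h3 h4 hlo (h56 k)
  have h6 := (h56 k).symm.trans h5
  refine ⟨?_, hlo, hi_eq_zero hΦ hz hs hfree h3 h5 h6⟩
  rintro (_ | _)
  exacts [h1, h2, h3, h4, h5, h6]

end SymmetricLayer

section Rotation

variable {d : ℕ}

/-- The cyclic rotation `(p, q, r) ↦ (q, r, p)` of the three parties. -/
def cubeRot (d : ℕ) (t : Cube d) : Cube d := (t.2.1, t.2.2, t.1)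

/-- The permutation of the cells induced by `cubeRot`. -/
def Cell.rot : Cell d → Cell d
  | .face k .f1 => .face k .f4
  | .face k .f2 => .face k .f3
  | .face k .f3 => .face k .f6
  | .face k .f4 => .face k .f5
  | .face k .f5 => .face k .f1
  | .face k .f6 => .face k .f2
  | .lo k => .lo k
  | .hi k => .hi k
  | .core => .core

theorem IsBlockConst.comp_cubeRot {H : Type*} {Φ : Cube d → H} {g : Cell d → H}
    (hΦ : IsBlockConst Φ g) : IsBlockConst (Φ ∘ cubeRot d) (g ∘ Cell.rot) := by
  intro c t ht
  refine hΦ c.rot (cubeRot d t) (Cell.mem_box.2 ?_)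
  have := Cell.mem_box.1 ht
  rcases c with ⟨k, (_ | _)⟩ | _ | _ | _ <;> exact ⟨this.2.1, this.2.2, this.1⟩

theorem sum_comp_cubeRot {H : Type*} [AddCommMonoid H] (Φ : Cube d → H) :
    ∑ t, (Φ ∘ cubeRot d) t = ∑ t, Φ t :=
  Fintype.sum_equiv ⟨cubeRot d, fun t => (t.2.2, t.1, t.2.1), fun _ => rfl, fun _ => rfl⟩ _ _
    fun _ => rfl

theorem symmetric_eq_zero_across {H : Type*} [NormedAddCommGroup H] [InnerProductSpace ℂ H]
    {Φ : Cube d → H} {g : Cell d → H} (c : Cut) (hΦ : IsBlockConst Φ g) (hs : ∑ t, Φ t = 0)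
    (hfree : IsFilterFree (pairing (Φ ∘ (cutEquiv d c).symm)))
    (h12 : ∀ k, g (.face k .f1) = g (.face k .f2)) (h34 : ∀ k, g (.face k .f3) = g (.face k .f4))
    (h56 : ∀ k, g (.face k .f5) = g (.face k .f6)) : Φ = 0 := by
  have hs1 := (sum_comp_cubeRot Φ).trans hs
  cases c with
  | A_BC => exact symmetric_eq_zero hΦ hs hfree h12 h34 h56
  | C_AB =>
    have h := symmetric_eq_zero hΦ.comp_cubeRot hs1 hfree (fun k => (h34 k).symm)
      (fun k => (h56 k).symm) h12
    exact funext fun t => congrFun h (t.2.2, t.1, t.2.1)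
  | B_AC =>
    have h := symmetric_eq_zero hΦ.comp_cubeRot.comp_cubeRot ((sum_comp_cubeRot _).trans hs1)
      (hfree.pairing_comp_prodMap (Equiv.prodComm _ _)) h56 (fun k => (h12 k).symm)
      (fun k => (h34 k).symm)
    exact funext fun t => congrFun h (t.2.1, t.2.2, t.1)

end Rotation

section ScalarLayers

variable {d : ℕ} {k : Fin (numLayers d)} {f : Cube d → ℂ} {g : Cell d → ℂ} {Z : Set ℂ}

/-- Product vectors across `A|BC`, described by the vanishing of their `2 × 2` minors. -/
def HasProductRows (f : Cube d → ℂ) : Prop :=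
  ∀ a a' u v, f (a, u) * f (a', v) = f (a, v) * f (a', u)

theorem IsProductAcross.hasProductRows {v : ThreeQudit d} (hv : IsProductAcross .A_BC v) :
    HasProductRows v := by
  obtain ⟨x, y, h⟩ := hv
  intro a a' u w
  rw [h, h, h, h]
  simp only [cutEquiv, Equiv.refl_apply]
  ring

/-- The values of a block-constant vector in a layer, for `p` (the row) the lowest, an inner and
the highest coordinate of the layer and `(q, r)` (the column) in the order: lowest–lowest,
lowest–inner, inner–highest, inner–lowest, highest–inner, highest–highest, inner–inner. The value
`z` in the interior of the layer is not constant in general. -/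
def layerMatrix (g : Cell d → ℂ) (k : Fin (numLayers d)) (z : ℂ) : Matrix (Fin 3) (Fin 7) ℂ :=
  !![g (.lo k), g (.face k .f1), g (.face k .f1), g (.face k .f4), g (.face k .f2),
      g (.face k .f2), g (.face k .f1);
    g (.face k .f5), g (.face k .f5), g (.face k .f6), g (.face k .f4), g (.face k .f2),
      g (.face k .f2), z;
    g (.face k .f5), g (.face k .f5), g (.face k .f6), g (.face k .f3), g (.face k .f3),
      g (.hi k), g (.face k .f3)]

/-- The values of a layer are those of a product vector across `A|BC` whose values in the interior
of the layer are the elements of `Z`. -/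
def IsProductLayer (g : Cell d → ℂ) (k : Fin (numLayers d)) (Z : Set ℂ) : Prop :=
  ∀ z ∈ Z, ∀ i i' j j', layerMatrix g k z i j * layerMatrix g k z i' j' =
    layerMatrix g k z i j' * layerMatrix g k z i' j

theorem HasProductRows.isProductLayer (hrow : HasProductRows f) (hf : IsBlockConst f g) :
    IsProductLayer g k (f '' subcube d (k + 1)) := by
  rintro _ ⟨⟨a, b, c⟩, ht, rfl⟩
  have hk := two_mul_lt k
  obtain ⟨ha, hb, hc⟩ := mem_subcube.1 (Finset.mem_coe.1 ht)
  simp only [mem_innerCoords] at ha hb hc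
  have hM (i : Fin 3) (j : Fin 7) : layerMatrix g k (f (a, b, c)) i j =
      f (![low k, a, high k] i, ![(low k, low k), (low k, c), (b, high k), (b, low k), (high k, c),
        (high k, high k), (b, c)] j) := by
    fin_cases i <;> fin_cases j <;> first
      | rfl
      | refine (hf _ _ (Cell.mem_box.2 ?_)).symm
        simp only [Cell.fst, Cell.snd, Cell.trd, Side.mem_low, Side.mem_high, Side.mem_eta,
          Side.mem_xi, low, high, Fin.mk_one, Fin.zero_eta, Fin.reduceFinMk, Matrix.cons_val]
        lia
  intro i i' j j'
  rw [hM, hM, hM, hM]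
  exact hrow ..

/-- The values of a layer are `0` and `v`, and unless `v = 0` so are the values `Z` in its
interior. -/
structure IsTwoValuedLayer (g : Cell d → ℂ) (k : Fin (numLayers d)) (Z : Set ℂ) (v : ℂ) :
    Prop where
  face : ∀ p, g (.face k p) = 0 ∨ g (.face k p) = v
  lo : g (.lo k) = 0 ∨ g (.lo k) = v
  hi : g (.hi k) = 0 ∨ g (.hi k) = v
  interior : v ≠ 0 → ∀ z ∈ Z, z = 0 ∨ z = v

theorem IsTwoValuedLayer.of_rot {v : ℂ} (h : IsTwoValuedLayer (g ∘ Cell.rot) k Z v) :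
    IsTwoValuedLayer g k Z v := by
  refine ⟨?_, h.lo, h.hi, h.interior⟩
  rintro (_ | _)
  exacts [h.face .f5, h.face .f6, h.face .f2, h.face .f1, h.face .f4, h.face .f3]

theorem IsTwoValuedLayer.eq_zero {v : ℂ}
    (h : IsTwoValuedLayer g k (f '' subcube d (k + 1)) v) (hf : IsBlockConst f g)
    (hz : ∀ t ∉ subcube d k, f t = 0) (hs : ∑ t, f t = 0) :
    (∀ p, g (.face k p) = 0) ∧ g (.lo k) = 0 ∧ g (.hi k) = 0 := by
  obtain rfl | hv := eq_or_ne v 0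
  · exact ⟨fun p => or_self_iff.1 (h.face p), or_self_iff.1 h.lo, or_self_iff.1 h.hi⟩
  have two_valued (t : Cube d) : f t = 0 ∨ f t = v := by
    by_cases ht : t ∈ subcube d k
    · obtain ht | ht | ⟨p, ht⟩ | ht := Cell.layer_cases k ht
      · exact hf _ _ ht ▸ h.lo
      · exact hf _ _ ht ▸ h.hi
      · exact hf _ _ ht ▸ h.face p
      · exact h.interior hv _ ⟨t, ht, rfl⟩
    · exact .inl (hz t ht)
  have zero (t : Cube d) : f t = 0 := (two_valued t).elim id fun ht => ht.trans
    (eq_zero_of_sum_eq_zero_of_inner hs (fun s => (two_valued s).imp (by simp +contextual)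
      (by simp +contextual)) t ht)
  exact ⟨fun p => by cases p <;> [rw [← hf.apply_f1 (low_mem_eta k) (high_mem_xi k)];
    rw [← hf.apply_f2 (low_mem_eta k) (high_mem_xi k)];
    rw [← hf.apply_f3 (high_mem_xi k) (low_mem_eta k)];
    rw [← hf.apply_f4 (low_mem_eta k) (high_mem_xi k)];
    rw [← hf.apply_f5 (high_mem_xi k) (low_mem_eta k)];
    rw [← hf.apply_f6 (high_mem_xi k) (low_mem_eta k)]] <;> exact zero _,
    hf.apply_lo ▸ zero _, hf.apply_hi ▸ zero _⟩

theorem IsProductLayer.layerMatrix_eq_of_f1_ne_zero (h : IsProductLayer g k Z)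
    (h1 : g (.face k .f1) ≠ 0) {z : ℂ} (hz : z ∈ Z) (j : Fin 7) :
    layerMatrix g k z 1 j = g (.face k .f5) / g (.face k .f1) * layerMatrix g k z 0 j ∧
      layerMatrix g k z 2 j = g (.face k .f5) / g (.face k .f1) * layerMatrix g k z 0 j := by
  have h01 : g (.face k .f1) * layerMatrix g k z 1 j = layerMatrix g k z 0 j * g (.face k .f5) :=
    h z hz 0 1 1 j
  have h02 : g (.face k .f1) * layerMatrix g k z 2 j = layerMatrix g k z 0 j * g (.face k .f5) :=
    h z hz 0 2 1 j
  rw [div_mul_eq_mul_div, eq_div_iff h1, eq_div_iff h1]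
  exact ⟨by linear_combination h01, by linear_combination h02⟩

theorem IsProductLayer.eq_zero_of_f1_ne_zero (h : IsProductLayer g k Z) (hZ : Z.Nonempty)
    (h1 : g (.face k .f1) ≠ 0) (h5 : g (.face k .f5) = 0) :
    (∀ p ≠ .f1, g (.face k p) = 0) ∧ g (.hi k) = 0 ∧ ∀ z ∈ Z, z = 0 := by
  have hrow {z : ℂ} (hz : z ∈ Z) (j : Fin 7) :
      layerMatrix g k z 1 j = 0 ∧ layerMatrix g k z 2 j = 0 := by
    simpa [h5] using h.layerMatrix_eq_of_f1_ne_zero h1 hz j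
  obtain ⟨z₀, hz₀⟩ := hZ
  refine ⟨?_, (hrow hz₀ 5).2, fun z hz => (hrow hz 6).1⟩
  rintro (_ | _) hp
  exacts [absurd rfl hp, (hrow hz₀ 4).1, (hrow hz₀ 4).2, (hrow hz₀ 3).1, h5, (hrow hz₀ 2).1]

theorem IsProductLayer.isTwoValuedLayer_of_f1_f5 (h : IsProductLayer g k Z) (hZ : Z.Nonempty)
    (h1 : g (.face k .f1) ≠ 0) (h5 : g (.face k .f5) ≠ 0) :
    IsTwoValuedLayer g k Z (g (.face k .f1)) := by
  set r := g (.face k .f5) / g (.face k .f1)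
  have hr0 : r ≠ 0 := div_ne_zero h5 h1
  have hrow {z : ℂ} (hz : z ∈ Z) (j : Fin 7) := h.layerMatrix_eq_of_f1_ne_zero h1 hz j
  obtain ⟨z₀, hz₀⟩ := hZ
  have e5 : g (.face k .f5) = r * g (.face k .f1) := (hrow hz₀ 1).1
  have e6 : g (.face k .f6) = r * g (.face k .f1) := (hrow hz₀ 2).1
  have e3 : g (.face k .f3) = r * g (.face k .f1) := (hrow hz₀ 6).2
  have elo : g (.lo k) = g (.face k .f1) :=
    mul_left_cancel₀ hr0 ((hrow hz₀ 0).1.symm.trans e5)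
  have e4 : g (.face k .f4) = g (.face k .f1) :=
    mul_left_cancel₀ hr0 ((hrow hz₀ 3).2.symm.trans e3)
  have e2 : g (.face k .f2) = g (.face k .f1) :=
    mul_left_cancel₀ hr0 ((hrow hz₀ 4).2.symm.trans e3)
  have hr1 : r = 1 := by
    have : g (.face k .f4) = r * g (.face k .f4) := (hrow hz₀ 3).1
    rw [e4] at this
    exact (mul_eq_right₀ h1).1 this.symm
  have ehi : g (.hi k) = r * g (.face k .f2) := (hrow hz₀ 5).2
  have ez (z : ℂ) (hz : z ∈ Z) : z = r * g (.face k .f1) := (hrow hz 6).1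
  rw [hr1, one_mul] at e5 e6 e3 ehi
  refine ⟨?_, .inr elo, .inr (ehi.trans e2), fun _ z hz => .inr ?_⟩
  · rintro (_ | _)
    exacts [.inr rfl, .inr e2, .inr e3, .inr e4, .inr e5, .inr e6]
  · rw [ez z hz, hr1, one_mul]

theorem IsProductLayer.eq_zero_of_f1_eq_zero (h : IsProductLayer g k Z) (hZ : Z.Nonempty)
    (h1 : g (.face k .f1) = 0) (h56 : g (.face k .f5) ≠ 0 ∨ g (.face k .f6) ≠ 0) :
    (∀ p, p ≠ .f5 → p ≠ .f6 → g (.face k p) = 0) ∧ g (.lo k) = 0 ∧ g (.hi k) = 0 ∧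
      ∀ z ∈ Z, z = 0 := by
  obtain ⟨j₀, w, hw, h0, h1', h2⟩ : ∃ j₀ w, w ≠ 0 ∧ (∀ z, layerMatrix g k z 0 j₀ = 0) ∧
      (∀ z, layerMatrix g k z 1 j₀ = w) ∧ ∀ z, layerMatrix g k z 2 j₀ = w :=
    h56.elim (fun h5 => ⟨1, _, h5, fun _ => h1, fun _ => rfl, fun _ => rfl⟩)
      fun h6 => ⟨2, _, h6, fun _ => h1, fun _ => rfl, fun _ => rfl⟩
  have low_row {z : ℂ} (hz : z ∈ Z) (j : Fin 7) : layerMatrix g k z 0 j = 0 := by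
    have := h z hz 0 1 j j₀
    rw [h0, h1', zero_mul] at this
    exact (mul_eq_zero_iff_right hw).1 this
  have inner_row {z : ℂ} (hz : z ∈ Z) (j : Fin 7) :
      layerMatrix g k z 1 j = layerMatrix g k z 2 j := by
    have := h z hz 1 2 j j₀
    rw [h1', h2, mul_comm w] at this
    exact mul_right_cancel₀ hw this
  obtain ⟨z₀, hz₀⟩ := hZ
  have e4 : g (.face k .f4) = 0 := low_row hz₀ 3
  have e2 : g (.face k .f2) = 0 := low_row hz₀ 4
  have e3 : g (.face k .f3) = 0 := (inner_row hz₀ 3).symm.trans e4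
  refine ⟨?_, low_row hz₀ 0, (inner_row hz₀ 5).symm.trans e2,
    fun z hz => (inner_row hz 6).trans e3⟩
  rintro (_ | _) hp5 hp6
  exacts [h1, e2, e3, e4, absurd rfl hp5, absurd rfl hp6]

theorem IsProductLayer.isTwoValuedLayer_of_f1 (h : IsProductLayer g k Z) (hZ : Z.Nonempty)
    (h1 : g (.face k .f1) ≠ 0) (h5 : g (.face k .f5) = 0)
    (hlo : g (.lo k) = 0 ∨ g (.lo k) = g (.face k .f1)) :
    IsTwoValuedLayer g k Z (g (.face k .f1)) := by
  obtain ⟨hface, hhi, hz⟩ := h.eq_zero_of_f1_ne_zero hZ h1 h5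
  refine ⟨fun p => ?_, hlo, .inl hhi, fun _ z h => .inl (hz z h)⟩
  obtain rfl | hp := eq_or_ne p .f1
  exacts [.inr rfl, .inl (hface p hp)]

theorem IsProductLayer.isTwoValuedLayer_of_f5 (h : IsProductLayer g k Z) (hZ : Z.Nonempty)
    (h1 : g (.face k .f1) = 0) (h5 : g (.face k .f5) ≠ 0)
    (h6 : g (.face k .f6) = 0 ∨ g (.face k .f6) = g (.face k .f5)) :
    IsTwoValuedLayer g k Z (g (.face k .f5)) := by
  obtain ⟨hface, hlo, hhi, hz⟩ := h.eq_zero_of_f1_eq_zero hZ h1 (.inl h5)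
  refine ⟨?_, .inl hlo, .inl hhi, fun _ z h => .inl (hz z h)⟩
  rintro (_ | _)
  exacts [.inl h1, .inl (hface _ nofun nofun), .inl (hface _ nofun nofun),
    .inl (hface _ nofun nofun), .inr rfl, h6]

theorem IsProductLayer.isTwoValuedLayer_of_f6 (h : IsProductLayer g k Z) (hZ : Z.Nonempty)
    (h1 : g (.face k .f1) = 0) (h5 : g (.face k .f5) = 0) (h6 : g (.face k .f6) ≠ 0) :
    IsTwoValuedLayer g k Z (g (.face k .f6)) := by
  obtain ⟨hface, hlo, hhi, hz⟩ := h.eq_zero_of_f1_eq_zero hZ h1 (.inr h6)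
  refine ⟨?_, .inl hlo, .inl hhi, fun _ z h => .inl (hz z h)⟩
  rintro (_ | _)
  exacts [.inl h1, .inl (hface _ nofun nofun), .inl (hface _ nofun nofun),
    .inl (hface _ nofun nofun), .inl h5, .inr rfl]

theorem IsProductLayer.exists_isTwoValuedLayer_of_faces_eq_zero (h : IsProductLayer g k Z)
    (hZ : Z.Nonempty) (hface : ∀ p, g (.face k p) = 0) : ∃ v, IsTwoValuedLayer g k Z v := by
  have hlohi : g (.lo k) = 0 ∨ g (.hi k) = 0 := by
    obtain ⟨z, hz⟩ := hZ
    have : g (.lo k) * g (.hi k) = g (.face k .f2) * g (.face k .f5) := h z hz 0 2 0 5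
    rwa [hface, zero_mul, mul_eq_zero] at this
  have hzlo (z : ℂ) (hz : z ∈ Z) : g (.lo k) = 0 ∨ z = 0 := by
    have : g (.lo k) * z = g (.face k .f1) * g (.face k .f5) := h z hz 0 1 0 6
    rwa [hface, zero_mul, mul_eq_zero] at this
  have hzhi (z : ℂ) (hz : z ∈ Z) : z = 0 ∨ g (.hi k) = 0 := by
    have : z * g (.hi k) = g (.face k .f2) * g (.face k .f3) := h z hz 1 2 6 5
    rwa [hface, zero_mul, mul_eq_zero] at this
  obtain hlo | hlo := eq_or_ne (g (.lo k)) 0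
  · exact ⟨g (.hi k), fun p => .inl (hface p), .inl hlo, .inr rfl,
      fun hhi z hz => .inl ((hzhi z hz).resolve_right hhi)⟩
  · exact ⟨g (.lo k), fun p => .inl (hface p), .inr rfl, .inl (hlohi.resolve_left hlo),
      fun _ z hz => .inl ((hzlo z hz).resolve_left hlo)⟩

theorem IsProductLayer.isTwoValuedLayer_of_f1_of_rot (hA : IsProductLayer g k Z)
    (hC : IsProductLayer (g ∘ Cell.rot) k Z) (hZ : Z.Nonempty) (h1 : g (.face k .f1) ≠ 0) :
    IsTwoValuedLayer g k Z (g (.face k .f1)) := by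
  obtain h5 | h5 := eq_or_ne (g (.face k .f5)) 0
  · have h4 : g (.face k .f4) = 0 := (hA.eq_zero_of_f1_ne_zero hZ h1 h5).1 _ nofun
    exact hA.isTwoValuedLayer_of_f1 hZ h1 h5 (.inl (hC.eq_zero_of_f1_eq_zero hZ h4 (.inl h1)).2.1)
  · exact hA.isTwoValuedLayer_of_f1_f5 hZ h1 h5

theorem Cell.rot_rot_rot (c : Cell d) : c.rot.rot.rot = c := by
  rcases c with ⟨k, (_ | _)⟩ | _ | _ | _ <;> rfl

theorem exists_isTwoValuedLayer_of_product (hA : IsProductLayer g k Z)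
    (hC : IsProductLayer (g ∘ Cell.rot) k Z) (hB : IsProductLayer ((g ∘ Cell.rot) ∘ Cell.rot) k Z)
    (hZ : Z.Nonempty) : ∃ v, IsTwoValuedLayer g k Z v := by
  have hA' : IsProductLayer (((g ∘ Cell.rot) ∘ Cell.rot) ∘ Cell.rot) k Z := by
    rwa [show ((g ∘ Cell.rot) ∘ Cell.rot) ∘ Cell.rot = g from
      funext fun c => congrArg g c.rot_rot_rot]
  by_cases h1 : g (.face k .f1) ≠ 0
  · exact ⟨_, hA.isTwoValuedLayer_of_f1_of_rot hC hZ h1⟩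
  by_cases h4 : g (.face k .f4) ≠ 0
  · exact ⟨_, (hC.isTwoValuedLayer_of_f1_of_rot hB hZ h4).of_rot⟩
  by_cases h5 : g (.face k .f5) ≠ 0
  · exact ⟨_, (hB.isTwoValuedLayer_of_f1_of_rot hA' hZ h5).of_rot.of_rot⟩
  rw [not_not] at h1 h4 h5
  by_cases h6 : g (.face k .f6) ≠ 0
  · exact ⟨_, hA.isTwoValuedLayer_of_f6 hZ h1 h5 h6⟩
  by_cases h2 : g (.face k .f2) ≠ 0
  · exact ⟨_, (hC.isTwoValuedLayer_of_f6 hZ h4 h1 h2).of_rot⟩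
  by_cases h3 : g (.face k .f3) ≠ 0
  · exact ⟨_, (hB.isTwoValuedLayer_of_f6 hZ h5 h4 h3).of_rot.of_rot⟩
  rw [not_not] at h2 h3 h6
  refine hA.exists_isTwoValuedLayer_of_faces_eq_zero hZ ?_
  rintro (_ | _)
  exacts [h1, h2, h3, h4, h5, h6]

theorem exists_isTwoValuedLayer_of_asymmetric_A (h : IsProductLayer g k Z) (hZ : Z.Nonempty)
    (h12 : g (.face k .f1) = g (.face k .f2)) (h35 : g (.face k .f3) = g (.face k .f5))
    (hlo : g (.lo k) = g (.face k .f4)) (hhi : g (.hi k) = g (.face k .f6)) :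
    ∃ v, IsTwoValuedLayer g k Z v := by
  by_cases h1 : g (.face k .f1) = 0
  · have h5 : g (.face k .f5) = 0 := by
      by_contra h5
      exact h5 (h35 ▸ (h.eq_zero_of_f1_eq_zero hZ h1 (.inl h5)).1 _ nofun nofun)
    have h6 : g (.face k .f6) = 0 := by
      by_contra h6
      exact h6 (hhi ▸ (h.eq_zero_of_f1_eq_zero hZ h1 (.inr h6)).2.2.1)
    have h4 : g (.face k .f4) = 0 := by
      obtain ⟨z, hz⟩ := hZ
      have : g (.lo k) * g (.face k .f4) = g (.face k .f4) * g (.face k .f5) := h z hz 0 1 0 3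
      rwa [hlo, h5, mul_zero, mul_self_eq_zero] at this
    refine h.exists_isTwoValuedLayer_of_faces_eq_zero hZ ?_
    rintro (_ | _)
    exacts [h1, h12 ▸ h1, h35.trans h5, h4, h5, h6]
  · by_cases h5 : g (.face k .f5) = 0
    · exact absurd (h12.trans ((h.eq_zero_of_f1_ne_zero hZ h1 h5).1 _ nofun)) h1
    · exact ⟨_, h.isTwoValuedLayer_of_f1_f5 hZ h1 h5⟩

theorem exists_isTwoValuedLayer_of_asymmetric_B (h : IsProductLayer g k Z) (hZ : Z.Nonempty)
    (h16 : g (.face k .f1) = g (.face k .f6)) (h34 : g (.face k .f3) = g (.face k .f4))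
    (hlo : g (.lo k) = g (.face k .f5)) (hhi : g (.hi k) = g (.face k .f2)) :
    ∃ v, IsTwoValuedLayer g k Z v := by
  by_cases h1 : g (.face k .f1) = 0
  · have h5 : g (.face k .f5) = 0 := by
      by_contra h5
      exact h5 (hlo ▸ (h.eq_zero_of_f1_eq_zero hZ h1 (.inl h5)).2.1)
    obtain ⟨z, hz⟩ := id hZ
    have h4 : g (.face k .f4) = 0 := by
      have : g (.face k .f4) * g (.face k .f3) = g (.face k .f1) * g (.face k .f3) :=
        h z hz 0 2 3 6
      rwa [h34, h1, zero_mul, mul_self_eq_zero] at this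
    have h2 : g (.face k .f2) = 0 := by
      have : g (.face k .f2) * g (.hi k) = g (.face k .f2) * g (.face k .f3) := h z hz 1 2 4 5
      rwa [hhi, h34, h4, mul_zero, mul_self_eq_zero] at this
    refine h.exists_isTwoValuedLayer_of_faces_eq_zero hZ ?_
    rintro (_ | _)
    exacts [h1, h2, h34.trans h4, h4, h5, h16 ▸ h1]
  · by_cases h5 : g (.face k .f5) = 0
    · exact absurd (h16.trans ((h.eq_zero_of_f1_ne_zero hZ h1 h5).1 _ nofun)) h1
    · exact ⟨_, h.isTwoValuedLayer_of_f1_f5 hZ h1 h5⟩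

theorem exists_isTwoValuedLayer_of_asymmetric_C (h : IsProductLayer g k Z) (hZ : Z.Nonempty)
    (h24 : g (.face k .f2) = g (.face k .f4)) (h56 : g (.face k .f5) = g (.face k .f6))
    (hlo : g (.lo k) = g (.face k .f1)) (hhi : g (.hi k) = g (.face k .f3)) :
    ∃ v, IsTwoValuedLayer g k Z v := by
  by_cases h1 : g (.face k .f1) = 0 <;> by_cases h5 : g (.face k .f5) = 0
  · have h2 (z : ℂ) (hz : z ∈ Z) : g (.face k .f2) = 0 ∨ z = 0 := by
      have : g (.face k .f2) * z = g (.face k .f1) * g (.face k .f2) := h z hz 0 1 4 6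
      rwa [h1, zero_mul, mul_eq_zero] at this
    have h23 : g (.face k .f2) = 0 ∨ g (.face k .f3) = 0 := by
      obtain ⟨z, hz⟩ := hZ
      have : g (.face k .f2) * g (.face k .f3) = g (.face k .f1) * g (.face k .f3) :=
        h z hz 0 2 4 6
      rwa [h1, zero_mul, mul_eq_zero] at this
    have h6 := h56 ▸ h5
    have hlo := hlo.trans h1
    obtain h2' | h2' := eq_or_ne (g (.face k .f2)) 0
    · have h3 (z : ℂ) (hz : z ∈ Z) : g (.face k .f3) = 0 ∨ z = 0 := by
        have : g (.face k .f2) * g (.face k .f3) = z * g (.face k .f3) := h z hz 1 2 4 6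
        rwa [h2', zero_mul, eq_comm, mul_eq_zero, or_comm] at this
      refine ⟨g (.face k .f3), ?_, .inl hlo, .inr hhi,
        fun hv z hz => .inl ((h3 z hz).resolve_left hv)⟩
      rintro (_ | _)
      exacts [.inl h1, .inl h2', .inr rfl, .inl (h24 ▸ h2'), .inl h5, .inl h6]
    · have h3 := h23.resolve_left h2'
      refine ⟨g (.face k .f2), ?_, .inl hlo, .inl (hhi.trans h3),
        fun hv z hz => .inl ((h2 z hz).resolve_left hv)⟩
      rintro (_ | _)
      exacts [.inl h1, .inr rfl, .inl h3, .inr h24.symm, .inl h5, .inl h6]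
  · exact ⟨_, h.isTwoValuedLayer_of_f5 hZ h1 h5 (.inr h56.symm)⟩
  · exact ⟨_, h.isTwoValuedLayer_of_f1 hZ h1 h5 (.inr hlo)⟩
  · exact ⟨_, h.isTwoValuedLayer_of_f1_f5 hZ h1 h5⟩

end ScalarLayers

section ProductVectors

variable {d : ℕ} {f : Cube d → ℂ} {g : Cell d → ℂ}

theorem next_mem_subcube (k : Fin (numLayers d)) :
    (next k, next k, next k) ∈ subcube d (k + 1) := by
  have := two_mul_lt k
  simp only [mem_subcube, mem_innerCoords, next]
  lia

theorem image_subcube_nonempty (f : Cube d → ℂ) (k : Fin (numLayers d)) :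
    (f '' subcube d (k + 1)).Nonempty := ⟨_, _, next_mem_subcube k, rfl⟩

theorem IsProductAcross.hasProductRows_C {v : ThreeQudit d} (hv : IsProductAcross .C_AB v) :
    HasProductRows (v ∘ cubeRot d) := by
  obtain ⟨x, y, h⟩ := hv
  intro a a' u w
  simp only [Function.comp_apply, cubeRot, h, cutEquiv, Equiv.coe_fn_mk]
  ring

theorem IsProductAcross.hasProductRows_B {v : ThreeQudit d} (hv : IsProductAcross .B_AC v) :
    HasProductRows ((v ∘ cubeRot d) ∘ cubeRot d) := by
  obtain ⟨x, y, h⟩ := hv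
  intro a a' u w
  simp only [Function.comp_apply, cubeRot, h, cutEquiv, Equiv.coe_fn_mk]
  ring

theorem image_comp_cubeRot (f : Cube d → ℂ) (j : ℕ) :
    (f ∘ cubeRot d) '' subcube d j = f '' subcube d j := by
  have hrot : cubeRot d '' subcube d j = subcube d j := by
    refine Set.Subset.antisymm ?_ fun t ht => ⟨(t.2.2, t.1, t.2.1), ?_, rfl⟩
    · rintro _ ⟨t, ht, rfl⟩
      have := mem_subcube.1 (Finset.mem_coe.1 ht)
      exact mem_subcube.2 ⟨this.2.1, this.2.2, this.1⟩
    · have := mem_subcube.1 (Finset.mem_coe.1 ht)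
      exact mem_subcube.2 ⟨this.2.2, this.1, this.2.1⟩
  rw [Set.image_comp, hrot]

theorem HasProductRows.isProductLayer_comp_rot (hrow : HasProductRows (f ∘ cubeRot d))
    (hf : IsBlockConst f g) (k : Fin (numLayers d)) :
    IsProductLayer (g ∘ Cell.rot) k (f '' subcube d (k + 1)) :=
  image_comp_cubeRot f (k + 1) ▸ hrow.isProductLayer hf.comp_cubeRot

theorem HasProductRows.isProductLayer_comp_rot_rot
    (hrow : HasProductRows ((f ∘ cubeRot d) ∘ cubeRot d)) (hf : IsBlockConst f g)
    (k : Fin (numLayers d)) :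
    IsProductLayer ((g ∘ Cell.rot) ∘ Cell.rot) k (f '' subcube d (k + 1)) :=
  image_comp_cubeRot f (k + 1) ▸ hrow.isProductLayer_comp_rot hf.comp_cubeRot k

theorem eq_zero_of_exists_isTwoValuedLayer (hf : IsBlockConst f g) (hs : ∑ t, f t = 0)
    (hlayer : ∀ k, ∃ v, IsTwoValuedLayer g k (f '' subcube d (k + 1)) v) : f = 0 :=
  eq_zero_of_layers hf hs fun k hz =>
    have ⟨_, h⟩ := hlayer k
    h.eq_zero hf hz hs

theorem IsFullyProduct.isProductAcross {v : ThreeQudit d} (hv : IsFullyProduct v) (c : Cut) :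
    IsProductAcross c v := by
  obtain ⟨x, y, z, rfl⟩ := hv
  cases c
  · exact ⟨x, WithLp.toLp 2 fun s => y s.1 * z s.2, fun t => mul_assoc _ _ _⟩
  · exact ⟨y, WithLp.toLp 2 fun s => x s.1 * z s.2, fun t => by
      simp only [tri_apply, cutEquiv, Equiv.coe_fn_mk]
      ring⟩
  · exact ⟨z, WithLp.toLp 2 fun s => x s.1 * y s.2, fun t => mul_comm _ _⟩

theorem IsFullyProduct.eq_zero {v : ThreeQudit d} (hv : IsFullyProduct v)
    (hg : IsBlockConst v g) (hs : ∑ t, v t = 0) : v = 0 := by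
  refine PiLp.ext (congrFun (eq_zero_of_exists_isTwoValuedLayer hg hs fun k => ?_))
  exact exists_isTwoValuedLayer_of_product
    ((hv.isProductAcross .A_BC).hasProductRows.isProductLayer hg)
    ((hv.isProductAcross .C_AB).hasProductRows_C.isProductLayer_comp_rot hg k)
    ((hv.isProductAcross .B_AC).hasProductRows_B.isProductLayer_comp_rot_rot hg k)
    (image_subcube_nonempty v k)

theorem IsProductAcross.eq_zero_of_asymmetric {c : Cut} {v : ThreeQudit d}
    (hv : IsProductAcross c v) (hg : IsBlockConst v g) (hs : ∑ t, v t = 0)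
    (h12 : ∀ k, g (.face k .f1) = g (.face k .f2)) (h35 : ∀ k, g (.face k .f3) = g (.face k .f5))
    (hlo : ∀ k, g (.lo k) = g (.face k .f4)) (hhi : ∀ k, g (.hi k) = g (.face k .f6)) :
    v = 0 := by
  refine PiLp.ext (congrFun (eq_zero_of_exists_isTwoValuedLayer hg hs fun k => ?_))
  have hZ := image_subcube_nonempty v k
  cases c with
  | A_BC =>
    exact exists_isTwoValuedLayer_of_asymmetric_A (hv.hasProductRows.isProductLayer hg) hZ (h12 k)
      (h35 k) (hlo k) (hhi k)
  | C_AB =>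
    obtain ⟨w, hw⟩ := exists_isTwoValuedLayer_of_asymmetric_C
      (hv.hasProductRows_C.isProductLayer_comp_rot hg k) hZ (h35 k) (h12 k) (hlo k) (hhi k)
    exact ⟨w, hw.of_rot⟩
  | B_AC =>
    obtain ⟨w, hw⟩ := exists_isTwoValuedLayer_of_asymmetric_B
      (hv.hasProductRows_B.isProductLayer_comp_rot_rot hg k) hZ (h35 k).symm (h12 k).symm (hlo k)
      (hhi k)
    exact ⟨w, hw.of_rot.of_rot⟩

theorem IsProductAcross.isFilterFree {c : Cut} {v : ThreeQudit d} (hv : IsProductAcross c v) :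
    IsFilterFree (pairing (v ∘ (cutEquiv d c).symm)) := by
  obtain ⟨x, y, hxy⟩ := hv
  have key (x' : Fin d → ℂ) (y' : Fin d × Fin d → ℂ) :
      pairing (v ∘ (cutEquiv d c).symm) x' y' = (∑ a, x' a * x a) * ∑ s, y' s * y s := by
    rw [pairing_apply, Finset.sum_mul_sum, Fintype.sum_prod_type]
    refine Finset.sum_congr rfl fun a _ => Finset.sum_congr rfl fun s _ => ?_
    rw [Function.comp_apply, hxy, Equiv.apply_symm_apply, smul_eq_mul]
    ring
  intro x' x'' y' y'' h
  rw [key, mul_eq_zero] at h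
  rw [key, key]
  obtain h | h := h <;> simp [h]

theorem face_f5_add_face_f6_eq_zero {k : Fin (numLayers d)} (hf : IsBlockConst f g)
    (hz : ∀ t ∉ subcube d k, f t = 0) (hs : ∑ t, f t = 0) (hrow : HasProductRows f) :
    g (.face k .f5) + g (.face k .f6) = 0 := by
  have hlayer : IsProductLayer g k (f '' subcube d (k + 1)) := hrow.isProductLayer hf
  have hZ := image_subcube_nonempty f k
  by_cases h1 : g (.face k .f1) = 0
  · by_cases h56 : g (.face k .f5) ≠ 0 ∨ g (.face k .f6) ≠ 0
    · obtain ⟨hface, hlo, hhi, hin⟩ := hlayer.eq_zero_of_f1_eq_zero hZ h1 h56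
      have vanish (t : Cube d) (ht : t ∉ (Cell.face k .f5).box ∪ (Cell.face k .f6).box) :
          f t = 0 := by
        rw [Finset.mem_union, not_or] at ht
        by_cases hk : t ∈ subcube d k
        · obtain h | h | ⟨p, h⟩ | h := Cell.layer_cases k hk
          exacts [(hf _ _ h).trans hlo, (hf _ _ h).trans hhi,
            (hf _ _ h).trans (hface p (by rintro rfl; exact ht.1 h) (by rintro rfl; exact ht.2 h)),
            hin _ ⟨t, h, rfl⟩]
        · exact hz t hk
      have hdisj : Disjoint (Cell.face k .f5).box (Cell.face k .f6).box :=
        Finset.disjoint_left.2 fun t h h' => by cases Cell.eq_of_mem h h'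
      rw [← Finset.sum_subset (Finset.subset_univ _) fun t _ => vanish t, Finset.sum_union hdisj,
        Finset.sum_congr rfl (hf _), Finset.sum_congr rfl (hf _), Finset.sum_const,
        Finset.sum_const, Cell.card_box_face, Cell.card_box_face, ← smul_add, smul_eq_zero] at hs
      exact hs.resolve_left (pow_ne_zero 2 (side_pos k).ne')
    · push Not at h56
      rw [h56.1, h56.2, add_zero]
  · by_cases h5 : g (.face k .f5) = 0
    · rw [h5, (hlayer.eq_zero_of_f1_ne_zero hZ h1 h5).1 .f6 nofun, add_zero]
    · exact absurd (((hlayer.isTwoValuedLayer_of_f1_f5 hZ h1 h5).eq_zero hf hz hs).1 .f1) h1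

end ProductVectors

section ProductBases

variable {d : ℕ} {c c' : Cell d}

theorem isProductAcross_A_minusVec (h : c.fst = c'.fst) : IsProductAcross .A_BC (minusVec c c') :=
  ⟨indVec c.fst.coords, WithLp.toLp 2 fun s =>
    (c'.box.card / c.box.card : ℂ) * (indVec c.snd.coords s.1 * indVec c.trd.coords s.2) -
      indVec c'.snd.coords s.1 * indVec c'.trd.coords s.2, fun t => by
    simp only [minusVec, cellVec, PiLp.sub_apply, PiLp.smul_apply, tri_apply, smul_eq_mul, cutEquiv,
      Equiv.refl_apply, ← h]
    ring⟩

theorem isProductAcross_B_minusVec (h : c.snd = c'.snd) : IsProductAcross .B_AC (minusVec c c') :=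
  ⟨indVec c.snd.coords, WithLp.toLp 2 fun s =>
    (c'.box.card / c.box.card : ℂ) * (indVec c.fst.coords s.1 * indVec c.trd.coords s.2) -
      indVec c'.fst.coords s.1 * indVec c'.trd.coords s.2, fun t => by
    simp only [minusVec, cellVec, PiLp.sub_apply, PiLp.smul_apply, tri_apply, smul_eq_mul, cutEquiv,
      Equiv.coe_fn_mk, ← h]
    ring⟩

theorem isProductAcross_C_minusVec (h : c.trd = c'.trd) : IsProductAcross .C_AB (minusVec c c') :=
  ⟨indVec c.trd.coords, WithLp.toLp 2 fun s =>
    (c'.box.card / c.box.card : ℂ) * (indVec c.fst.coords s.1 * indVec c.snd.coords s.2) -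
      indVec c'.fst.coords s.1 * indVec c'.snd.coords s.2, fun t => by
    simp only [minusVec, cellVec, PiLp.sub_apply, PiLp.smul_apply, tri_apply, smul_eq_mul, cutEquiv,
      Equiv.coe_fn_mk, ← h]
    ring⟩

variable [NeZero d] {V : LayerVectors d} {v : ThreeQudit d}

omit [NeZero d] in
theorem isFullyProduct_of_mem_block (hv : v ∈ block V c) : IsFullyProduct v := by
  obtain ⟨x, -, y, -, z, -, rfl⟩ := hv
  exact ⟨x, y, z, rfl⟩

theorem isFullyProduct_of_mem_productBasis (hv : v ∈ productBasis V) : IsFullyProduct v := by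
  rw [productBasis_eq] at hv
  obtain hv | rfl := hv
  · obtain ⟨c, hv, -⟩ := Set.mem_iUnion.1 hv
    exact isFullyProduct_of_mem_block hv
  · exact ⟨_, _, _, rfl⟩

theorem isBiseparable_of_mem_symmetricBasis (hv : v ∈ symmetricBasis V) : IsBiseparable v := by
  rw [symmetricBasis_eq_extendedBasis, extendedBasis, ← productBasis_eq] at hv
  obtain hv | ⟨⟨k, i⟩, rfl⟩ := hv
  · exact ⟨.A_BC, (isFullyProduct_of_mem_productBasis hv).isProductAcross _⟩
  · fin_cases i
    · exact ⟨_, isProductAcross_C_minusVec rfl⟩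
    · exact ⟨_, isProductAcross_B_minusVec rfl⟩
    · exact ⟨_, isProductAcross_A_minusVec rfl⟩

theorem isProductAcross_of_mem_asymmetricBasis (hv : v ∈ asymmetricBasis V) :
    IsProductAcross .C_AB v := by
  rw [asymmetricBasis_eq_extendedBasis, extendedBasis, ← productBasis_eq] at hv
  obtain hv | ⟨⟨k, i⟩, rfl⟩ := hv
  · exact (isFullyProduct_of_mem_productBasis hv).isProductAcross _
  · fin_cases i <;> exact isProductAcross_C_minusVec rfl

variable (V)

theorem isOrthogonalProductBasis_twistedBasis : IsOrthogonalProductBasis (twistedBasis V) := by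
  rw [twistedBasis_eq]
  have h := isOrthogonalSet_iUnion_block V
  refine ⟨⟨h.ne_zero, h.pairwise, fun v hv => ?_⟩, span_iUnion_block V⟩
  obtain ⟨c, hv⟩ := Set.mem_iUnion.1 hv
  exact isFullyProduct_of_mem_block hv

theorem isOrthogonalFamily_productBasis : IsOrthogonalFamily IsFullyProduct (productBasis V) := by
  have h := (isOrthogonalSet_extendedBasis_and_ncard V (κ := Empty) (P := fun e => e.elim)
    (N := fun e => e.elim) (Function.injective_of_subsingleton _)).1
  rw [← productBasis_eq_extendedBasis] at h
  exact ⟨h.ne_zero, h.pairwise, fun _ => isFullyProduct_of_mem_productBasis⟩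

theorem ncard_productBasis : (productBasis V).ncard + 8 * numLayers d = d ^ 3 := by
  rw [productBasis_eq_extendedBasis, (isOrthogonalSet_extendedBasis_and_ncard V
    (Function.injective_of_subsingleton _)).2, Fintype.card_empty, add_zero]

theorem finrank_complementary_productBasis :
    finrank ℂ (complementary (productBasis V)) = 8 * numLayers d := by
  rw [productBasis_eq_extendedBasis,
    ← finrank_complementary_extendedBasis V (κ := Empty) (Function.injective_of_subsingleton _),
    Fintype.card_empty, add_zero]

theorem mem_complementary_productBasis {f : ThreeQudit d} :
    f ∈ complementary (productBasis V) ↔ ∃ g, IsBlockConst f g ∧ ∑ t, f t = 0 := by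
  rw [productBasis_eq_extendedBasis, mem_complementary_extendedBasis]
  simp only [IsEmpty.forall_iff, and_true]

theorem isOrthogonalFamily_symmetricBasis :
    IsOrthogonalFamily IsBiseparable (symmetricBasis V) := by
  have h := (isOrthogonalSet_extendedBasis_and_ncard V injective_sumElim_symFst_symSnd).1
  rw [← symmetricBasis_eq_extendedBasis] at h
  exact ⟨h.ne_zero, h.pairwise, fun _ => isBiseparable_of_mem_symmetricBasis⟩

theorem ncard_symmetricBasis : (symmetricBasis V).ncard + 5 * numLayers d = d ^ 3 := by
  have := (isOrthogonalSet_extendedBasis_and_ncard V injective_sumElim_symFst_symSnd).2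
  rw [← symmetricBasis_eq_extendedBasis, Fintype.card_prod, Fintype.card_fin,
    Fintype.card_fin] at this
  omega

theorem finrank_complementary_symmetricBasis :
    finrank ℂ (complementary (symmetricBasis V)) = 5 * numLayers d := by
  have := finrank_complementary_extendedBasis V injective_sumElim_symFst_symSnd
  rw [← symmetricBasis_eq_extendedBasis, Fintype.card_prod, Fintype.card_fin,
    Fintype.card_fin] at this
  omega

theorem isOrthogonalFamily_asymmetricBasis :
    IsOrthogonalFamily (IsProductAcross .C_AB) (asymmetricBasis V) := by
  have h := (isOrthogonalSet_extendedBasis_and_ncard V injective_sumElim_asymFst_asymSnd).1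
  rw [← asymmetricBasis_eq_extendedBasis] at h
  exact ⟨h.ne_zero, h.pairwise, fun _ => isProductAcross_of_mem_asymmetricBasis⟩

theorem ncard_asymmetricBasis : (asymmetricBasis V).ncard + 4 * numLayers d = d ^ 3 := by
  have := (isOrthogonalSet_extendedBasis_and_ncard V injective_sumElim_asymFst_asymSnd).2
  rw [← asymmetricBasis_eq_extendedBasis, Fintype.card_prod, Fintype.card_fin,
    Fintype.card_fin] at this
  omega

theorem finrank_complementary_asymmetricBasis :
    finrank ℂ (complementary (asymmetricBasis V)) = 4 * numLayers d := by
  have := finrank_complementary_extendedBasis V injective_sumElim_asymFst_asymSnd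
  rw [← asymmetricBasis_eq_extendedBasis, Fintype.card_prod, Fintype.card_fin,
    Fintype.card_fin] at this
  omega

theorem eq_zero_of_mem_complementary_asymmetricBasis {v : ThreeQudit d}
    (hv : v ∈ complementary (asymmetricBasis V)) {c : Cut} (hp : IsProductAcross c v) : v = 0 := by
  rw [asymmetricBasis_eq_extendedBasis] at hv
  obtain ⟨g, hg, hs, hpair⟩ := (mem_complementary_extendedBasis V).1 hv
  exact hp.eq_zero_of_asymmetric hg hs (fun k => hpair (k, 0)) (fun k => hpair (k, 1))
    (fun k => hpair (k, 2)) fun k => hpair (k, 3)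

end ProductBases

section Unextendible

variable {d : ℕ} (hd : 3 ≤ d) (V : LayerVectors d)

theorem isUnextendible_of_finrank_ne_zero {P : ThreeQudit d → Prop} {U : Set (ThreeQudit d)}
    (hU : IsOrthogonalFamily P U) (hfr : finrank ℂ (complementary U) ≠ 0)
    (h : ∀ v ∈ complementary U, P v → v = 0) : IsUnextendible P U :=
  ⟨hU, fun htop => hfr (by
    rw [complementary, htop, Submodule.top_orthogonal_eq_bot, finrank_bot]), h⟩

include hd

theorem numLayers_pos : 0 < numLayers d := Nat.div_pos (by omega) two_pos

theorem isUPB_productBasis : IsUPB (productBasis V) := by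
  have : NeZero d := ⟨by omega⟩
  have hn := numLayers_pos hd
  refine isUnextendible_of_finrank_ne_zero (isOrthogonalFamily_productBasis V) ?_ fun v hv hp => ?_
  · rw [finrank_complementary_productBasis]
    omega
  · obtain ⟨g, hg, hs⟩ := (mem_complementary_productBasis V).1 hv
    exact hp.eq_zero hg hs

theorem isUBB_symmetricBasis : IsUBB (symmetricBasis V) := by
  have : NeZero d := ⟨by omega⟩
  have hn := numLayers_pos hd
  refine isUnextendible_of_finrank_ne_zero (isOrthogonalFamily_symmetricBasis V) ?_ ?_
  · rw [finrank_complementary_symmetricBasis]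
    omega
  · rintro v hv ⟨c, hp⟩
    rw [symmetricBasis_eq_extendedBasis] at hv
    obtain ⟨g, hg, hs, hpair⟩ := (mem_complementary_extendedBasis V).1 hv
    have := symmetric_eq_zero_across c hg hs hp.isFilterFree (fun k => hpair (k, 0))
      (fun k => hpair (k, 1)) fun k => hpair (k, 2)
    exact PiLp.ext (congrFun this)

theorem isUPBAcross_asymmetricBasis : IsUPBAcross .C_AB (asymmetricBasis V) := by
  have : NeZero d := ⟨by omega⟩
  have hn := numLayers_pos hd
  refine isUnextendible_of_finrank_ne_zero (isOrthogonalFamily_asymmetricBasis V) ?_ fun _ hv =>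
    eq_zero_of_mem_complementary_asymmetricBasis V hv
  rw [finrank_complementary_asymmetricBasis]
  omega

theorem isUBB_asymmetricBasis : IsUBB (asymmetricBasis V) := by
  have : NeZero d := ⟨by omega⟩
  obtain ⟨⟨h0, horth, hprod⟩, hproper, -⟩ := isUPBAcross_asymmetricBasis hd V
  exact ⟨⟨h0, horth, fun v hv => ⟨_, hprod v hv⟩⟩, hproper, fun v hv ⟨_, hp⟩ =>
    eq_zero_of_mem_complementary_asymmetricBasis V hv hp⟩

end Unextendible

section GramSupport

variable {ι H : Type*} [Fintype ι] [DecidableEq ι] [NormedAddCommGroup H] [InnerProductSpace ℂ H]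

theorem sum_smul_eq_zero_iff_forall_mem_support (Φ : ι → H) (u : ι → ℂ) :
    ∑ t, u t • Φ t = 0 ↔ ∀ f ∈ support (gram ℂ Φ), ∑ t, star (u t) * f t = 0 := by
  rw [← gram_mulVec_eq_zero_iff, ← mem_orthogonal_support_iff (isHermitian_gram ℂ Φ),
    Submodule.mem_orthogonal']
  simp only [PiLp.inner_apply, RCLike.inner_apply, RCLike.star_def, mul_comm]

theorem apply_eq_apply_iff_forall_mem_support (Φ : ι → H) (s t : ι) :
    Φ s = Φ t ↔ ∀ f ∈ support (gram ℂ Φ), f s = f t := by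
  have := sum_smul_eq_zero_iff_forall_mem_support Φ (Pi.single s 1 - Pi.single t 1)
  simpa [Pi.single_apply, sub_smul, sub_mul, sub_eq_zero] using this

theorem sum_eq_zero_iff_forall_mem_support (Φ : ι → H) :
    ∑ t, Φ t = 0 ↔ ∀ f ∈ support (gram ℂ Φ), ∑ t, f t = 0 := by
  simpa using sum_smul_eq_zero_iff_forall_mem_support Φ 1

end GramSupport

section DistillableStates

variable {d : ℕ} [NeZero d] {V : LayerVectors d} {κ : Type*} {P N : κ → Cell d}

theorem exists_isBlockConst_of_support_gram_le {H : Type*} [NormedAddCommGroup H]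
    [InnerProductSpace ℂ H] {Φ : Cube d → H}
    (hΦ : support (gram ℂ Φ) ≤ complementary (extendedBasis V P N)) :
    ∃ g, IsBlockConst Φ g ∧ ∑ t, Φ t = 0 ∧ ∀ i, g (P i) = g (N i) := by
  choose pt hpt using fun c : Cell d => c.box_nonempty
  refine ⟨Φ ∘ pt, fun c t ht => ?_, ?_, fun i => ?_⟩
  · refine (apply_eq_apply_iff_forall_mem_support Φ _ _).2 fun f hf => ?_
    obtain ⟨g, hg, -, -⟩ := (mem_complementary_extendedBasis V).1 (hΦ hf)
    rw [hg c t ht, hg c _ (hpt c)]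
  · refine (sum_eq_zero_iff_forall_mem_support Φ).2 fun f hf => ?_
    obtain ⟨g, -, hs, -⟩ := (mem_complementary_extendedBasis V).1 (hΦ hf)
    exact hs
  · refine (apply_eq_apply_iff_forall_mem_support Φ _ _).2 fun f hf => ?_
    obtain ⟨g, hg, -, hpair⟩ := (mem_complementary_extendedBasis V).1 (hΦ hf)
    rw [hg _ _ (hpt _), hg _ _ (hpt _), hpair i]

omit [NeZero d] in
theorem isFilterFree_of_not_isOneDistillable_across {H : Type*} [NormedAddCommGroup H]
    [InnerProductSpace ℂ H] {Φ : Cube d → H} {c : Cut}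
    (h : ¬ IsOneDistillable (across c (gram ℂ Φ))) :
    IsFilterFree (pairing (Φ ∘ (cutEquiv d c).symm)) :=
  isFilterFree_pairing h

theorem isOneDistillable_of_supportedOn_symmetricBasis {ρ : Matrix (Cube d) (Cube d) ℂ}
    (hρ : IsDensity ρ) (hS : SupportedOn ρ (complementary (symmetricBasis V))) (c : Cut) :
    IsOneDistillable (across c ρ) := by
  by_contra hnd
  obtain ⟨m, Φ, rfl⟩ := exists_eq_gram hρ.1
  rw [supportedOn_iff_support_le, symmetricBasis_eq_extendedBasis] at hS
  obtain ⟨g, hg, hs, hpair⟩ := exists_isBlockConst_of_support_gram_le hS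
  have hΦ : Φ = 0 := symmetric_eq_zero_across c hg hs
    (isFilterFree_of_not_isOneDistillable_across hnd) (fun k => hpair (k, 0))
    (fun k => hpair (k, 1)) fun k => hpair (k, 2)
  have := hρ.2
  simp [hΦ, Matrix.trace] at this

theorem minusVec_mem_complementary_productBasis (c c' : Cell d) :
    minusVec c c' ∈ complementary (productBasis V) := by
  rw [productBasis_eq, complementary, mem_orthogonal_span_iff]
  rintro u (hu | rfl)
  · simp only [minusVec, inner_sub_right, inner_smul_right, inner_reducedBasis_cellVec V hu,
      mul_zero, sub_zero]
  · rw [inner_eq_zero_symm, inner_minusVec_stopper]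

omit [NeZero d] in
theorem isBlockConst_minusVec [DecidableEq (Cell d)] (c c' : Cell d) :
    IsBlockConst (minusVec c c')
      ((c'.box.card / c.box.card : ℂ) • Pi.single c 1 - Pi.single c' 1) := fun c'' t ht => by
  simp only [minusVec, PiLp.sub_apply, PiLp.smul_apply, Pi.sub_apply, Pi.smul_apply,
    isBlockConst_cellVec _ c'' t ht]

variable (V)

theorem exists_mem_complementary_asymmetricBasis (k : Fin (numLayers d)) :
    ∃ f ∈ complementary (asymmetricBasis V), ∃ g, IsBlockConst f g ∧ g (.lo k) = 1 ∧
      g (.face k .f1) = 0 ∧ g (.face k .f3) = 0 := by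
  classical
  have h := add_mem (minusVec_mem_complementary_productBasis (V := V) (.lo k) (.hi k))
    (minusVec_mem_complementary_productBasis (.face k .f4) (.face k .f6))
  obtain ⟨-, -, hs⟩ := (mem_complementary_productBasis V).1 h
  have hg : IsBlockConst ⇑(minusVec (.lo k) (.hi k) + minusVec (.face k .f4) (.face k .f6)) _ :=
    fun c t ht => congrArg₂ (· + ·) (isBlockConst_minusVec _ _ c t ht)
      (isBlockConst_minusVec _ _ c t ht)
  refine ⟨_, ?_, _, hg, ?_, ?_, ?_⟩
  · rw [asymmetricBasis_eq_extendedBasis]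
    refine (mem_complementary_extendedBasis V).2 ⟨_, hg, hs, fun ⟨l, i⟩ => ?_⟩
    have := (side_pos k).ne'
    fin_cases i <;> simp [asymFst, asymSnd, Pi.single_apply, Cell.card_box_face,
      Cell.card_box_lo, Cell.card_box_hi, this]
  all_goals simp [Cell.card_box_lo, Cell.card_box_hi]

theorem exists_projState_asymmetricBasis_eq_gram :
    ∃ (m : ℕ) (Φ : Cube d → EuclideanSpace ℂ (Fin m)) (g : Cell d → EuclideanSpace ℂ (Fin m)),
      projState (complementary (asymmetricBasis V)) = gram ℂ Φ ∧ IsBlockConst Φ g ∧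
      (∀ i, g (asymFst i) = g (asymSnd i)) ∧
      ∀ k, g (.lo k) ≠ g (.face k .f1) ∧ g (.lo k) ≠ g (.face k .f3) := by
  obtain ⟨m, Φ, hΦ⟩ := exists_eq_gram (posSemidef_projState (complementary (asymmetricBasis V)))
  have hS := support_projState (complementary (asymmetricBasis V))
  rw [hΦ] at hS
  have hle : support (gram ℂ Φ) ≤ complementary (extendedBasis V asymFst asymSnd) := by
    rw [hS, asymmetricBasis_eq_extendedBasis]
  obtain ⟨g, hg, -, hpair⟩ := exists_isBlockConst_of_support_gram_le hle
  refine ⟨m, Φ, g, hΦ, hg, hpair, fun k => ?_⟩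
  obtain ⟨f, hf, gf, hgf, hlo, h1, h3⟩ := exists_mem_complementary_asymmetricBasis V k
  constructor <;> intro h
  · rw [← hg.apply_lo, ← hg.apply_f1 (low_mem_eta k) (high_mem_xi k)] at h
    have := (apply_eq_apply_iff_forall_mem_support Φ _ _).1 h f (hS ▸ hf)
    rw [hgf.apply_lo, hgf.apply_f1 (low_mem_eta k) (high_mem_xi k), hlo, h1] at this
    exact one_ne_zero this
  · rw [← hg.apply_lo, ← hg.apply_f3 (high_mem_xi k) (low_mem_eta k)] at h
    have := (apply_eq_apply_iff_forall_mem_support Φ _ _).1 h f (hS ▸ hf)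
    rw [hgf.apply_lo, hgf.apply_f3 (high_mem_xi k) (low_mem_eta k), hlo, h3] at this
    exact one_ne_zero this

end DistillableStates

section AsymmetricDistillability

variable {d : ℕ} (hd : 3 ≤ d) (V : LayerVectors d)

theorem eq_of_inner_sub_eq_zero {H : Type*} [NormedAddCommGroup H] [InnerProductSpace ℂ H]
    {p s : H} (hs : inner ℂ s (s - p) = 0) (hp : inner ℂ p (s - p) = 0) : s = p := by
  rw [← sub_eq_zero, ← inner_self_eq_zero (𝕜 := ℂ), inner_sub_left, hs, hp, sub_zero]

include hd

theorem isOneDistillable_A_asymmetricBasis :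
    IsOneDistillable (across .A_BC (projState (complementary (asymmetricBasis V)))) := by
  have : NeZero d := ⟨by omega⟩
  obtain ⟨m, Φ, g, hΦ, hg, hpair, hne⟩ := exists_projState_asymmetricBasis_eq_gram V
  rw [hΦ]
  by_contra hnd
  obtain ⟨k⟩ : Nonempty (Fin (numLayers d)) := ⟨⟨0, numLayers_pos hd⟩⟩
  have h12 : g (.face k .f1) = g (.face k .f2) := hpair (k, 0)
  have hlo4 : g (.lo k) = g (.face k .f4) := hpair (k, 2)
  have hfree : IsFilterFree (pairing Φ) :=
    isFilterFree_of_not_isOneDistillable_across (c := .A_BC) hnd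
  have orth := inner_row_lo_sub_f1 hg hfree (next_mem_xi k)
  refine (hne k).1 (eq_of_inner_sub_eq_zero ?_ ?_)
  · have := orth (next k, low k)
    rwa [hg.apply_f4 (next_mem_eta k) (next_mem_xi k), ← hlo4] at this
  · have := orth (high k, next k)
    rwa [hg.apply_f2 (next_mem_eta k) (next_mem_xi k), ← h12] at this

theorem isOneDistillable_B_asymmetricBasis :
    IsOneDistillable (across .B_AC (projState (complementary (asymmetricBasis V)))) := by
  have : NeZero d := ⟨by omega⟩
  obtain ⟨m, Φ, g, hΦ, hg, hpair, hne⟩ := exists_projState_asymmetricBasis_eq_gram V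
  rw [hΦ]
  by_contra hnd
  obtain ⟨k⟩ : Nonempty (Fin (numLayers d)) := ⟨⟨0, numLayers_pos hd⟩⟩
  have h35 : g (.face k .f3) = g (.face k .f5) := hpair (k, 1)
  have hlo4 : g (.lo k) = g (.face k .f4) := hpair (k, 2)
  have hf4 : Φ (low k, next k, low k) = Φ (next k, next k, low k) :=
    (hg.apply_f4 (low_mem_eta k) (next_mem_xi k)).trans
      (hg.apply_f4 (next_mem_eta k) (next_mem_xi k)).symm
  have orth (a c : Fin d) :
      inner ℂ (Φ (a, next k, c)) (g (.lo k) - g (.face k .f3)) = 0 := by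
    have := (isFilterFree_of_not_isOneDistillable_across hnd).inner_row_eq_zero
      (a := next k) (u := (low k, low k)) (v := (next k, low k)) hf4 (low k) (a, c)
    rwa [h35, ← hg.apply_lo,
      ← hg.apply_f5 (next_mem_xi k) (low_mem_eta k)]
  refine (hne k).2 (eq_of_inner_sub_eq_zero ?_ ?_)
  · have := orth (low k) (low k)
    rwa [hg.apply_f4 (low_mem_eta k) (next_mem_xi k), ← hlo4] at this
  · have := orth (high k) (next k)
    rwa [hg.apply_f3 (next_mem_xi k) (next_mem_eta k)] at this

end AsymmetricDistillability

section BoundEntanglement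

variable {d : ℕ}

/-- The two faces of the outer layer on which, for every product vector across a given
cut with block-constant entries of zero sum, the entries cancel. -/
def cancellingFaces : Cut → Face × Face
  | .A_BC => (.f5, .f6)
  | .B_AC => (.f4, .f3)
  | .C_AB => (.f1, .f2)

theorem IsProductAcross.add_cancellingFaces_eq_zero {c : Cut} {v : ThreeQudit d}
    {g : Cell d → ℂ} (hv : IsProductAcross c v) (hg : IsBlockConst v g) (hs : ∑ t, v t = 0)
    {k : Fin (numLayers d)} (hk : (k : ℕ) = 0) :
    g (.face k (cancellingFaces c).1) + g (.face k (cancellingFaces c).2) = 0 := by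
  have outside (f : Cube d → ℂ) : ∀ t ∉ subcube d k, f t = 0 := fun t ht =>
    absurd (hk ▸ mem_subcube_zero t) ht
  cases c
  · exact face_f5_add_face_f6_eq_zero hg (outside _) hs hv.hasProductRows
  · exact face_f5_add_face_f6_eq_zero hg.comp_cubeRot.comp_cubeRot (outside _)
      ((sum_comp_cubeRot _).trans ((sum_comp_cubeRot _).trans hs)) hv.hasProductRows_B
  · exact face_f5_add_face_f6_eq_zero hg.comp_cubeRot (outside _)
      ((sum_comp_cubeRot _).trans hs) hv.hasProductRows_C

theorem le_span_of_isSeparable_across_projState {S : Submodule ℂ (ThreeQudit d)} {c : Cut}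
    (h : IsSeparable (across c (projState S))) :
    S ≤ Submodule.span ℂ {v | v ∈ S ∧ IsProductAcross c v} := by
  have := support_le_span_of_mem_convexHull (mem_convexHull_of_isSeparable_across h)
  rwa [support_projState] at this

theorem IsUnextendible.not_isSeparable_across {c : Cut} {U : Set (ThreeQudit d)}
    (hU : IsUnextendible (IsProductAcross c) U) :
    ¬ IsSeparable (across c (projState (complementary U))) := fun h => by
  have hzero := eq_zero_of_mem_convexHull hU
    (supportedOn_iff_support_le.2 (support_projState _).le) (mem_convexHull_of_isSeparable_across h)
  have hbot : complementary U = ⊥ := by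
    rw [← support_projState (complementary U), support_eq_bot_iff, hzero]
  exact hU.proper (Submodule.orthogonal_eq_bot_iff.1 hbot)

variable (hd : 3 ≤ d) (V : LayerVectors d)

include hd

theorem not_isSeparable_across_productBasis (c : Cut) :
    ¬ IsSeparable (across c (projState (complementary (productBasis V)))) := fun h => by
  classical
  have : NeZero d := ⟨by omega⟩
  let k : Fin (numLayers d) := ⟨0, numLayers_pos hd⟩
  obtain ⟨s, hs⟩ := (Cell.face k (cancellingFaces c).1).box_nonempty
  obtain ⟨t, ht⟩ := (Cell.face k (cancellingFaces c).2).box_nonempty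
  have cancel : ∀ f ∈ complementary (productBasis V), f s + f t = 0 := fun f hf => by
    refine Submodule.span_induction (fun v hv => ?_) (add_zero _) (fun v w _ _ hv hw => ?_)
      (fun a v _ hv => ?_) (le_span_of_isSeparable_across_projState h hf)
    · obtain ⟨g, hg, hsum⟩ := (mem_complementary_productBasis V).1 hv.1
      rw [hg _ s hs, hg _ t ht, hv.2.add_cancellingFaces_eq_zero hg hsum rfl]
    · rw [PiLp.add_apply, PiLp.add_apply, add_add_add_comm, hv, hw, add_zero]
    · rw [PiLp.smul_apply, PiLp.smul_apply, ← smul_add, hv, smul_zero]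
  have := cancel _ (minusVec_mem_complementary_productBasis (.lo k) (.face k (cancellingFaces c).1))
  rw [isBlockConst_minusVec _ _ _ s hs, isBlockConst_minusVec _ _ _ t ht] at this
  cases c <;> simp [cancellingFaces] at this

theorem isBoundEntangled_productBasis (c : Cut) :
    IsPPT (across c (projState (complementary (productBasis V)))) ∧
      IsBoundEntangled (across c (projState (complementary (productBasis V)))) := by
  have : NeZero d := ⟨by omega⟩
  obtain ⟨h0, horth, hprod⟩ := isOrthogonalFamily_productBasis V
  have hppt : IsPPT (across c (projState (complementary (productBasis V)))) :=
    isPPT_across_projState ⟨h0, horth, fun v hv => (hprod v hv).isProductAcross c⟩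
  exact ⟨hppt, not_isSeparable_across_productBasis hd V c, not_isDistillable_of_isPPT hppt⟩

theorem isBoundEntangled_asymmetricBasis :
    IsPPT (across .C_AB (projState (complementary (asymmetricBasis V)))) ∧
      IsBoundEntangled (across .C_AB (projState (complementary (asymmetricBasis V)))) := by
  have : NeZero d := ⟨by omega⟩
  have hU := isUPBAcross_asymmetricBasis hd V
  have hppt := isPPT_across_projState hU.family
  exact ⟨hppt, hU.not_isSeparable_across, not_isDistillable_of_isPPT hppt⟩

end BoundEntanglement

end

end BlockCube

open BlockCube in
theorem mainTheorem7_general (d : ℕ) (hd : 3 ≤ d) :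
    Nonempty (LayerVectors d) ∧
    (∀ V : LayerVectors d,
      IsOrthogonalProductBasis (twistedBasis V) ∧
      (IsUPB (productBasis V) ∧
        (productBasis V).ncard + 8 * numLayers d = d ^ 3 ∧
        Module.finrank ℂ (complementary (productBasis V)) = 8 * numLayers d) ∧
      (IsUBB (symmetricBasis V) ∧
        (symmetricBasis V).ncard + 5 * numLayers d = d ^ 3 ∧
        Module.finrank ℂ (complementary (symmetricBasis V)) = 5 * numLayers d) ∧
      (∀ ρ : Matrix (Cube d) (Cube d) ℂ, IsDensity ρ →
        SupportedOn ρ (complementary (symmetricBasis V)) →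
          IsGenuinelyEntangled ρ ∧
          ∀ c : Cut, IsOneDistillable (across c ρ) ∧ IsDistillable (across c ρ)) ∧
      (IsUBB (asymmetricBasis V) ∧
        IsUPBAcross .C_AB (asymmetricBasis V) ∧
        (asymmetricBasis V).ncard + 4 * numLayers d = d ^ 3 ∧
        Module.finrank ℂ (complementary (asymmetricBasis V)) = 4 * numLayers d) ∧
      (∀ ρ : Matrix (Cube d) (Cube d) ℂ, IsDensity ρ →
        SupportedOn ρ (complementary (asymmetricBasis V)) → IsGenuinelyEntangled ρ) ∧
      (IsPPT (across .C_AB (projState (complementary (asymmetricBasis V)))) ∧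
        IsBoundEntangled (across .C_AB (projState (complementary (asymmetricBasis V)))) ∧
        IsOneDistillable (across .A_BC (projState (complementary (asymmetricBasis V)))) ∧
        IsOneDistillable (across .B_AC (projState (complementary (asymmetricBasis V))))) ∧
      (∀ c : Cut, IsPPT (across c (projState (complementary (productBasis V)))) ∧
        IsBoundEntangled (across c (projState (complementary (productBasis V)))))) ∧
    (∀ (c : Cut) (S : Submodule ℂ (ThreeQudit d)),
      (across c (projMatrix S)).rank <
          max (reducedFst (across c (projMatrix S))).rank
            (reducedSnd (across c (projMatrix S))).rank →
        ∀ ρ : Matrix (Cube d) (Cube d) ℂ, IsDensity ρ → SupportedOn ρ S →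
          ρ.rank = Module.finrank ℂ S → IsOneDistillable (across c ρ)) := by
  have : NeZero d := ⟨by omega⟩
  refine ⟨nonempty_layerVectors d, fun V => ⟨isOrthogonalProductBasis_twistedBasis V,
    ⟨isUPB_productBasis hd V, ncard_productBasis V, finrank_complementary_productBasis V⟩,
    ⟨isUBB_symmetricBasis hd V, ncard_symmetricBasis V, finrank_complementary_symmetricBasis V⟩,
    fun ρ hρ hS => ⟨isGenuinelyEntangled_of_isUBB (isUBB_symmetricBasis hd V) hρ hS, fun c => ?_⟩,
    ⟨isUBB_asymmetricBasis hd V, isUPBAcross_asymmetricBasis hd V, ncard_asymmetricBasis V,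
      finrank_complementary_asymmetricBasis V⟩,
    fun ρ => isGenuinelyEntangled_of_isUBB (isUBB_asymmetricBasis hd V),
    ⟨(isBoundEntangled_asymmetricBasis hd V).1, (isBoundEntangled_asymmetricBasis hd V).2,
      isOneDistillable_A_asymmetricBasis hd V, isOneDistillable_B_asymmetricBasis hd V⟩,
    isBoundEntangled_productBasis hd V⟩,
    fun c S hr ρ hρ hS hdim => isOneDistillable_across_of_rank_lt hr hρ.1 hS hdim⟩
  have h := isOneDistillable_of_supportedOn_symmetricBasis hρ hS c
  exact ⟨h, isDistillable_of_isOneDistillable h⟩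

open BlockCube in
theorem mainTheorem7 (d : ℕ) (hd : 4 ≤ d) :
    -- the construction can be carried out
    Nonempty (LayerVectors d) ∧
    -- and for every choice of the local vectors:
    (∀ V : LayerVectors d,
      -- twisted product basis
      IsOrthogonalProductBasis (twistedBasis V) ∧
      -- unextendible product basis, with a completely entangled complement
      (IsUPB (productBasis V) ∧
        (productBasis V).ncard + 8 * numLayers d = d ^ 3 ∧
        Module.finrank ℂ (complementary (productBasis V)) = 8 * numLayers d) ∧
      -- symmetric unextendible biseparable basis
      (IsUBB (symmetricBasis V) ∧
        (symmetricBasis V).ncard + 5 * numLayers d = d ^ 3 ∧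
        Module.finrank ℂ (complementary (symmetricBasis V)) = 5 * numLayers d) ∧
      -- its complement is genuinely entangled and distillable across every cut
      (∀ ρ : Matrix (Cube d) (Cube d) ℂ, IsDensity ρ →
        SupportedOn ρ (complementary (symmetricBasis V)) →
          IsGenuinelyEntangled ρ ∧
          ∀ c : Cut, IsOneDistillable (across c ρ) ∧ IsDistillable (across c ρ)) ∧
      -- asymmetric unextendible biseparable basis, a UPB in the cut AB|C
      (IsUBB (asymmetricBasis V) ∧
        IsUPBAcross .C_AB (asymmetricBasis V) ∧
        (asymmetricBasis V).ncard + 4 * numLayers d = d ^ 3 ∧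
        Module.finrank ℂ (complementary (asymmetricBasis V)) = 4 * numLayers d) ∧
      (∀ ρ : Matrix (Cube d) (Cube d) ℂ, IsDensity ρ →
        SupportedOn ρ (complementary (asymmetricBasis V)) → IsGenuinelyEntangled ρ) ∧
      -- its normalized projector is bound entangled in AB|C, 1-distillable in the other cuts
      (IsPPT (across .C_AB (projState (complementary (asymmetricBasis V)))) ∧
        IsBoundEntangled (across .C_AB (projState (complementary (asymmetricBasis V)))) ∧
        IsOneDistillable (across .A_BC (projState (complementary (asymmetricBasis V)))) ∧
        IsOneDistillable (across .B_AC (projState (complementary (asymmetricBasis V))))) ∧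
      -- the normalized projector on the complement of the UPB is bound entangled in every cut
      (∀ c : Cut, IsPPT (across c (projState (complementary (productBasis V)))) ∧
        IsBoundEntangled (across c (projState (complementary (productBasis V)))))) ∧
    -- rank criterion for 1-distillability across every cut
    (∀ (c : Cut) (S : Submodule ℂ (ThreeQudit d)),
      (across c (projMatrix S)).rank <
          max (reducedFst (across c (projMatrix S))).rank
            (reducedSnd (across c (projMatrix S))).rank →
        ∀ ρ : Matrix (Cube d) (Cube d) ℂ, IsDensity ρ → SupportedOn ρ S →
          ρ.rank = Module.finrank ℂ S → IsOneDistillable (across c ρ)) :=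
  mainTheorem7_general d (by omega)
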